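/- **Setting.** Let $\mathbb T^3=\mathbb R^3/\mathbb Z^3$ with normalized Lebesgue measure. Let $L^2=L^2(\mathbb T^3;\mathbb R^3)$ and let $H^s=H^s(\mathbb T^3;\mathbb R^3)$ have norm $\|v\|_{H^s}=\|(\mathrm{Id}-\Delta)^{s/2}v\|_{L^2}$, where $(\mathrm{Id}-\Delta)^s$ is the Fourier multiplier with symbol $(1+4\pi^2|k|^2)^s$, $k\in\mathbb Z^3$. Let $\epsilon_0\in(0,1)$, $m\in\mathbb N$, and let $B_1,\dots,B_m$ be balls in $\{\xi\in\mathbb R^3:1<|\xi|<1+\frac{\epsilon_0}{2}\}$ such that $B_1,\dots,B_m,-B_1,\dots,-B_m$ are disjoint. Let $\psi_1,\dots,\psi_m:\mathbb R^3\to\mathbb R^3$ be divergence-free Schwartz vector fields with $\|\psi_i\|_{L^2(\mathbb R^3)}=1$ and with Fourier transform supported in $B_i\cup -B_i$. For $n\in\mathbb Z$ put $$\psi_{i,n}(x)=(1+\epsilon_0)^{3n/2}\,\psi_i\big((1+\epsilon_0)^n x\big),\qquad \psi^{\rm per}_{i,n}(x)=\sum_{l\in\mathbb Z^3}\psi_{i,n}(x+l),$$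 and $\tilde\psi_{i,n}=\psi^{\rm per}_{i,n}/\|\psi^{\rm per}_{i,n}\|_{L^2(\mathbb T^3)}$ (with $\tilde\psi_{i,n}=0$ if $\psi^{\rm per}_{i,n}=0$). Let $S=\{(0,0,0),(1,0,0),(0,1,0),(0,0,1)\}$ and let $\alpha_{i,\mu}\in\mathbb R$ for $i\in\{1,\dots,m\}^3$, $\mu\in S$. Define $$F(u)=\sum_{n\in\mathbb Z}\ \sum_{i\in\{1,\dots,m\}^3,\ \mu\in S}\alpha_{i,\mu}(1+\epsilon_0)^{\frac{5n}{2}}\langle u,\tilde\psi_{i_1,n+\mu_1}\rangle_{L^2}\langle u,\tilde\psi_{i_2,n+\mu_2}\rangle_{L^2}\,\tilde\psi_{i_3,n+\mu_3},$$ and $F_\rho(v)=(\mathrm{Id}-\Delta)^\rho F(u)$ with $u=(\mathrm{Id}-\Delta)^{-\rho}v$. For $\nu\ge 0$ and $T>0$, a *weak solution* on $[0,T]$ of $$\partial_t v=\Delta v+\nu\Delta v+F_\rho(v),\qquad v(0)=v_0, \tag{1}$$ is a $v\in C([0,T];L^2)\cap L^2(0,T;H^1)$ with $v(0)=v_0$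 such that for all $\varphi\in H^1$ the functions $s\mapsto\langle\nabla v(s),\nabla\varphi\rangle_{L^2}$ and $s\mapsto\langle F_\rho(v(s)),\varphi\rangle_{L^2}$ are integrable on $(0,T)$ and, for all $t\in[0,T]$, $$\langle v(t),\varphi\rangle_{L^2}=\langle v_0,\varphi\rangle_{L^2}-(1+\nu)\int_0^t\langle\nabla v(s),\nabla\varphi\rangle_{L^2}\,ds+\int_0^t\langle F_\rho(v(s)),\varphi\rangle_{L^2}\,ds .$$ **Lemma.** Let $\rho>\frac14$. Then: 1. ($F_\rho$ has zero mean.) For every $v\in H^1$, with $u=(\mathrm{Id}-\Delta)^{-\rho}v$, the series $$\sum_{n,i,\mu}\alpha_{i,\mu}(1+\epsilon_0)^{\frac{5n}{2}}\langle u,\tilde\psi_{i_1,n+\mu_1}\rangle_{L^2}\langle u,\tilde\psi_{i_2,n+\mu_2}\rangle_{L^2}\,(\mathrm{Id}-\Delta)^\rho\tilde\psi_{i_3,n+\mu_3}$$ converges absolutely in $L^2$, its sum is $F_\rho(v)$, and $\int_{\mathbb T^3}F_\rho(v)\,dx=0$. 2. (The dynamics preserve mean-zero functions.) If $\nu\ge0$,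 $T>0$, $\int_{\mathbb T^3}v_0\,dx=0$ and $v$ is a weak solution of (1) on $[0,T]$, then $\int_{\mathbb T^3}v(t)\,dx=0$ for all $t\in[0,T]$. 3. (Hypothesis (H4).) For every $R\ge0$ the set $$\mathcal K=\Big\{f\in L^2:\ \int_{\mathbb T^3}f\,dx=0,\ \|f\|_{L^2}\le R\Big\}$$ is convex, closed and bounded in $L^2$, and for every $T>0$ there is $\nu>0$ such that for every $v_0\in\mathcal K$ problem (1) has a global solution $v(\cdot;v_0,\nu)$, i.e. $v(\cdot;v_0,\nu):[0,\infty)\to L^2$ is a weak solution on $[0,T']$ for every $T'>0$, and moreover $$\sup_{v_0\in\mathcal K}\ \sup_{t\in[0,T]}\|v(t;v_0,\nu)\|_{L^2}<\infty .$$ -/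

import Mathlib

open MeasureTheory Set
open scoped ENNReal FourierTransform ComplexConjugate

noncomputable section

namespace AveragedNSE

/-! ### Vector fields on the flat torus `𝕋³ = ℝ³ / ℤ³` and Sobolev spaces -/

/-- Three-dimensional Euclidean space. -/
abbrev E3 : Type := EuclideanSpace ℝ (Fin 3)

/-- The torus `ℝ³ / ℤ³`. -/
abbrev T3 : Type := UnitAddTorus (Fin 3)

/-- Normalised Haar measure on the torus, i.e. Lebesgue measure on a unit cell (total mass `1`). -/
abbrev torusMeasure : Measure T3 := Measure.pi fun _ => AddCircle.haarAddCircle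

/-- `L²(𝕋³)`: square-integrable real vector fields `𝕋³ → ℝ³`. -/
abbrev L2Torus : Type := Lp E3 2 torusMeasure

/-- The `j`-th component of the Fourier coefficient of `v` at the lattice point `k`:
`∫ v_j(x) e^{-2πi k·x} dx`. -/
def fourierCoef (v : L2Torus) (k : Fin 3 → ℤ) (j : Fin 3) : ℂ :=
  ∫ x, UnitAddTorus.mFourier (-k) x • ((v x j : ℝ) : ℂ) ∂torusMeasure

/-- `|k|²` for a lattice point `k`. -/
def normSqLattice (k : Fin 3 → ℤ) : ℝ := ∑ j, (k j : ℝ) ^ 2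

/-- The symbol `1 + 4π²|k|²` of `Id - Δ`. -/
def besselSymbol (k : Fin 3 → ℤ) : ℝ := 1 + 4 * Real.pi ^ 2 * normSqLattice k

/-- The square of the `H^s(𝕋³)`-norm `‖(Id - Δ)^{s/2} v‖_{L²}` (possibly infinite). -/
def sobolevNormSq (s : ℝ) (v : L2Torus) : ℝ≥0∞ :=
  ∑' k : Fin 3 → ℤ, ENNReal.ofReal (besselSymbol k ^ s * ∑ j, ‖fourierCoef v k j‖ ^ 2)

/-- `v ∈ H^s(𝕋³)` (for `s ≥ 0`, as a subspace of `L²`). -/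
def InSobolev (s : ℝ) (v : L2Torus) : Prop := sobolevNormSq s v < ∞

open Classical in
/-- `(Id - Δ)^s v`: the (unique) `L²` vector field with Fourier coefficients
`(1 + 4π²|k|²)^s v̂(k)`. It exists exactly when `v` lies in the `L²`-domain `H^{2s}` of
`(Id - Δ)^s`, thus always if `s ≤ 0`; outside the domain the value is the dummy `0`. -/
def besselPow (s : ℝ) (v : L2Torus) : L2Torus :=
  if h : ∃ w : L2Torus, ∀ k j,
      fourierCoef w k j = ((besselSymbol k ^ s : ℝ) : ℂ) * fourierCoef v k j
  then h.choose else 0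

/-- `⟨∇v, ∇φ⟩_{L²}` for `v, φ ∈ H¹(𝕋³)`, by Parseval. -/
def gradInner (v φ : L2Torus) : ℝ :=
  ∑' k : Fin 3 → ℤ, 4 * Real.pi ^ 2 * normSqLattice k *
    ∑ j, (fourierCoef v k j * conj (fourierCoef φ k j)).re

/-! ### The periodised local cascade operator -/

/-- The set `S = {(0,0,0), (1,0,0), (0,1,0), (0,0,1)}` of scale shifts. -/
def shifts : Finset (Fin 3 → ℤ) := {![0, 0, 0], ![1, 0, 0], ![0, 1, 0], ![0, 0, 1]}

/-- The data of a local cascade operator: `ε₀ ∈ (0,1)`, balls `B₁, …, B_m` in the annulus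
`1 < |ξ| < 1 + ε₀/2` such that `B₁, …, B_m, -B₁, …, -B_m` are disjoint, divergence-free Schwartz
vector fields `ψ_i` with Fourier transform supported in `B_i ∪ -B_i` and `‖ψ_i‖_{L²} = 1`, and real
structure constants `α_{i₁,i₂,i₃,μ₁,μ₂,μ₃}`. -/
structure CascadeData (m : ℕ) where
  ε₀ : ℝ
  ε₀_pos : 0 < ε₀
  ε₀_lt_one : ε₀ < 1
  center : Fin m → E3
  radius : Fin m → ℝ
  ball_subset : ∀ i, Metric.ball (center i) (radius i) ⊆ {ξ | 1 < ‖ξ‖ ∧ ‖ξ‖ < 1 + ε₀ / 2}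
  ball_disjoint : ∀ i j, i ≠ j →
    Disjoint (Metric.ball (center i) (radius i)) (Metric.ball (center j) (radius j))
  ball_disjoint_neg : ∀ i j,
    Disjoint (Metric.ball (center i) (radius i)) (Metric.ball (-center j) (radius j))
  ψ : Fin m → SchwartzMap E3 E3
  ψ_divFree : ∀ i x, ∑ j, (fderiv ℝ (ψ i) x (EuclideanSpace.single j 1)) j = 0
  ψ_fourier : ∀ i j ξ, ξ ∉ Metric.ball (center i) (radius i) ∪ Metric.ball (-center i) (radius i) →
    𝓕 (fun x : E3 => ((ψ i x j : ℝ) : ℂ)) ξ = 0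
  ψ_norm : ∀ i, ∫ x, ‖ψ i x‖ ^ 2 = 1
  α : (Fin 3 → Fin m) → shifts → ℝ

/-- The representative in `(0,1]³ ⊆ ℝ³` of a point of the torus. -/
def torusRep (x : T3) : Fin 3 → ℝ := fun j => (AddCircle.equivIoc (1 : ℝ) 0 (x j) : ℝ)

open Classical in
/-- The class in `L²(𝕋³)` of a vector field (the dummy `0` if it is not square-integrable). -/
def toL2 (f : T3 → E3) : L2Torus :=
  if h : MemLp f 2 torusMeasure then h.toLp f else 0

namespace CascadeData

variable {m : ℕ} (D : CascadeData m)

/-- `ψ_{i,n}(x) = (1+ε₀)^{3n/2} ψ_i((1+ε₀)^n x)` on `ℝ³`. -/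
def ψScaled (i : Fin m) (n : ℤ) (x : E3) : E3 :=
  (1 + D.ε₀) ^ (3 * (n : ℝ) / 2) • D.ψ i ((1 + D.ε₀) ^ n • x)

/-- The periodisation `ψ^per_{i,n}(x) = ∑_{l ∈ ℤ³} ψ_{i,n}(x + l)`. -/
def ψPer (i : Fin m) (n : ℤ) (x : T3) : E3 :=
  ∑' l : Fin 3 → ℤ, D.ψScaled i n (WithLp.toLp 2 fun j => torusRep x j + (l j : ℝ))

/-- The `L²(𝕋³)`-normalisation of `ψ^per_{i,n}`; it is `0` if `ψ^per_{i,n} = 0`. -/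
def ψNormalized (i : Fin m) (n : ℤ) : L2Torus :=
  ‖toL2 (D.ψPer i n)‖⁻¹ • toL2 (D.ψPer i n)

/-- The scalar factor of the summand with index `(n, i, μ)` of the cascade operator,
`α_{i,μ} (1+ε₀)^{5n/2} ⟨u, ψ̃_{i₁,n+μ₁}⟩ ⟨v, ψ̃_{i₂,n+μ₂}⟩`. -/
def coef (u v : L2Torus) (p : ℤ × (Fin 3 → Fin m) × shifts) : ℝ :=
  D.α p.2.1 p.2.2 * (1 + D.ε₀) ^ (5 * (p.1 : ℝ) / 2) *
    inner ℝ u (D.ψNormalized (p.2.1 0) (p.1 + p.2.2.1 0)) *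
    inner ℝ v (D.ψNormalized (p.2.1 1) (p.1 + p.2.2.1 1))

/-- The third wavelet `ψ̃_{i₃,n+μ₃}` of the summand with index `(n, i, μ)`. -/
def outWavelet (p : ℤ × (Fin 3 → Fin m) × shifts) : L2Torus :=
  D.ψNormalized (p.2.1 2) (p.1 + p.2.2.1 2)

/-- The periodic local cascade operator
`C(u,v) = ∑_{n,i,μ} α_{i,μ} (1+ε₀)^{5n/2} ⟨u, ψ̃_{i₁,n+μ₁}⟩ ⟨v, ψ̃_{i₂,n+μ₂}⟩ ψ̃_{i₃,n+μ₃}`. -/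
def cascade (u v : L2Torus) : L2Torus := ∑' p, D.coef u v p • D.outWavelet p

/-- `F(u) = C(u,u)`. -/
def F (u : L2Torus) : L2Torus := D.cascade u u

/-- `F_ρ(v) = (Id - Δ)^ρ F(u)` with `u = (Id - Δ)^{-ρ} v`. -/
def Frho (ρ : ℝ) (v : L2Torus) : L2Torus := besselPow ρ (D.F (besselPow (-ρ) v))

end CascadeData

/-! ### The deterministic Cauchy problem and hypothesis (H4) -/

/-- `v ∈ C([0,T]; L²) ∩ L²(0,T; H¹)` is a weak solution on `[0,T]` of
`∂ₜ v = Δv + νΔv + N(v)`, `v(0) = v₀`. -/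
structure IsWeakSolution (N : L2Torus → L2Torus) (ν : ℝ) (v₀ : L2Torus) (T : ℝ)
    (v : ℝ → L2Torus) : Prop where
  continuousOn : ContinuousOn v (Icc 0 T)
  sobolev : ∫⁻ t in Ioc 0 T, sobolevNormSq 1 (v t) < ∞
  initial : v 0 = v₀
  grad_integrable : ∀ φ, InSobolev 1 φ →
    IntervalIntegrable (fun t => gradInner (v t) φ) volume 0 T
  nonlin_integrable : ∀ φ, InSobolev 1 φ →
    IntervalIntegrable (fun t => (inner ℝ (N (v t)) φ : ℝ)) volume 0 T
  weak : ∀ φ, InSobolev 1 φ → ∀ t ∈ Icc 0 T,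
    (inner ℝ (v t) φ : ℝ) = inner ℝ v₀ φ - (1 + ν) * (∫ s in (0 : ℝ)..t, gradInner (v s) φ)
      + ∫ s in (0 : ℝ)..t, (inner ℝ (N (v s)) φ : ℝ)

/-- Hypothesis (H4) (admissible initial conditions) for `∂ₜ v = Δv + N(v)` on `𝕋³` with the set
`K`: `K ⊆ L²` is convex, closed and bounded, and for every `T > 0` there is `ν > 0` such that
`∂ₜ v = Δv + νΔv + N(v)` has for each `v₀ ∈ K` a global solution `v(·; v₀, ν)` (on `[0,∞)`, of class
`C([0,S]; L²) ∩ L²(0,S; H¹)` for every `S > 0`), and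
`sup_{v₀ ∈ K} sup_{t ∈ [0,T]} ‖v(t; v₀, ν)‖_{L²} < ∞`. -/
def HypothesisH4 (N : L2Torus → L2Torus) (K : Set L2Torus) : Prop :=
  Convex ℝ K ∧ IsClosed K ∧ Bornology.IsBounded K ∧
    ∀ T : ℝ, 0 < T → ∃ ν : ℝ, 0 < ν ∧ ∃ sol : L2Torus → ℝ → L2Torus,
      (∀ v₀ ∈ K, ∀ S : ℝ, 0 < S → IsWeakSolution N ν v₀ S (sol v₀)) ∧
      ∃ M : ℝ, ∀ v₀ ∈ K, ∀ t ∈ Icc 0 T, ‖sol v₀ t‖ ≤ M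

/-- `v` has zero spatial mean, `∫_{𝕋³} v dx = 0`. -/
def MeanZero (v : L2Torus) : Prop := ∫ x, v x ∂torusMeasure = 0

/-- The mean-zero ball `{f ∈ L²(𝕋³) : ∫ f dx = 0, ‖f‖_{L²} ≤ R}`. -/
def meanZeroBall (R : ℝ) : Set L2Torus := {f | MeanZero f ∧ ‖f‖ ≤ R}

end AveragedNSE

end

noncomputable section

namespace AveragedNSE

/-! ### Fourier analysis of real vector fields on the torus -/

/-! Write λ = 1 + ε₀. The Fourier support of ψ̃_{i,n} lies in lattice points with λⁿ < |k| < λⁿ⁺¹,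
in one of the scaled balls ±B_i. These supports are pairwise disjoint, are empty for n < 0, and
never contain k = 0 (`index_eq_of_mem_freqSet`, `freqSet_eq_empty`, `zero_notMem_freqSet`). The last
fact makes F_ρ mean-free, and testing the equation with the mean of v(t) shows that the mean is
conserved.

On frequencies of size λⁿ the multiplier (Id - Δ)^s acts like λ^{2sn}. Moving the two factors (Id -
Δ)^{-ρ} onto the wavelets, a summand of F_ρ at scale n has size λ^{5n/2 - 4ρn + 2ρn} = λ^{2n}
λ^{-(2ρ-1/2)n} times two normalised amplitudes of v (`scalarFactor_mul_norm_le`). For ρ > 1/4 the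
second factor is a convergent geometric series. The first stands for two derivatives. If v lies in
H¹, each amplitude gains λ^{-n} and the series converges absolutely in L². In the Duhamel formula
the heat flow with viscosity μ = 1 + ν integrates to a factor 1/(μλ^{2n}) at scale n
(`norm_duhamel_le`), so the Duhamel map is a bounded quadratic map on bounded continuous L²-valued
functions with constant O(1/μ). For μ large in terms of R it is a contraction, globally in time.

A fixed point that is merely bounded in L² need not be visibly a weak solution, since its forcing is
not summable in L². The fixed point is therefore sought in the closed set where the amplitude at
scale n is at most M w_n(t), with w_n(t) = 1/(1 + λ^{2n}t). The free evolution satisfies this bound.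
The quadratic term preserves it because each summand feeds a single wavelet, because w_n² ≤ w_n, and
because w_n(s) ≤ w_n(t) e^{λ^{2n}(t-s)}, whose growth is absorbed by half of the heat decay
(`exists_mildSolution`).

Since ∫ λ^{2n} w_n² dt ≤ 1 uniformly in n, the forcing is then summable in L¹(0,T;L²) and the
Duhamel part lies in L²(0,T;H¹). The weak formulation is checked for each Duhamel term, which has
finitely many frequencies, and for each mode of the free evolution; these identities are then summed
under the integral (`isWeakSolution`). -/

/-- The `j`-th component of a vector field, as a complex-valued function. -/
def complexComponent (j : Fin 3) : E3 →L[ℝ] ℂ :=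
  Complex.ofRealCLM.comp (EuclideanSpace.proj j)

/-- The vector field `Re z • e_j`. -/
def reSingle (j : Fin 3) : ℂ →L[ℝ] E3 :=
  (ContinuousLinearMap.toSpanSingleton ℝ (EuclideanSpace.single j (1 : ℝ))).comp Complex.reCLM

/-- The `j`-th component of an `L²` vector field as an element of the complex `L²` space. -/
def componentL2 (j : Fin 3) : L2Torus →L[ℝ] Lp ℂ 2 torusMeasure :=
  (complexComponent j).compLpL 2 torusMeasure

lemma componentL2_ae (v : L2Torus) (j : Fin 3) :
    componentL2 j v =ᵐ[torusMeasure] fun x => ((v x j : ℝ) : ℂ) := by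
  filter_upwards [(complexComponent j).coeFn_compLpL (p := 2) v] with x hx
  simpa [componentL2, complexComponent] using hx

lemma fourierCoef_eq_repr (v : L2Torus) (k : Fin 3 → ℤ) (j : Fin 3) :
    fourierCoef v k j = UnitAddTorus.mFourierBasis.repr (componentL2 j v) k := by
  rw [UnitAddTorus.mFourierBasis_repr]
  refine integral_congr_ae ?_
  filter_upwards [componentL2_ae v j] with x hx
  rw [hx]

/-- The Fourier coefficient as a continuous real-linear map. -/
def fourierCLM (k : Fin 3 → ℤ) (j : Fin 3) : L2Torus →L[ℝ] ℂ :=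
  ((innerSL ℂ (UnitAddTorus.mFourierBasis (d := Fin 3) k)).restrictScalars ℝ).comp (componentL2 j)

@[simp]
lemma fourierCLM_apply (k : Fin 3 → ℤ) (j : Fin 3) (v : L2Torus) :
    fourierCLM k j v = fourierCoef v k j := by
  rw [fourierCoef_eq_repr, HilbertBasis.repr_apply_apply]
  rfl

lemma fourierCoef_neg (v : L2Torus) (k : Fin 3 → ℤ) (j : Fin 3) :
    fourierCoef v (-k) j = conj (fourierCoef v k j) := by
  rw [fourierCoef, fourierCoef, ← integral_conj]
  refine integral_congr_ae (.of_forall fun x => ?_)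
  simp [UnitAddTorus.mFourier_neg]

/-- The contribution of the frequency `k` to `⟨v, w⟩`. -/
def modePairing (v w : L2Torus) (k : Fin 3 → ℤ) : ℝ :=
  ∑ j, (fourierCoef v k j * conj (fourierCoef w k j)).re

/-- **Parseval's identity** for real vector fields on the torus. -/
theorem hasSum_modePairing (v w : L2Torus) : HasSum (modePairing v w) (inner ℝ v w) := by
  have h : ∀ j, HasSum (fun k => (fourierCoef v k j * conj (fourierCoef w k j)).re)
      (∫ x, v x j * w x j ∂torusMeasure) := by
    intro j
    have h1 := UnitAddTorus.hasSum_prod_mFourierCoeff (componentL2 j w) (componentL2 j v)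
    have h2 := Complex.hasSum_re h1
    convert h2 using 1
    · ext k
      rw [fourierCoef_eq_repr, fourierCoef_eq_repr, UnitAddTorus.mFourierBasis_repr,
        UnitAddTorus.mFourierBasis_repr, mul_comm]
    · have : (∫ x, conj (componentL2 j w x) * componentL2 j v x ∂torusMeasure) =
          ((∫ x, v x j * w x j ∂torusMeasure : ℝ) : ℂ) := by
        rw [← integral_complex_ofReal]
        refine integral_congr_ae ?_
        filter_upwards [componentL2_ae v j, componentL2_ae w j] with x hx hy
        rw [hx, hy]
        simp [mul_comm]
      change _ = (∫ x, conj (componentL2 j w x) * componentL2 j v x ∂torusMeasure).re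
      rw [this, Complex.ofReal_re]
  have h3 := hasSum_sum (s := Finset.univ) fun j _ => h j
  refine (show _ = (inner ℝ v w : ℝ) from ?_) ▸ h3
  rw [L2.inner_def, ← integral_finsetSum]
  · refine integral_congr_ae (.of_forall fun x => ?_)
    simp [PiLp.inner_apply, mul_comm]
  · intro j _
    have h4 := (L2.integrable_inner (𝕜 := ℂ) (componentL2 j w) (componentL2 j v)).re
    refine h4.congr ?_
    filter_upwards [componentL2_ae v j, componentL2_ae w j] with x hx hy
    simp [hx, hy]

lemma modePairing_self (v : L2Torus) (k : Fin 3 → ℤ) :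
    modePairing v v k = ∑ j, ‖fourierCoef v k j‖ ^ 2 := by
  refine Finset.sum_congr rfl fun j _ => ?_
  rw [Complex.mul_conj, Complex.ofReal_re, Complex.normSq_eq_norm_sq]

lemma hasSum_normSq_fourierCoef (v : L2Torus) :
    HasSum (fun k => ∑ j, ‖fourierCoef v k j‖ ^ 2) (‖v‖ ^ 2) := by
  have := hasSum_modePairing v v
  rw [real_inner_self_eq_norm_sq] at this
  convert this using 2 with k
  rw [modePairing_self]

lemma ext_fourierCoef {v w : L2Torus} (h : ∀ k j, fourierCoef v k j = fourierCoef w k j) :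
    v = w := by
  rw [← sub_eq_zero, ← norm_eq_zero, ← sq_eq_zero_iff]
  refine (hasSum_normSq_fourierCoef (v - w)).unique ?_
  convert hasSum_zero with k
  simp only [← fourierCLM_apply, map_sub]
  simp [h]

/-- Riesz–Fischer for real fields: the complex functions with coefficients `c` are replaced by their
real parts, and the Hermitian symmetry `hc` guarantees that this does not change the coefficients.
-/
lemma exists_fourierCoef_eq (c : (Fin 3 → ℤ) → Fin 3 → ℂ) (hc : ∀ k j, c (-k) j = conj (c k j))
    (hs : Summable fun k => ∑ j, ‖c k j‖ ^ 2) : ∃ w : L2Torus, ∀ k j, fourierCoef w k j = c k j := by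
  have hm : ∀ j, Memℓp (fun k => c k j) 2 := fun j => by
    refine memℓp_gen ?_
    simp only [ENNReal.toReal_ofNat, Real.rpow_ofNat]
    exact hs.of_nonneg_of_le (fun k => by positivity) fun k =>
      Finset.single_le_sum (f := fun j => ‖c k j‖ ^ 2) (fun i _ => by positivity) (Finset.mem_univ j)
  let f : Fin 3 → Lp ℂ 2 torusMeasure := fun j =>
    UnitAddTorus.mFourierBasis.repr.symm ⟨fun k => c k j, hm j⟩
  have hf : ∀ k j, UnitAddTorus.mFourierCoeff (f j) k = c k j := fun k j => by
    rw [← UnitAddTorus.mFourierBasis_repr]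
    simp [f]
  let w : L2Torus := ∑ j, (reSingle j).compLp (f j)
  have hw : ∀ j, (fun x => ((w x j : ℝ) : ℂ)) =ᵐ[torusMeasure]
      fun x => (1 / 2 : ℂ) * (f j x + conj (f j x)) := fun j => by
    have h1 : ∀ i, (reSingle i).compLp (f i) =ᵐ[torusMeasure] fun x => reSingle i (f i x) :=
      fun i => (reSingle i).coeFn_compLp (f i)
    have h2 : w =ᵐ[torusMeasure] ∑ i, ⇑((reSingle i).compLp (f i)) := Lp.coeFn_finsetSum _ _
    filter_upwards [h2, ae_all_iff.2 h1] with x hx hy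
    rw [hx, Complex.add_conj, Finset.sum_apply, Finset.sum_congr rfl fun i _ => hy i]
    simp [reSingle, Pi.single_apply]
  refine ⟨w, fun k j => ?_⟩
  have hi : ∀ k, Integrable (fun x => UnitAddTorus.mFourier k x * f j x) torusMeasure := fun k => by
    have : Integrable (f j) torusMeasure := (Lp.memLp (f j)).integrable (by norm_num)
    refine this.bdd_mul (c := ‖UnitAddTorus.mFourier k‖) ?_ ?_
    · exact (UnitAddTorus.mFourier k).continuous.aestronglyMeasurable
    · exact .of_forall fun x => (UnitAddTorus.mFourier k).norm_coe_le_norm x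
  have e1 : ∫ x, UnitAddTorus.mFourier (-k) x * f j x ∂torusMeasure = c k j := hf k j
  have e2 : ∫ x, conj (UnitAddTorus.mFourier k x * f j x) ∂torusMeasure = c k j := by
    rw [integral_conj]
    have : ∫ x, UnitAddTorus.mFourier (- -k) x * f j x ∂torusMeasure = c (-k) j := hf (-k) j
    rw [neg_neg] at this
    rw [this, hc, Complex.conj_conj]
  have : fourierCoef w k j = ∫ x, (1 / 2 : ℂ) * (UnitAddTorus.mFourier (-k) x * f j x +
      conj (UnitAddTorus.mFourier k x * f j x)) ∂torusMeasure := by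
    refine integral_congr_ae ?_
    filter_upwards [hw j] with x hx
    rw [hx, map_mul, UnitAddTorus.mFourier_neg, smul_eq_mul]
    ring
  rw [this, integral_const_mul, integral_add (hi _), e1, e2]
  · ring
  · exact Complex.conjLIE.integrable_comp_iff.2 (hi k)

/-! ### Fourier multipliers -/

/-- `w` arises from `v` by the Fourier multiplier with real symbol `m`. -/
def FourierMul (m : (Fin 3 → ℤ) → ℝ) (v w : L2Torus) : Prop :=
  ∀ k j, fourierCoef w k j = (m k : ℂ) * fourierCoef v k j

/-- `v` has all its frequencies in `K`. -/
def FourierSupported (K : Set (Fin 3 → ℤ)) (v : L2Torus) : Prop :=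
  ∀ k, k ∉ K → ∀ j, fourierCoef v k j = 0

lemma FourierMul.unique {m : (Fin 3 → ℤ) → ℝ} {v w w' : L2Torus} (h : FourierMul m v w)
    (h' : FourierMul m v w') : w = w' :=
  ext_fourierCoef fun k j => by rw [h k j, h' k j]

lemma FourierMul.comp {m m' : (Fin 3 → ℤ) → ℝ} {u v w : L2Torus} (h : FourierMul m u v)
    (h' : FourierMul m' v w) : FourierMul (fun k => m' k * m k) u w := fun k j => by
  rw [h' k j, h k j]; push_cast; ring

lemma FourierMul.supported {m : (Fin 3 → ℤ) → ℝ} {v w : L2Torus} {K : Set (Fin 3 → ℤ)}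
    (h : FourierMul m v w) (hv : FourierSupported K v) : FourierSupported K w :=
  fun k hk j => by rw [h k j, hv k hk j, mul_zero]

lemma FourierMul.modePairing_left {m : (Fin 3 → ℤ) → ℝ} {v w : L2Torus} (h : FourierMul m v w)
    (u : L2Torus) (k : Fin 3 → ℤ) : modePairing w u k = m k * modePairing v u k := by
  simp only [modePairing, Finset.mul_sum, h k, mul_assoc, Complex.re_ofReal_mul]

lemma modePairing_comm (v w : L2Torus) (k : Fin 3 → ℤ) : modePairing v w k = modePairing w v k := by
  refine Finset.sum_congr rfl fun j _ => ?_
  rw [← Complex.conj_re]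
  simp [mul_comm]

lemma FourierMul.modePairing_right {m : (Fin 3 → ℤ) → ℝ} {v w : L2Torus} (h : FourierMul m v w)
    (u : L2Torus) (k : Fin 3 → ℤ) : modePairing u w k = m k * modePairing u v k := by
  rw [modePairing_comm, h.modePairing_left, modePairing_comm]

/-- Multipliers with real symbol are self-adjoint. This is what moves powers of Id - Δ and the heat
flow from the solution onto wavelets of known frequency. -/
lemma FourierMul.inner_eq {m : (Fin 3 → ℤ) → ℝ} {v w u u' : L2Torus} (h : FourierMul m v w)
    (h' : FourierMul m u u') : (inner ℝ w u : ℝ) = inner ℝ v u' := by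
  have : modePairing w u = modePairing v u' := funext fun k => by
    rw [h.modePairing_left, h'.modePairing_right]
  exact (hasSum_modePairing w u).unique (this ▸ hasSum_modePairing v u')

lemma FourierMul.normSq_mode {m : (Fin 3 → ℤ) → ℝ} {v w : L2Torus} (h : FourierMul m v w)
    (k : Fin 3 → ℤ) : ∑ j, ‖fourierCoef w k j‖ ^ 2 = m k ^ 2 * ∑ j, ‖fourierCoef v k j‖ ^ 2 := by
  rw [Finset.mul_sum]
  refine Finset.sum_congr rfl fun j _ => ?_
  rw [h k j, norm_mul, mul_pow, Complex.norm_real, Real.norm_eq_abs, sq_abs]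

/-- By Parseval only the values of the symbol on the support of `v` matter. All frequency-localised
estimates below are instances of this bound. -/
lemma FourierMul.norm_le {m : (Fin 3 → ℤ) → ℝ} {v w : L2Torus} {K : Set (Fin 3 → ℤ)} {B : ℝ}
    (h : FourierMul m v w) (hv : FourierSupported K v) (hB : 0 ≤ B) (hm : ∀ k ∈ K, |m k| ≤ B) :
    ‖w‖ ≤ B * ‖v‖ := by
  refine abs_le_of_sq_le_sq' ?_ (by positivity) |>.2
  rw [mul_pow]
  refine hasSum_le (fun k => ?_) (hasSum_normSq_fourierCoef w)
    ((hasSum_normSq_fourierCoef v).mul_left (B ^ 2))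
  rw [h.normSq_mode]
  by_cases hk : k ∈ K
  · exact mul_le_mul_of_nonneg_right (sq_le_sq' (abs_le.1 (hm k hk)).1 (abs_le.1 (hm k hk)).2)
      (by positivity)
  · simp [hv k hk]

lemma fourierSupported_univ (v : L2Torus) : FourierSupported univ v := fun _ hk => (hk trivial).elim

lemma exists_fourierMul_of_summable {m : (Fin 3 → ℤ) → ℝ} (hm : ∀ k, m (-k) = m k) {v : L2Torus}
    (hs : Summable fun k => m k ^ 2 * ∑ j, ‖fourierCoef v k j‖ ^ 2) : ∃ w, FourierMul m v w := by
  refine exists_fourierCoef_eq (fun k j => (m k : ℂ) * fourierCoef v k j) (fun k j => ?_) ?_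
  · rw [hm, fourierCoef_neg, map_mul, Complex.conj_ofReal]
  · convert hs using 2 with k
    rw [Finset.mul_sum]
    refine Finset.sum_congr rfl fun j _ => ?_
    rw [norm_mul, mul_pow, Complex.norm_real, Real.norm_eq_abs, sq_abs]

lemma exists_fourierMul {m : (Fin 3 → ℤ) → ℝ} (hm : ∀ k, m (-k) = m k) {v : L2Torus}
    {K : Set (Fin 3 → ℤ)} {B : ℝ} (hv : FourierSupported K v) (hB : ∀ k ∈ K, |m k| ≤ B) :
    ∃ w, FourierMul m v w := by
  refine exists_fourierMul_of_summable hm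
    (((hasSum_normSq_fourierCoef v).summable.mul_left (B ^ 2)).of_nonneg_of_le
      (fun k => by positivity) fun k => ?_)
  by_cases hk : k ∈ K
  · exact mul_le_mul_of_nonneg_right (sq_le_sq' (abs_le.1 (hB k hk)).1 (abs_le.1 (hB k hk)).2)
      (by positivity)
  · simp [hv k hk]

/-- The symbol `4π²|k|²` of `-Δ`. -/
def laplaceSymbol (k : Fin 3 → ℤ) : ℝ := 4 * Real.pi ^ 2 * normSqLattice k

lemma normSqLattice_nonneg (k : Fin 3 → ℤ) : 0 ≤ normSqLattice k :=
  Finset.sum_nonneg fun _ _ => sq_nonneg _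

lemma normSqLattice_neg (k : Fin 3 → ℤ) : normSqLattice (-k) = normSqLattice k := by
  simp [normSqLattice]

lemma laplaceSymbol_nonneg (k : Fin 3 → ℤ) : 0 ≤ laplaceSymbol k :=
  mul_nonneg (by positivity) (normSqLattice_nonneg k)

lemma laplaceSymbol_neg (k : Fin 3 → ℤ) : laplaceSymbol (-k) = laplaceSymbol k := by
  rw [laplaceSymbol, normSqLattice_neg, laplaceSymbol]

lemma besselSymbol_eq (k : Fin 3 → ℤ) : besselSymbol k = 1 + laplaceSymbol k := rfl

lemma besselSymbol_neg (k : Fin 3 → ℤ) : besselSymbol (-k) = besselSymbol k := by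
  rw [besselSymbol_eq, laplaceSymbol_neg, besselSymbol_eq]

lemma one_le_besselSymbol (k : Fin 3 → ℤ) : 1 ≤ besselSymbol k := by
  rw [besselSymbol_eq]; linarith [laplaceSymbol_nonneg k]

lemma besselSymbol_pos (k : Fin 3 → ℤ) : 0 < besselSymbol k :=
  one_pos.trans_le (one_le_besselSymbol k)

lemma normSqLattice_zero : normSqLattice 0 = 0 := by simp [normSqLattice]

/-- The symbol of `(Id - Δ)^s`. -/
def besselPowSymbol (s : ℝ) (k : Fin 3 → ℤ) : ℝ := besselSymbol k ^ s

lemma besselPowSymbol_neg (s : ℝ) (k : Fin 3 → ℤ) : besselPowSymbol s (-k) = besselPowSymbol s k := by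
  rw [besselPowSymbol, besselSymbol_neg, besselPowSymbol]

lemma besselPowSymbol_pos (s : ℝ) (k : Fin 3 → ℤ) : 0 < besselPowSymbol s k :=
  Real.rpow_pos_of_pos (besselSymbol_pos k) s

lemma besselPow_spec {s : ℝ} {v : L2Torus} (h : ∃ w, FourierMul (besselPowSymbol s) v w) :
    FourierMul (besselPowSymbol s) v (besselPow s v) := by
  have h' : ∃ w : L2Torus, ∀ k j,
      fourierCoef w k j = ((besselSymbol k ^ s : ℝ) : ℂ) * fourierCoef v k j := h
  rw [besselPow, dif_pos h']
  exact h'.choose_spec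

lemma FourierMul.besselPow_eq {s : ℝ} {v w : L2Torus} (h : FourierMul (besselPowSymbol s) v w) :
    besselPow s v = w :=
  (besselPow_spec ⟨w, h⟩).unique h

lemma besselPow_spec_of_supported {s : ℝ} {v : L2Torus} {K : Set (Fin 3 → ℤ)} {B : ℝ}
    (hv : FourierSupported K v) (hB : ∀ k ∈ K, besselSymbol k ≤ B) :
    FourierMul (besselPowSymbol s) v (besselPow s v) := by
  refine besselPow_spec (exists_fourierMul (besselPowSymbol_neg s) (B := max 1 (B ^ s)) hv ?_)
  intro k hk
  rw [abs_of_pos (besselPowSymbol_pos s k)]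
  rcases le_total 0 s with hs | hs
  · exact (Real.rpow_le_rpow (besselSymbol_pos k).le (hB k hk) hs).trans (le_max_right _ _)
  · exact (Real.rpow_le_one_of_one_le_of_nonpos (one_le_besselSymbol k) hs).trans (le_max_left _ _)

lemma besselPow_spec_of_nonpos {s : ℝ} (hs : s ≤ 0) (v : L2Torus) :
    FourierMul (besselPowSymbol s) v (besselPow s v) := by
  refine besselPow_spec (exists_fourierMul (besselPowSymbol_neg s) (B := 1)
    (fourierSupported_univ v) fun k _ => ?_)
  rw [abs_of_pos (besselPowSymbol_pos s k)]
  exact Real.rpow_le_one_of_one_le_of_nonpos (one_le_besselSymbol k) hs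

/-- No domain assumption is needed, because the dummy value of `besselPow` also has vanishing mean.
-/
lemma fourierCoef_zero_besselPow {s : ℝ} {v : L2Torus} (hv : ∀ j, fourierCoef v 0 j = 0) (j : Fin 3) :
    fourierCoef (besselPow s v) 0 j = 0 := by
  by_cases h : ∃ w, FourierMul (besselPowSymbol s) v w
  · rw [besselPow_spec h, hv, mul_zero]
  · have h0 : besselPow s v = 0 := dif_neg h
    rw [h0, ← fourierCLM_apply, map_zero]

/-! ### The heat semigroup -/

/-- The symbol of the heat semigroup at time `max τ 0`. -/
def heatSymbol (τ : ℝ) (k : Fin 3 → ℤ) : ℝ := Real.exp (-(laplaceSymbol k * max τ 0))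

lemma heatSymbol_le_one (τ : ℝ) (k : Fin 3 → ℤ) : heatSymbol τ k ≤ 1 := by
  rw [heatSymbol, Real.exp_le_one_iff, neg_nonpos]
  exact mul_nonneg (laplaceSymbol_nonneg k) (le_max_right _ _)

lemma heatSymbol_pos (τ : ℝ) (k : Fin 3 → ℤ) : 0 < heatSymbol τ k := Real.exp_pos _

lemma exists_heat (τ : ℝ) (v : L2Torus) : ∃ w, FourierMul (heatSymbol τ) v w := by
  refine exists_fourierMul (fun k => by rw [heatSymbol, laplaceSymbol_neg, heatSymbol]) (B := 1)
    (fourierSupported_univ v) fun k _ => ?_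
  rw [abs_of_pos (heatSymbol_pos τ k)]
  exact heatSymbol_le_one τ k

/-- The heat flow `e^{τΔ} v` (at time `max τ 0`). -/
def heat (τ : ℝ) (v : L2Torus) : L2Torus := (exists_heat τ v).choose

lemma heat_spec (τ : ℝ) (v : L2Torus) : FourierMul (heatSymbol τ) v (heat τ v) :=
  (exists_heat τ v).choose_spec

lemma heat_zero (v : L2Torus) : heat 0 v = v :=
  (heat_spec 0 v).unique fun k j => by simp [heatSymbol]

lemma norm_heat_le (τ : ℝ) (v : L2Torus) : ‖heat τ v‖ ≤ ‖v‖ := by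
  have := (heat_spec τ v).norm_le (fourierSupported_univ v) zero_le_one fun k _ => by
    rw [abs_of_pos (heatSymbol_pos τ k)]; exact heatSymbol_le_one τ k
  rwa [one_mul] at this

lemma norm_heat_le_of_supported {τ a : ℝ} (hτ : 0 ≤ τ) {v : L2Torus} {K : Set (Fin 3 → ℤ)}
    (hv : FourierSupported K v) (ha : ∀ k ∈ K, a ≤ laplaceSymbol k) :
    ‖heat τ v‖ ≤ Real.exp (-(a * τ)) * ‖v‖ := by
  refine (heat_spec τ v).norm_le hv (Real.exp_pos _).le fun k hk => ?_
  rw [abs_of_pos (heatSymbol_pos τ k), heatSymbol, max_eq_left hτ]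
  exact Real.exp_le_exp.2 (neg_le_neg (mul_le_mul_of_nonneg_right (ha k hk) hτ))

lemma fourierCoef_sub (v w : L2Torus) (k : Fin 3 → ℤ) (j : Fin 3) :
    fourierCoef (v - w) k j = fourierCoef v k j - fourierCoef w k j := by
  simp only [← fourierCLM_apply, map_sub]

lemma fourierCoef_add (v w : L2Torus) (k : Fin 3 → ℤ) (j : Fin 3) :
    fourierCoef (v + w) k j = fourierCoef v k j + fourierCoef w k j := by
  simp only [← fourierCLM_apply, map_add]

lemma fourierCoef_smul (c : ℝ) (v : L2Torus) (k : Fin 3 → ℤ) (j : Fin 3) :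
    fourierCoef (c • v) k j = c * fourierCoef v k j := by
  simp only [← fourierCLM_apply, map_smul, Complex.real_smul]

lemma fourierCoef_zero_left (k : Fin 3 → ℤ) (j : Fin 3) : fourierCoef 0 k j = 0 := by
  simp only [← fourierCLM_apply, map_zero]

/-- The heat semigroup is strongly continuous. -/
theorem continuous_heat (v : L2Torus) : Continuous fun τ => heat τ v := by
  rw [continuous_iff_continuousAt]
  intro τ₀
  rw [ContinuousAt, tendsto_iff_norm_sub_tendsto_zero]
  have hmul : ∀ τ, FourierMul (fun k => heatSymbol τ k - heatSymbol τ₀ k) v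
      (heat τ v - heat τ₀ v) := fun τ k j => by
    rw [fourierCoef_sub, heat_spec τ v k j, heat_spec τ₀ v k j]; push_cast; ring
  have hsq : ∀ τ, ‖heat τ v - heat τ₀ v‖ ^ 2 =
      ∑' k, (heatSymbol τ k - heatSymbol τ₀ k) ^ 2 * ∑ j, ‖fourierCoef v k j‖ ^ 2 := fun τ => by
    rw [← (hasSum_normSq_fourierCoef _).tsum_eq]
    exact tsum_congr fun k => (hmul τ).normSq_mode k
  have key : Filter.Tendsto (fun τ => ‖heat τ v - heat τ₀ v‖ ^ 2) (nhds τ₀) (nhds 0) := by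
    simp only [hsq]
    rw [show (0 : ℝ) = ∑' k : Fin 3 → ℤ, (0 : ℝ) from tsum_zero.symm]
    refine tendsto_tsum_of_dominated_convergence
      (bound := fun k => ∑ j, ‖fourierCoef v k j‖ ^ 2) (hasSum_normSq_fourierCoef v).summable
      (fun k => ?_) (.of_forall fun τ k => ?_)
    · have hc : Continuous fun τ => (heatSymbol τ k - heatSymbol τ₀ k) ^ 2 *
          ∑ j, ‖fourierCoef v k j‖ ^ 2 := by
        unfold heatSymbol; fun_prop
      simpa using hc.tendsto τ₀
    · rw [Real.norm_of_nonneg (by positivity)]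
      refine mul_le_of_le_one_left (by positivity) ?_
      rw [sq_le_one_iff_abs_le_one, abs_le]
      have := heatSymbol_le_one τ k; have := heatSymbol_le_one τ₀ k
      have := heatSymbol_pos τ k; have := heatSymbol_pos τ₀ k
      constructor <;> linarith
  have := key.sqrt
  simpa [Real.sqrt_sq (norm_nonneg _)] using this

/-! ### Sobolev norm and Dirichlet form -/

lemma FourierMul.sobolevNormSq_eq {v w : L2Torus} (h : FourierMul (besselPowSymbol (1 / 2)) v w) :
    sobolevNormSq 1 v = ENNReal.ofReal (‖w‖ ^ 2) := by
  rw [← (hasSum_normSq_fourierCoef w).tsum_eq,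
    ENNReal.ofReal_tsum_of_nonneg (fun k => by positivity) (hasSum_normSq_fourierCoef w).summable]
  refine tsum_congr fun k => ?_
  rw [h.normSq_mode, besselPowSymbol, ← Real.rpow_natCast, ← Real.rpow_mul (besselSymbol_pos k).le]
  norm_num

lemma InSobolev.exists_fourierMul {v : L2Torus} (h : InSobolev 1 v) :
    ∃ w, FourierMul (besselPowSymbol (1 / 2)) v w := by
  refine exists_fourierMul_of_summable (besselPowSymbol_neg _) ?_
  have h1 := ENNReal.summable_toReal (ne_of_lt h)
  refine h1.congr fun k => ?_
  rw [ENNReal.toReal_ofReal (mul_nonneg (Real.rpow_nonneg (besselSymbol_pos k).le _) (by positivity)),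
    besselPowSymbol, ← Real.rpow_natCast, ← Real.rpow_mul (besselSymbol_pos k).le]
  norm_num

/-- Every `φ ∈ H¹` yields a vector field representing the functional `⟨∇ ·, ∇φ⟩` on `H¹`. -/
lemma InSobolev.exists_dirichlet {φ : L2Torus} (h : InSobolev 1 φ) :
    ∃ X, FourierMul (fun k => laplaceSymbol k * besselPowSymbol (-(1 / 2)) k) φ X := by
  obtain ⟨w, hw⟩ := h.exists_fourierMul
  -- Apply the symbol 4π²|k|²/(1 + 4π²|k|²) ≤ 1 to (Id - Δ)^{1/2} φ.
  obtain ⟨X, hX⟩ := AveragedNSE.exists_fourierMul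
    (m := fun k => laplaceSymbol k * besselPowSymbol (-1) k)
    (fun k => by rw [laplaceSymbol_neg, besselPowSymbol_neg]) (B := 1) (fourierSupported_univ w)
    (fun k _ => by
      rw [abs_of_nonneg (mul_nonneg (laplaceSymbol_nonneg k) (besselPowSymbol_pos _ k).le),
        besselPowSymbol, Real.rpow_neg_one, ← div_eq_mul_inv, div_le_one (besselSymbol_pos k),
        besselSymbol_eq]
      linarith)
  refine ⟨X, ?_⟩
  convert hw.comp hX using 2 with k
  rw [mul_assoc]
  congr 1
  rw [besselPowSymbol, besselPowSymbol, besselPowSymbol, ← Real.rpow_add (besselSymbol_pos k)]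
  norm_num

lemma gradInner_eq_tsum (v φ : L2Torus) : gradInner v φ = ∑' k, laplaceSymbol k * modePairing v φ k :=
  rfl

/-- Half a power of Id - Δ is moved from `φ` to `v`, so the Dirichlet form becomes an L² inner
product, continuous in `y` and compatible with series. -/
lemma hasSum_gradInner {v y φ X : L2Torus} (hy : FourierMul (besselPowSymbol (1 / 2)) v y)
    (hX : FourierMul (fun k => laplaceSymbol k * besselPowSymbol (-(1 / 2)) k) φ X) :
    HasSum (fun k => laplaceSymbol k * modePairing v φ k) (inner ℝ y X) := by
  convert hasSum_modePairing y X using 2 with k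
  rw [hy.modePairing_left, hX.modePairing_right]
  have : besselPowSymbol (1 / 2) k * besselPowSymbol (-(1 / 2)) k = 1 := by
    rw [besselPowSymbol, besselPowSymbol, ← Real.rpow_add (besselSymbol_pos k)]
    norm_num
  linear_combination (-laplaceSymbol k * modePairing v φ k) * this

lemma gradInner_eq_inner {v y φ X : L2Torus} (hy : FourierMul (besselPowSymbol (1 / 2)) v y)
    (hX : FourierMul (fun k => laplaceSymbol k * besselPowSymbol (-(1 / 2)) k) φ X) :
    gradInner v φ = inner ℝ y X :=
  (hasSum_gradInner hy hX).tsum_eq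

/-! ### Zero mean -/

lemma meanZero_iff (v : L2Torus) : MeanZero v ↔ ∀ j, fourierCoef v 0 j = 0 := by
  have hv : Integrable v torusMeasure := (Lp.memLp v).integrable (by norm_num)
  have h : ∀ j, fourierCoef v 0 j = (((∫ x, v x ∂torusMeasure) j : ℝ) : ℂ) := fun j => by
    refine Eq.trans ?_ ((complexComponent j).integral_comp_comm hv)
    refine integral_congr_ae (.of_forall fun x => ?_)
    simp [UnitAddTorus.mFourier_zero, complexComponent]
  simp only [h, Complex.ofReal_eq_zero, MeanZero]
  constructor
  · intro h0 j; rw [h0]; rfl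
  · intro h0; ext j; exact h0 j

/-! ### Series of integrable functions -/

/-- Tonelli: the sum of the norms has finite integral, hence is finite almost everywhere. -/
lemma ae_summable_norm_of_summable_integral_norm {ι α E : Type*} [Countable ι] [MeasurableSpace α]
    [NormedAddCommGroup E] {μ : Measure α} {F : ι → α → E} (hF : ∀ i, Integrable (F i) μ)
    (hs : Summable fun i => ∫ a, ‖F i a‖ ∂μ) : ∀ᵐ a ∂μ, Summable fun i => ‖F i a‖ := by
  have h1 : ∫⁻ a, ∑' i, ENNReal.ofReal ‖F i a‖ ∂μ ≠ ∞ := by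
    rw [lintegral_tsum fun i => (hF i).norm.aestronglyMeasurable.aemeasurable.ennreal_ofReal]
    have : ∀ i, ∫⁻ a, ENNReal.ofReal ‖F i a‖ ∂μ = ENNReal.ofReal (∫ a, ‖F i a‖ ∂μ) := fun i =>
      (ofReal_integral_eq_lintegral_ofReal (hF i).norm (.of_forall fun _ => norm_nonneg _)).symm
    simp only [this]
    exact hs.tsum_ofReal_ne_top
  have h2 := ae_lt_top' (AEMeasurable.tsum fun i =>
    (hF i).norm.aestronglyMeasurable.aemeasurable.ennreal_ofReal) h1
  filter_upwards [h2] with a ha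
  refine (ENNReal.summable_toReal ha.ne).congr fun i => ?_
  rw [ENNReal.toReal_ofReal (norm_nonneg _)]

lemma integrable_tsum_of_summable_integral_norm {ι α E : Type*} [Countable ι] [MeasurableSpace α]
    [NormedAddCommGroup E] [CompleteSpace E] {μ : Measure α} {F : ι → α → E}
    (hF : ∀ i, Integrable (F i) μ)
    (hs : Summable fun i => ∫ a, ‖F i a‖ ∂μ) : Integrable (fun a => ∑' i, F i a) μ := by
  have hae := ae_summable_norm_of_summable_integral_norm hF hs
  refine ⟨aestronglyMeasurable_of_tendsto_ae (u := Filter.atTop)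
    (f := fun (s : Finset ι) a => ∑ i ∈ s, F i a) (fun s => ?_) ?_, ?_⟩
  · exact Finset.aestronglyMeasurable_fun_sum s fun i _ => (hF i).1
  · filter_upwards [hae] with a ha
    exact ha.of_norm.hasSum
  · have h1 : ∫⁻ a, ∑' i, ENNReal.ofReal ‖F i a‖ ∂μ < ∞ := by
      rw [lintegral_tsum fun i => (hF i).norm.aestronglyMeasurable.aemeasurable.ennreal_ofReal]
      have : ∀ i, ∫⁻ a, ENNReal.ofReal ‖F i a‖ ∂μ = ENNReal.ofReal (∫ a, ‖F i a‖ ∂μ) := fun i =>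
        (ofReal_integral_eq_lintegral_ofReal (hF i).norm (.of_forall fun _ => norm_nonneg _)).symm
      simp only [this]
      exact hs.tsum_ofReal_lt_top
    refine lt_of_le_of_lt (lintegral_mono_ae ?_) h1
    filter_upwards [hae] with a ha
    rw [← ofReal_norm, ← ENNReal.ofReal_tsum_of_nonneg (fun i => norm_nonneg _) ha]
    exact ENNReal.ofReal_le_ofReal (norm_tsum_le_tsum_norm ha)

/-! ### Fourier coefficients of periodisations -/

/-- The unit cell `(0,1]³`. -/
def unitCell : Set (Fin 3 → ℝ) := {x | ∀ i, x i ∈ Ioc (0 : ℝ) 1}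

/-- A lattice point as a real vector. -/
def latticeVec (l : Fin 3 → ℤ) : Fin 3 → ℝ := fun j => l j

lemma measurableSet_unitCell : MeasurableSet unitCell :=
  MeasurableSet.univ_pi' fun _ => measurableSet_Ioc

/-- The translate of the unit cell with upper corner `l + (1,1,1)`. -/
def latticeCell (l : Fin 3 → ℤ) : Set (Fin 3 → ℝ) := {y | y - latticeVec l ∈ unitCell}

/-- Ceilings appear because the cells are half-open as (0,1]; each point thus has exactly one cell.
-/
lemma mem_latticeCell_iff (l : Fin 3 → ℤ) (y : Fin 3 → ℝ) :
    y ∈ latticeCell l ↔ ∀ i, ⌈y i⌉ - 1 = l i := by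
  simp only [latticeCell, unitCell, latticeVec, mem_ofPred_eq, mem_Ioc, Pi.sub_apply]
  refine forall_congr' fun i => ?_
  rw [sub_eq_iff_eq_add, Int.ceil_eq_iff]
  push_cast
  constructor <;> rintro ⟨h1, h2⟩ <;> constructor <;> linarith

lemma iUnion_latticeCell : ⋃ l, latticeCell l = univ :=
  eq_univ_of_forall fun y =>
    mem_iUnion.2 ⟨fun i => ⌈y i⌉ - 1, (mem_latticeCell_iff _ y).2 fun _ => rfl⟩

lemma pairwise_disjoint_latticeCell : Pairwise (Function.onFun Disjoint latticeCell) := by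
  intro l l' hne
  refine Set.disjoint_left.2 fun y h h' => hne (funext fun i => ?_)
  rw [← (mem_latticeCell_iff l y).1 h i, (mem_latticeCell_iff l' y).1 h' i]

lemma measurableSet_latticeCell (l : Fin 3 → ℤ) : MeasurableSet (latticeCell l) :=
  measurableSet_unitCell.preimage (measurable_id.sub_const _)

lemma setIntegral_latticeCell {E : Type*} [NormedAddCommGroup E] [NormedSpace ℝ E]
    (f : (Fin 3 → ℝ) → E) (l : Fin 3 → ℤ) :
    ∫ y in latticeCell l, f y = ∫ x in unitCell, f (x + latticeVec l) := by
  have h := (measurePreserving_add_right (volume : Measure (Fin 3 → ℝ))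
    (latticeVec l)).setIntegral_preimage_emb (measurableEmbedding_addRight _) f (latticeCell l)
  rw [← h]
  congr 2
  ext x
  simp [latticeCell]

lemma hasSum_setIntegral_unitCell {E : Type*} [NormedAddCommGroup E] [NormedSpace ℝ E]
    {f : (Fin 3 → ℝ) → E} (hf : Integrable f) :
    HasSum (fun l => ∫ x in unitCell, f (x + latticeVec l)) (∫ y, f y) := by
  have h := hasSum_integral_iUnion (f := f) (μ := volume) measurableSet_latticeCell
    pairwise_disjoint_latticeCell hf.integrableOn
  simpa only [iUnion_latticeCell, setIntegral_univ, setIntegral_latticeCell] using h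

/-- The character `e^{-2πi k·x}` on `ℝ³`. -/
def latticeChar (k : Fin 3 → ℤ) (x : Fin 3 → ℝ) : ℂ :=
  UnitAddTorus.mFourier (-k) (fun i => (x i : UnitAddCircle))

lemma norm_latticeChar_le (k : Fin 3 → ℤ) (x : Fin 3 → ℝ) : ‖latticeChar k x‖ ≤ 1 :=
  ((UnitAddTorus.mFourier (-k)).norm_coe_le_norm _).trans UnitAddTorus.mFourier_norm.le

lemma continuous_latticeChar (k : Fin 3 → ℤ) : Continuous (latticeChar k) := by
  refine (UnitAddTorus.mFourier (-k)).continuous.comp (continuous_pi fun i => ?_)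
  exact (AddCircle.continuous_mk' 1).comp (continuous_apply i)

lemma latticeChar_add_latticeVec (k l : Fin 3 → ℤ) (x : Fin 3 → ℝ) :
    latticeChar k (x + latticeVec l) = latticeChar k x := by
  unfold latticeChar
  congr 1
  ext i
  simp [latticeVec]

lemma latticeChar_eq_exp (k : Fin 3 → ℤ) (x : Fin 3 → ℝ) :
    latticeChar k x = Complex.exp (-(2 * Real.pi * Complex.I * ∑ j, (k j : ℂ) * x j)) := by
  simp only [latticeChar, UnitAddTorus.mFourier, ContinuousMap.coe_mk, fourier_coe_apply,
    ← Complex.exp_sum, Finset.mul_sum, ← Finset.sum_neg_distrib]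
  congr 1
  refine Finset.sum_congr rfl fun j _ => ?_
  simp
  ring

/-- Unfolding: the Fourier coefficients of a periodisation. -/
theorem integral_mFourier_periodisation (h : (Fin 3 → ℝ) → E3) (hh : Integrable h)
    (k : Fin 3 → ℤ) (j : Fin 3) :
    ∫ x, UnitAddTorus.mFourier (-k) x •
      (((∑' l : Fin 3 → ℤ, h (torusRep x + latticeVec l)) j : ℝ) : ℂ) ∂torusMeasure =
    ∫ y, latticeChar k y * ((h y j : ℝ) : ℂ) := by
  have h1 := UnitAddTorus.integral_preimage (d := Fin 3) (fun x => UnitAddTorus.mFourier (-k) x •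
      (((∑' l : Fin 3 → ℤ, h (torusRep x + latticeVec l)) j : ℝ) : ℂ)) 0
  refine h1.trans ?_
  have hset : {x : Fin 3 → ℝ | ∀ i, x i ∈ Ioc ((0 : Fin 3 → ℝ) i) ((0 : Fin 3 → ℝ) i + 1)} =
      unitCell := by simp [unitCell]
  rw [hset]
  have hint : Integrable fun y => latticeChar k y * ((h y j : ℝ) : ℂ) := by
    refine ((complexComponent j).integrable_comp hh).bdd_mul (c := 1)
      (continuous_latticeChar k).aestronglyMeasurable (.of_forall fun x => norm_latticeChar_le k x)
  have hhl : ∀ l, IntegrableOn (fun x => h (x + latticeVec l)) unitCell := fun l =>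
    (hh.comp_add_right _).integrableOn
  -- Pointwise convergence of the periodisation almost everywhere is what allows components to be
  -- taken inside the sum.
  have hae := ae_summable_norm_of_summable_integral_norm hhl
    (hasSum_setIntegral_unitCell hh.norm).summable
  have hF : ∀ l, IntegrableOn
      (fun x => latticeChar k (x + latticeVec l) * ((h (x + latticeVec l) j : ℝ) : ℂ)) unitCell :=
    fun l => (hint.comp_add_right (latticeVec l)).integrableOn
  rw [← (hasSum_setIntegral_unitCell hint).tsum_eq, integral_tsum_of_summable_integral_norm hF
    (hasSum_setIntegral_unitCell hint.norm).summable]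
  refine integral_congr_ae ?_
  filter_upwards [hae, ae_restrict_mem measurableSet_unitCell] with x hx hxc
  have hrep : torusRep (fun i => (x i : UnitAddCircle)) = x := by
    ext i
    refine AddCircle.equivIoc_coe_of_mem (p := (1 : ℝ)) ?_
    simpa using hxc i
  rw [hrep]
  have hs := (complexComponent j).hasSum hx.of_norm.hasSum
  simp only [latticeChar_add_latticeVec, tsum_mul_left]
  congr 1
  exact hs.tsum_eq.symm

/-! ### Fourier support of the periodised wavelets. -/

namespace CascadeData

variable {m : ℕ} (D : CascadeData m)

lemma integrable_ψScaled (i : Fin m) (n : ℤ) : Integrable (D.ψScaled i n) := by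
  have h0 : (1 + D.ε₀) ^ n ≠ 0 := zpow_ne_zero _ (by linarith [D.ε₀_pos])
  exact Integrable.smul ((1 + D.ε₀) ^ (3 * (n : ℝ) / 2))
    (((D.ψ i).integrable (μ := volume)).comp_smul h0)

/-- The lattice frequencies at which `ψ̃_{i,n}` may be non-zero. -/
def freqSet (i : Fin m) (n : ℤ) : Set (Fin 3 → ℤ) :=
  {k | ((1 + D.ε₀) ^ n)⁻¹ • WithLp.toLp 2 (latticeVec k) ∈
    Metric.ball (D.center i) (D.radius i) ∪ Metric.ball (-D.center i) (D.radius i)}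

/-- The substitution u = (1+ε₀)ⁿ x turns the integral into a multiple of the Fourier transform of
ψ_i at (1+ε₀)^{-n} k, a point outside ±B_i. -/
lemma integral_latticeChar_ψScaled (i : Fin m) (n : ℤ) {k : Fin 3 → ℤ} (hk : k ∉ D.freqSet i n)
    (j : Fin 3) : ∫ y : Fin 3 → ℝ, latticeChar k y *
      ((D.ψScaled i n (WithLp.toLp 2 y) j : ℝ) : ℂ) = 0 := by
  have hL : (1 + D.ε₀) ^ n ≠ 0 := zpow_ne_zero _ (by linarith [D.ε₀_pos])
  have h1 : ∫ y : Fin 3 → ℝ, latticeChar k y * ((D.ψScaled i n (WithLp.toLp 2 y) j : ℝ) : ℂ) =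
      ∫ x : E3, latticeChar k (WithLp.ofLp x) * ((D.ψScaled i n x j : ℝ) : ℂ) :=
    (PiLp.volume_preserving_toLp (Fin 3)).integral_comp
      (MeasurableEquiv.toLp 2 (Fin 3 → ℝ)).measurableEmbedding
      (fun x : E3 => latticeChar k (WithLp.ofLp x) * ((D.ψScaled i n x j : ℝ) : ℂ))
  rw [h1]
  set L := (1 + D.ε₀) ^ n with hLdef
  set f : E3 → ℂ := fun u => Real.fourierChar
    (-inner ℝ u (L⁻¹ • WithLp.toLp 2 (latticeVec k) : E3)) • ((D.ψ i u j : ℝ) : ℂ) with hf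
  have h2 : ∀ x : E3, latticeChar k (WithLp.ofLp x) * ((D.ψScaled i n x j : ℝ) : ℂ) =
      (((1 + D.ε₀) ^ (3 * (n : ℝ) / 2) : ℝ) : ℂ) * f (L • x) := fun x => by
    have h3 : latticeChar k (WithLp.ofLp x) = Real.fourierChar
        (-inner ℝ (L • x) (L⁻¹ • WithLp.toLp 2 (latticeVec k) : E3)) := by
      rw [real_inner_smul_left, real_inner_smul_right, mul_inv_cancel_left₀ hL, latticeChar_eq_exp,
        Real.fourierChar_apply]
      congr 1
      simp only [PiLp.inner_apply, latticeVec]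
      simp
      ring
    rw [hf, h3]
    simp only [ψScaled, ← hLdef]
    simp only [Circle.smul_def, PiLp.smul_apply, smul_eq_mul]
    push_cast
    ring
  simp only [h2, integral_const_mul]
  rw [Measure.integral_comp_smul volume f L]
  have h4 := D.ψ_fourier i j _ hk
  rw [Real.fourier_eq] at h4
  rw [hf, h4]
  simp

/-- The wavelet `ψ̃_{i,n}` has Fourier support in the scaled balls. -/
theorem supported_ψNormalized (i : Fin m) (n : ℤ) :
    FourierSupported (D.freqSet i n) (D.ψNormalized i n) := by
  intro k hk j
  rw [ψNormalized, fourierCoef_smul]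
  refine mul_eq_zero_of_right _ ?_
  by_cases hmem : MemLp (D.ψPer i n) 2 torusMeasure
  · have h0 : toL2 (D.ψPer i n) = hmem.toLp _ := dif_pos hmem
    have h1 : fourierCoef (toL2 (D.ψPer i n)) k j =
        ∫ x, UnitAddTorus.mFourier (-k) x • ((D.ψPer i n x j : ℝ) : ℂ) ∂torusMeasure := by
      rw [h0]
      refine integral_congr_ae ?_
      filter_upwards [hmem.coeFn_toLp] with x hx
      rw [hx]
    rw [h1]
    refine (integral_mFourier_periodisation (fun y => D.ψScaled i n (WithLp.toLp 2 y)) ?_ k j).trans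
      (D.integral_latticeChar_ψScaled i n hk j)
    exact ((PiLp.volume_preserving_toLp (Fin 3)).integrable_comp_emb
      (MeasurableEquiv.toLp 2 (Fin 3 → ℝ)).measurableEmbedding).2 (D.integrable_ψScaled i n)
  · have h0 : toL2 (D.ψPer i n) = 0 := dif_neg hmem
    rw [h0, fourierCoef_zero_left]

lemma norm_ψNormalized_le (i : Fin m) (n : ℤ) : ‖D.ψNormalized i n‖ ≤ 1 := by
  rw [ψNormalized, norm_smul, norm_inv, norm_norm]
  exact inv_mul_le_one

end CascadeData

namespace CascadeData

variable {m : ℕ} (D : CascadeData m)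

/-! ### Location of the wavelet frequencies -/

/-- The squared frequency scale `(1+ε₀)^{2n}`. -/
def scaleSq (n : ℤ) : ℝ := ((1 + D.ε₀) ^ n) ^ 2

lemma one_lt_base : 1 < 1 + D.ε₀ := by linarith [D.ε₀_pos]

lemma base_pos : 0 < 1 + D.ε₀ := by linarith [D.ε₀_pos]

lemma scaleSq_pos (n : ℤ) : 0 < D.scaleSq n := pow_pos (zpow_pos D.base_pos n) 2

lemma one_le_scaleSq {n : ℤ} (hn : 0 ≤ n) : 1 ≤ D.scaleSq n :=
  one_le_pow₀ (one_le_zpow₀ D.one_lt_base.le hn)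

lemma scaleSq_mono {n n' : ℤ} (h : n ≤ n') : D.scaleSq n ≤ D.scaleSq n' :=
  pow_le_pow_left₀ (zpow_pos D.base_pos n).le (zpow_le_zpow_right₀ D.one_lt_base.le h) 2

lemma scaleSq_add_one_le (n : ℤ) : D.scaleSq (n + 1) ≤ 4 * D.scaleSq n := by
  rw [scaleSq, scaleSq, zpow_add_one₀ D.base_pos.ne', mul_pow, mul_comm]
  refine mul_le_mul_of_nonneg_right ?_ (by positivity)
  nlinarith [D.ε₀_pos, D.ε₀_lt_one]

lemma scaleSq_eq_rpow (n : ℤ) : D.scaleSq n = (1 + D.ε₀) ^ (2 * (n : ℝ)) := by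
  rw [scaleSq, ← Real.rpow_intCast, ← Real.rpow_natCast, ← Real.rpow_mul D.base_pos.le]
  congr 1
  push_cast
  ring

lemma neg_mem_ball {x c : E3} {r : ℝ} (hx : x ∈ Metric.ball (-c) r) : -x ∈ Metric.ball c r := by
  rw [mem_ball_iff_norm] at hx ⊢
  rwa [← norm_neg, show -(-x - c) = x - -c by abel]

lemma norm_of_mem_balls {i : Fin m} {x : E3} (hx : x ∈ Metric.ball (D.center i) (D.radius i) ∪
    Metric.ball (-D.center i) (D.radius i)) : 1 < ‖x‖ ∧ ‖x‖ < 1 + D.ε₀ / 2 := by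
  rcases hx with hx | hx
  · exact D.ball_subset i hx
  · simpa using D.ball_subset i (neg_mem_ball hx)

lemma normSq_inv_smul_latticeVec (n : ℤ) (k : Fin 3 → ℤ) :
    D.scaleSq n * ‖((1 + D.ε₀) ^ n)⁻¹ • (WithLp.toLp 2 (latticeVec k) : E3)‖ ^ 2 =
      normSqLattice k := by
  have : ‖(WithLp.toLp 2 (latticeVec k) : E3)‖ ^ 2 = normSqLattice k := by
    rw [EuclideanSpace.norm_sq_eq]
    simp [latticeVec, normSqLattice]
  rw [norm_smul, mul_pow, this, Real.norm_eq_abs, sq_abs, scaleSq, ← mul_assoc, ← mul_pow,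
    mul_inv_cancel₀ (zpow_ne_zero n D.base_pos.ne'), one_pow, one_mul]

lemma normSqLattice_of_mem_freqSet {i : Fin m} {n : ℤ} {k : Fin 3 → ℤ} (hk : k ∈ D.freqSet i n) :
    D.scaleSq n < normSqLattice k ∧ normSqLattice k < D.scaleSq n * (1 + D.ε₀ / 2) ^ 2 := by
  obtain ⟨h1, h2⟩ := D.norm_of_mem_balls hk
  rw [← D.normSq_inv_smul_latticeVec n k]
  constructor
  · exact lt_mul_of_one_lt_right (D.scaleSq_pos n) (one_lt_pow₀ h1 two_ne_zero)
  · exact mul_lt_mul_of_pos_left (pow_lt_pow_left₀ h2 (norm_nonneg _) two_ne_zero) (D.scaleSq_pos n)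

/-- Since 1 + ε₀/2 ≤ 1 + ε₀, the annulus at scale n ends before the one at scale n + 1 begins. -/
lemma normSqLattice_lt_scaleSq_succ {i : Fin m} {n : ℤ} {k : Fin 3 → ℤ} (hk : k ∈ D.freqSet i n) :
    normSqLattice k < D.scaleSq (n + 1) := by
  refine (D.normSqLattice_of_mem_freqSet hk).2.trans_le ?_
  rw [scaleSq, scaleSq, zpow_add_one₀ D.base_pos.ne', mul_pow]
  refine mul_le_mul_of_nonneg_left ?_ (by positivity)
  nlinarith [D.ε₀_pos, D.ε₀_lt_one]

/-- For n < 0 the annulus lies in 0 < |k|² < 1, while |k|² is an integer. -/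
lemma freqSet_eq_empty (i : Fin m) {n : ℤ} (hn : n < 0) : D.freqSet i n = ∅ := by
  refine eq_empty_of_forall_notMem fun k hk => ?_
  have h1 := (D.normSqLattice_of_mem_freqSet hk).1
  have h2 := D.normSqLattice_lt_scaleSq_succ hk
  have h3 : D.scaleSq (n + 1) ≤ 1 :=
    (D.scaleSq_mono (by lia : n + 1 ≤ 0)).trans (by simp [scaleSq])
  have h4 : normSqLattice k = ((∑ j, k j ^ 2 : ℤ) : ℝ) := by simp [normSqLattice]
  have h5 : 0 < normSqLattice k := (D.scaleSq_pos n).trans h1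
  have h6 := h2.trans_le h3
  rw [h4] at h5 h6
  norm_cast at h5 h6
  lia

/-- Different scales are separated by the annuli; at equal scale the balls ±B_i are disjoint. -/
lemma index_eq_of_mem_freqSet {i i' : Fin m} {n n' : ℤ} {k : Fin 3 → ℤ} (h : k ∈ D.freqSet i n)
    (h' : k ∈ D.freqSet i' n') : i = i' ∧ n = n' := by
  have hn : n = n' := by
    have key : ∀ {i i' : Fin m} {n n' : ℤ}, k ∈ D.freqSet i n → k ∈ D.freqSet i' n' → ¬ n < n' :=
      fun {i i' n n'} h h' hlt => by
        have h1 := D.normSqLattice_lt_scaleSq_succ h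
        have h2 := (D.normSqLattice_of_mem_freqSet h').1
        have h3 := D.scaleSq_mono (by lia : n + 1 ≤ n')
        exact absurd (h1.trans_le h3) (by linarith)
    exact le_antisymm (not_lt.1 (key h' h)) (not_lt.1 (key h h'))
  subst hn
  refine ⟨?_, rfl⟩
  by_contra hne
  rcases h with h | h <;> rcases h' with h' | h'
  · exact Set.disjoint_left.1 (D.ball_disjoint i i' hne) h h'
  · exact Set.disjoint_left.1 (D.ball_disjoint_neg i i') h h'
  · exact Set.disjoint_left.1 (D.ball_disjoint_neg i' i) h' h
  · exact Set.disjoint_left.1 (D.ball_disjoint i i' hne) (neg_mem_ball h) (neg_mem_ball h')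

/-- The factor 2, available because 4π² ≥ 2, leaves a spare e^{-λ^{2n}τ} in the heat decay, spent
later on the growth of the time weights backwards in time. -/
lemma scaleSq_le_laplaceSymbol {i : Fin m} {n : ℤ} {k : Fin 3 → ℤ} (hk : k ∈ D.freqSet i n) :
    2 * D.scaleSq n ≤ laplaceSymbol k := by
  have h1 := (D.normSqLattice_of_mem_freqSet hk).1
  have h2 := D.scaleSq_pos n
  have h3 : 2 ≤ 4 * Real.pi ^ 2 := by nlinarith [Real.pi_gt_three]
  exact mul_le_mul h3 h1.le h2.le (by positivity)

lemma scaleSq_le_besselSymbol {i : Fin m} {n : ℤ} {k : Fin 3 → ℤ} (hk : k ∈ D.freqSet i n) :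
    D.scaleSq n ≤ besselSymbol k := by
  rw [besselSymbol_eq]
  linarith [D.scaleSq_le_laplaceSymbol hk, D.scaleSq_pos n]

lemma nonneg_of_mem_freqSet {i : Fin m} {n : ℤ} {k : Fin 3 → ℤ} (hk : k ∈ D.freqSet i n) : 0 ≤ n := by
  by_contra h
  rw [D.freqSet_eq_empty i (not_le.1 h)] at hk
  exact hk

/-- A constant comparing `1 + 4π²|k|²` with the frequency scale. -/
def symbolConst : ℝ := 1 + 16 * Real.pi ^ 2

lemma symbolConst_pos : 0 < symbolConst := by unfold symbolConst; positivity

/-- The frequency set is non-empty here, so n ≥ 0 and the summand 1 is absorbed by (1+ε₀)^{2n} ≥ 1;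
the 16π² is 4π² times the bound 4 for one scale step. -/
lemma besselSymbol_le {i : Fin m} {n : ℤ} {k : Fin 3 → ℤ} (hk : k ∈ D.freqSet i n) :
    besselSymbol k ≤ symbolConst * D.scaleSq n := by
  have h1 := (D.normSqLattice_lt_scaleSq_succ hk).le.trans (D.scaleSq_add_one_le n)
  have h2 := D.one_le_scaleSq (D.nonneg_of_mem_freqSet hk)
  rw [besselSymbol, symbolConst]
  nlinarith [sq_nonneg Real.pi]

/-! ### Rescaled wavelets -/

/-- The test field `(Id - Δ)^{-ρ} ψ̃_{i,n}`. -/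
def testWavelet (ρ : ℝ) (i : Fin m) (n : ℤ) : L2Torus := besselPow (-ρ) (D.ψNormalized i n)

/-- The output field `(Id - Δ)^ρ ψ̃_{i₃,n+μ₃}`. -/
def outField (ρ : ℝ) (p : ℤ × (Fin 3 → Fin m) × shifts) : L2Torus := besselPow ρ (D.outWavelet p)

/-- The set of frequencies of the output field. -/
def outFreq (p : ℤ × (Fin 3 → Fin m) × shifts) : Set (Fin 3 → ℤ) :=
  D.freqSet (p.2.1 2) (p.1 + p.2.2.1 2)

lemma besselPow_ψNormalized_spec (s : ℝ) (i : Fin m) (n : ℤ) :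
    FourierMul (besselPowSymbol s) (D.ψNormalized i n) (besselPow s (D.ψNormalized i n)) :=
  besselPow_spec_of_supported (D.supported_ψNormalized i n) fun _ hk => D.besselSymbol_le hk

lemma supported_testWavelet (ρ : ℝ) (i : Fin m) (n : ℤ) :
    FourierSupported (D.freqSet i n) (D.testWavelet ρ i n) :=
  (D.besselPow_ψNormalized_spec _ i n).supported (D.supported_ψNormalized i n)

lemma supported_outField (ρ : ℝ) (p : ℤ × (Fin 3 → Fin m) × shifts) :
    FourierSupported (D.outFreq p) (D.outField ρ p) :=
  (D.besselPow_ψNormalized_spec _ _ _).supported (D.supported_ψNormalized _ _)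

lemma norm_testWavelet_le {ρ : ℝ} (hρ : 0 ≤ ρ) (i : Fin m) (n : ℤ) :
    ‖D.testWavelet ρ i n‖ ≤ D.scaleSq n ^ (-ρ) := by
  have h := (D.besselPow_ψNormalized_spec (-ρ) i n).norm_le (D.supported_ψNormalized i n)
    (B := D.scaleSq n ^ (-ρ)) (Real.rpow_nonneg (D.scaleSq_pos n).le _) fun k hk => by
      rw [abs_of_pos (besselPowSymbol_pos _ k)]
      exact Real.rpow_le_rpow_of_nonpos (D.scaleSq_pos n) (D.scaleSq_le_besselSymbol hk)
        (neg_nonpos.2 hρ)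
  exact h.trans (mul_le_of_le_one_right (Real.rpow_nonneg (D.scaleSq_pos n).le _)
    (D.norm_ψNormalized_le i n))

lemma testWavelet_eq_zero (ρ : ℝ) (i : Fin m) {n : ℤ} (hn : n < 0) : D.testWavelet ρ i n = 0 := by
  refine ext_fourierCoef fun k j => ?_
  rw [fourierCoef_zero_left]
  refine D.supported_testWavelet ρ i n k ?_ j
  rw [D.freqSet_eq_empty i hn]
  exact notMem_empty k

lemma shift_mem {μ : Fin 3 → ℤ} (hμ : μ ∈ shifts) (i : Fin 3) : 0 ≤ μ i ∧ μ i ≤ 1 := by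
  simp only [shifts, Finset.mem_insert, Finset.mem_singleton] at hμ
  rcases hμ with rfl | rfl | rfl | rfl <;> fin_cases i <;> simp

lemma shift_zero_or (μ : shifts) : μ.1 0 = 0 ∨ μ.1 1 = 0 := by
  obtain ⟨μ, hμ⟩ := μ
  simp only [shifts, Finset.mem_insert, Finset.mem_singleton] at hμ
  rcases hμ with rfl | rfl | rfl | rfl <;> simp

lemma scaleSq_le_shift (n : ℤ) (μ : shifts) (i : Fin 3) : D.scaleSq n ≤ D.scaleSq (n + μ.1 i) :=
  D.scaleSq_mono (by have := (shift_mem μ.2 i).1; lia)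

lemma scaleSq_shift_le (n : ℤ) (μ : shifts) (i : Fin 3) :
    D.scaleSq (n + μ.1 i) ≤ 4 * D.scaleSq n :=
  (D.scaleSq_mono (by have := (shift_mem μ.2 i).2; lia)).trans (D.scaleSq_add_one_le n)

lemma norm_outField_le {ρ : ℝ} (hρ : 0 ≤ ρ) (p : ℤ × (Fin 3 → Fin m) × shifts) :
    ‖D.outField ρ p‖ ≤ (4 * symbolConst) ^ ρ * D.scaleSq p.1 ^ ρ := by
  have hC := symbolConst_pos
  have hs := D.scaleSq_pos p.1
  have h := (D.besselPow_ψNormalized_spec ρ (p.2.1 2) (p.1 + p.2.2.1 2)).norm_le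
    (D.supported_ψNormalized _ _) (B := (4 * symbolConst) ^ ρ * D.scaleSq p.1 ^ ρ)
    (by positivity) fun k hk => by
      rw [abs_of_pos (besselPowSymbol_pos _ k), ← Real.mul_rpow (by positivity) hs.le]
      refine Real.rpow_le_rpow (besselSymbol_pos k).le ((D.besselSymbol_le hk).trans ?_) hρ
      nlinarith [D.scaleSq_shift_le p.1 p.2.2 2]
  exact h.trans (mul_le_of_le_one_right (by positivity) (D.norm_ψNormalized_le _ _))

/-- The wavelet is recovered from the output field by the contraction (Id - Δ)^{-ρ}, so convergence
of the series of F follows from that of F_ρ. -/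
lemma norm_outWavelet_le {ρ : ℝ} (hρ : 0 ≤ ρ) (p : ℤ × (Fin 3 → Fin m) × shifts) :
    ‖D.outWavelet p‖ ≤ ‖D.outField ρ p‖ := by
  have h := D.besselPow_ψNormalized_spec ρ (p.2.1 2) (p.1 + p.2.2.1 2)
  have h' : FourierMul (besselPowSymbol (-ρ)) (D.outField ρ p) (D.outWavelet p) := fun k j => by
    rw [outField, outWavelet, h k j, ← mul_assoc, besselPowSymbol, besselPowSymbol,
      Real.rpow_neg (besselSymbol_pos k).le, ← Complex.ofReal_mul,
      inv_mul_cancel₀ (Real.rpow_pos_of_pos (besselSymbol_pos k) ρ).ne', Complex.ofReal_one, one_mul]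
  have := h'.norm_le (fourierSupported_univ _) zero_le_one fun k _ => by
    rw [abs_of_pos (besselPowSymbol_pos _ k)]
    exact Real.rpow_le_one_of_one_le_of_nonpos (one_le_besselSymbol k) (neg_nonpos.2 hρ)
  rwa [one_mul] at this

/-- The normalised wavelet amplitude `(1+ε₀)^{2ρn} |⟨v, (Id - Δ)^{-ρ} ψ̃_{i,n}⟩|`. -/
def amplitude (ρ : ℝ) (i : Fin m) (n : ℤ) (v : L2Torus) : ℝ :=
  D.scaleSq n ^ ρ * |(inner ℝ v (D.testWavelet ρ i n) : ℝ)|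

lemma amplitude_nonneg (ρ : ℝ) (i : Fin m) (n : ℤ) (v : L2Torus) : 0 ≤ D.amplitude ρ i n v :=
  mul_nonneg (Real.rpow_nonneg (D.scaleSq_pos n).le _) (abs_nonneg _)

lemma scaleSq_rpow_mul_neg (ρ : ℝ) (n : ℤ) : D.scaleSq n ^ ρ * D.scaleSq n ^ (-ρ) = 1 := by
  rw [← Real.rpow_add (D.scaleSq_pos n), add_neg_cancel, Real.rpow_zero]

lemma amplitude_le_norm {ρ : ℝ} (hρ : 0 ≤ ρ) (i : Fin m) (n : ℤ) (v : L2Torus) :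
    D.amplitude ρ i n v ≤ ‖v‖ := by
  have hpos := Real.rpow_nonneg (D.scaleSq_pos n).le ρ
  calc D.amplitude ρ i n v ≤ D.scaleSq n ^ ρ * (‖v‖ * D.scaleSq n ^ (-ρ)) := by
        refine mul_le_mul_of_nonneg_left ((abs_real_inner_le_norm _ _).trans ?_) hpos
        exact mul_le_mul_of_nonneg_left (D.norm_testWavelet_le hρ i n) (norm_nonneg _)
    _ = ‖v‖ := by rw [mul_left_comm, D.scaleSq_rpow_mul_neg, mul_one]

/-- One derivative is taken from the wavelet and given to `v`, at the gain (1+ε₀)^{-n}. -/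
lemma amplitude_le_sobolev {ρ : ℝ} (hρ : 0 ≤ ρ) (i : Fin m) (n : ℤ) {v y : L2Torus}
    (hy : FourierMul (besselPowSymbol (1 / 2)) v y) :
    D.amplitude ρ i n v ≤ D.scaleSq n ^ (-(1 / 2) : ℝ) * ‖y‖ := by
  have hsup := D.supported_testWavelet ρ i n
  have h1 := besselPow_spec_of_supported (s := -(1 / 2)) hsup fun _ hk => D.besselSymbol_le hk
  have h2 : FourierMul (besselPowSymbol (1 / 2)) (besselPow (-(1 / 2)) (D.testWavelet ρ i n))
      (D.testWavelet ρ i n) := fun k j => by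
    rw [h1 k j, ← mul_assoc, ← Complex.ofReal_mul, besselPowSymbol, besselPowSymbol,
      ← Real.rpow_add (besselSymbol_pos k)]
    norm_num
  have hpos := Real.rpow_nonneg (D.scaleSq_pos n).le (-(1 / 2))
  have h3 : ‖besselPow (-(1 / 2)) (D.testWavelet ρ i n)‖ ≤
      D.scaleSq n ^ (-(1 / 2) : ℝ) * D.scaleSq n ^ (-ρ) := by
    refine (h1.norm_le hsup (B := D.scaleSq n ^ (-(1 / 2) : ℝ)) hpos fun k hk => ?_).trans
      (mul_le_mul_of_nonneg_left (D.norm_testWavelet_le hρ i n) hpos)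
    rw [abs_of_pos (besselPowSymbol_pos _ k)]
    exact Real.rpow_le_rpow_of_nonpos (D.scaleSq_pos n) (D.scaleSq_le_besselSymbol hk) (by norm_num)
  rw [amplitude, ← hy.inner_eq h2]
  calc D.scaleSq n ^ ρ * |inner ℝ y (besselPow (-(1 / 2)) (D.testWavelet ρ i n))|
      ≤ D.scaleSq n ^ ρ * (‖y‖ * (D.scaleSq n ^ (-(1 / 2) : ℝ) * D.scaleSq n ^ (-ρ))) := by
        refine mul_le_mul_of_nonneg_left ((abs_real_inner_le_norm _ _).trans ?_)
          (Real.rpow_nonneg (D.scaleSq_pos n).le ρ)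
        exact mul_le_mul_of_nonneg_left h3 (norm_nonneg _)
    _ = (D.scaleSq n ^ ρ * D.scaleSq n ^ (-ρ)) * (D.scaleSq n ^ (-(1 / 2) : ℝ) * ‖y‖) := by ring
    _ = _ := by rw [D.scaleSq_rpow_mul_neg, one_mul]

/-! ### The scalar factors of the cascade operator -/

/-- The scalar factor of the summand with index `p` of `F_ρ`, polarised. -/
def scalarFactor (ρ : ℝ) (v w : L2Torus) (p : ℤ × (Fin 3 → Fin m) × shifts) : ℝ :=
  D.α p.2.1 p.2.2 * (1 + D.ε₀) ^ (5 * (p.1 : ℝ) / 2) *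
    inner ℝ v (D.testWavelet ρ (p.2.1 0) (p.1 + p.2.2.1 0)) *
    inner ℝ w (D.testWavelet ρ (p.2.1 1) (p.1 + p.2.2.1 1))

lemma coef_besselPow {ρ : ℝ} (hρ : 0 ≤ ρ) (v w : L2Torus) (p : ℤ × (Fin 3 → Fin m) × shifts) :
    D.coef (besselPow (-ρ) v) (besselPow (-ρ) w) p = D.scalarFactor ρ v w p := by
  have h : ∀ (u : L2Torus) (i : Fin m) (n : ℤ),
      (inner ℝ (besselPow (-ρ) u) (D.ψNormalized i n) : ℝ) = inner ℝ u (D.testWavelet ρ i n) :=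
    fun u i n => (besselPow_spec_of_nonpos (neg_nonpos.2 hρ) u).inner_eq
      (D.besselPow_ψNormalized_spec (-ρ) i n)
  rw [coef, scalarFactor, h, h]

/-- One shifted input may reach scale 0 when n = -1, but at most one of the two inputs is shifted;
the other one has negative scale and vanishes. -/
lemma scalarFactor_eq_zero (ρ : ℝ) (v w : L2Torus) {p : ℤ × (Fin 3 → Fin m) × shifts}
    (hp : p.1 < 0) : D.scalarFactor ρ v w p = 0 := by
  rcases shift_zero_or p.2.2 with h | h
  · rw [scalarFactor, h, add_zero, D.testWavelet_eq_zero ρ _ hp, inner_zero_right]; ring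
  · rw [scalarFactor, h, add_zero, D.testWavelet_eq_zero ρ (p.2.1 1) hp, inner_zero_right]; ring

lemma scalarFactor_sub (ρ : ℝ) (v w : L2Torus) (p : ℤ × (Fin 3 → Fin m) × shifts) :
    D.scalarFactor ρ v v p - D.scalarFactor ρ w w p =
      D.scalarFactor ρ (v - w) v p + D.scalarFactor ρ w (v - w) p := by
  simp only [scalarFactor, inner_sub_left]
  ring

/-- The decay rate `(1+ε₀)^{-(2ρ-1/2)}` per scale. -/
def decayRate (ρ : ℝ) : ℝ := (1 + D.ε₀) ^ (-(2 * ρ - 1 / 2))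

/-- The decay factor of the summand with index `p`. -/
def decay (ρ : ℝ) (p : ℤ × (Fin 3 → Fin m) × shifts) : ℝ := D.decayRate ρ ^ p.1.natAbs

/-- The constant in the bound for the summands of the cascade operator. -/
def cascadeConst (ρ : ℝ) : ℝ := (∑ i, ∑ μ, |D.α i μ|) * (4 * symbolConst) ^ ρ

lemma decayRate_pos (ρ : ℝ) : 0 < D.decayRate ρ := Real.rpow_pos_of_pos D.base_pos _

lemma decayRate_lt_one {ρ : ℝ} (hρ : 1 / 4 < ρ) : D.decayRate ρ < 1 :=
  Real.rpow_lt_one_of_one_lt_of_neg D.one_lt_base (by linarith)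

lemma decay_pos (ρ : ℝ) (p : ℤ × (Fin 3 → Fin m) × shifts) : 0 < D.decay ρ p :=
  pow_pos (D.decayRate_pos ρ) _

lemma cascadeConst_nonneg (ρ : ℝ) : 0 ≤ D.cascadeConst ρ :=
  mul_nonneg (Finset.sum_nonneg fun _ _ => Finset.sum_nonneg fun _ _ => abs_nonneg _)
    (Real.rpow_nonneg (by have := symbolConst_pos; positivity) _)

lemma summable_decay {ρ : ℝ} (hρ : 1 / 4 < ρ) : Summable (D.decay ρ) := by
  have h1 : Summable fun n : ℤ => D.decayRate ρ ^ n.natAbs := by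
    refine Summable.of_nat_of_neg ?_ ?_ <;>
    simpa using summable_geometric_of_lt_one (D.decayRate_pos ρ).le (D.decayRate_lt_one hρ)
  have h2 : Summable fun _ : (Fin 3 → Fin m) × shifts => (1 : ℝ) := Summable.of_finite
  refine (h1.mul_of_nonneg h2 (fun n => (pow_pos (D.decayRate_pos ρ) _).le)
    fun _ => zero_le_one).congr fun p => ?_
  rw [mul_one, decay]

/-- The basic bound for the summands of `F_ρ`. -/
theorem scalarFactor_mul_norm_le {ρ : ℝ} (hρ : 0 ≤ ρ) (v w : L2Torus)
    (p : ℤ × (Fin 3 → Fin m) × shifts) :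
    |D.scalarFactor ρ v w p| * ‖D.outField ρ p‖ ≤
      D.cascadeConst ρ * D.decay ρ p * D.scaleSq p.1 *
        (D.amplitude ρ (p.2.1 0) (p.1 + p.2.2.1 0) v *
          D.amplitude ρ (p.2.1 1) (p.1 + p.2.2.1 1) w) := by
  have hβ := mul_nonneg (D.amplitude_nonneg ρ (p.2.1 0) (p.1 + p.2.2.1 0) v)
    (D.amplitude_nonneg ρ (p.2.1 1) (p.1 + p.2.2.1 1) w)
  have hA := D.cascadeConst_nonneg ρ
  have hd := D.decay_pos ρ p
  have hs := D.scaleSq_pos p.1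
  -- The decay factor is defined with |n|; it agrees with the true exponent for n ≥ 0, and negative
  -- scales contribute nothing.
  rcases lt_or_ge p.1 0 with hp | hp
  · rw [D.scalarFactor_eq_zero ρ v w hp, abs_zero, zero_mul]
    positivity
  have hin : ∀ (u : L2Torus) (i : Fin m) (j : Fin 3),
      |(inner ℝ u (D.testWavelet ρ i (p.1 + p.2.2.1 j)) : ℝ)| ≤
        D.scaleSq p.1 ^ (-ρ) * D.amplitude ρ i (p.1 + p.2.2.1 j) u := fun u i j => by
    have h1 : |(inner ℝ u (D.testWavelet ρ i (p.1 + p.2.2.1 j)) : ℝ)| =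
        D.scaleSq (p.1 + p.2.2.1 j) ^ (-ρ) * D.amplitude ρ i (p.1 + p.2.2.1 j) u := by
      rw [amplitude, ← mul_assoc, mul_comm (_ ^ (-ρ)), D.scaleSq_rpow_mul_neg, one_mul]
    rw [h1]
    exact mul_le_mul_of_nonneg_right (Real.rpow_le_rpow_of_nonpos hs
      (D.scaleSq_le_shift p.1 p.2.2 j) (neg_nonpos.2 hρ)) (D.amplitude_nonneg _ _ _ _)
  have hα : |D.α p.2.1 p.2.2| ≤ ∑ i, ∑ μ, |D.α i μ| :=
    (Finset.single_le_sum (f := fun μ => |D.α p.2.1 μ|) (fun _ _ => abs_nonneg _)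
      (Finset.mem_univ p.2.2)).trans
    (Finset.single_le_sum (f := fun i => ∑ μ, |D.α i μ|)
      (fun _ _ => Finset.sum_nonneg fun _ _ => abs_nonneg _) (Finset.mem_univ p.2.1))
  -- Exponent count per scale: 5/2 - 2ρ - 2ρ + 2ρ = 2 - (2ρ - 1/2).
  have hpow : (1 + D.ε₀) ^ (5 * (p.1 : ℝ) / 2) * D.scaleSq p.1 ^ (-ρ) * D.scaleSq p.1 ^ (-ρ) *
      D.scaleSq p.1 ^ ρ = D.decay ρ p * D.scaleSq p.1 := by
    have hnat : ((p.1.natAbs : ℕ) : ℝ) = (p.1 : ℝ) := by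
      rw [← Int.cast_natCast, Int.natAbs_of_nonneg hp]
    rw [decay, decayRate, ← Real.rpow_natCast, hnat, D.scaleSq_eq_rpow]
    simp only [← Real.rpow_mul D.base_pos.le, ← Real.rpow_add D.base_pos]
    congr 1
    ring
  have hb0 : 0 ≤ (1 + D.ε₀) ^ (5 * (p.1 : ℝ) / 2) := Real.rpow_nonneg D.base_pos.le _
  have ha1 := D.amplitude_nonneg ρ (p.2.1 0) (p.1 + p.2.2.1 0) v
  have ha2 := D.amplitude_nonneg ρ (p.2.1 1) (p.1 + p.2.2.1 1) w
  have hsρ := Real.rpow_nonneg hs.le (-ρ)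
  rw [scalarFactor, abs_mul, abs_mul, abs_mul, abs_of_nonneg hb0]
  calc _ ≤ (∑ i, ∑ μ, |D.α i μ|) * (1 + D.ε₀) ^ (5 * (p.1 : ℝ) / 2) *
        (D.scaleSq p.1 ^ (-ρ) * D.amplitude ρ (p.2.1 0) (p.1 + p.2.2.1 0) v) *
        (D.scaleSq p.1 ^ (-ρ) * D.amplitude ρ (p.2.1 1) (p.1 + p.2.2.1 1) w) *
        ((4 * symbolConst) ^ ρ * D.scaleSq p.1 ^ ρ) := by
        gcongr
        · exact hin v _ 0
        · exact hin w _ 1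
        · exact D.norm_outField_le hρ p
    _ = (∑ i, ∑ μ, |D.α i μ|) * (4 * symbolConst) ^ ρ *
        ((1 + D.ε₀) ^ (5 * (p.1 : ℝ) / 2) * D.scaleSq p.1 ^ (-ρ) * D.scaleSq p.1 ^ (-ρ) *
          D.scaleSq p.1 ^ ρ) *
        (D.amplitude ρ (p.2.1 0) (p.1 + p.2.2.1 0) v *
          D.amplitude ρ (p.2.1 1) (p.1 + p.2.2.1 1) w) := by ring
    _ = _ := by rw [hpow, cascadeConst]; ring

/-! ### The series of `F_ρ` -/

/-- (Id - Δ)^ρ is a closed operator: both series converge in L² and their Fourier coefficients are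
related termwise by the symbol, so the sum of the second series is the image of the first. -/
lemma hasSum_Frho {ρ : ℝ} (hρ : 0 ≤ ρ) {v : L2Torus}
    (hs : Summable fun p => ‖D.scalarFactor ρ v v p • D.outField ρ p‖) :
    HasSum (fun p => D.scalarFactor ρ v v p • D.outField ρ p) (D.Frho ρ v) := by
  have hF : HasSum (fun p => D.scalarFactor ρ v v p • D.outWavelet p) (D.F (besselPow (-ρ) v)) := by
    have : Summable fun p => D.scalarFactor ρ v v p • D.outWavelet p := by
      refine Summable.of_norm_bounded hs fun p => ?_
      rw [norm_smul, norm_smul]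
      exact mul_le_mul_of_nonneg_left (D.norm_outWavelet_le hρ p) (norm_nonneg _)
    convert this.hasSum using 1
    simp only [F, cascade, D.coef_besselPow hρ]
  have hW := hs.of_norm.hasSum
  have hmul : FourierMul (besselPowSymbol ρ) (D.F (besselPow (-ρ) v))
      (∑' p, D.scalarFactor ρ v v p • D.outField ρ p) := fun k j => by
    have h1 := (fourierCLM k j).hasSum hF
    have h2 := (fourierCLM k j).hasSum hW
    simp only [fourierCLM_apply, fourierCoef_smul] at h1 h2
    refine h2.unique ((h1.mul_left _).congr_fun fun p => ?_)
    rw [outField, outWavelet, D.besselPow_ψNormalized_spec ρ _ _ k j]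
    ring
  rw [Frho, hmul.besselPow_eq]
  exact hW

/-- The two inputs gain (1+ε₀)^{-n} each, which cancels the factor (1+ε₀)^{2n} exactly and leaves
the geometric decay. -/
lemma summable_Frho_of_sobolev {ρ : ℝ} (hρ : 1 / 4 < ρ) {v : L2Torus} (hv : InSobolev 1 v) :
    Summable fun p => ‖D.scalarFactor ρ v v p • D.outField ρ p‖ := by
  obtain ⟨y, hy⟩ := hv.exists_fourierMul
  have hρ0 : 0 ≤ ρ := by linarith
  refine ((D.summable_decay hρ).mul_left (D.cascadeConst ρ * ‖y‖ ^ 2)).of_nonneg_of_le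
    (fun p => norm_nonneg _) fun p => ?_
  rw [norm_smul, Real.norm_eq_abs]
  refine (D.scalarFactor_mul_norm_le hρ0 v v p).trans ?_
  have hs := D.scaleSq_pos p.1
  have hA := D.cascadeConst_nonneg ρ
  have hd := D.decay_pos ρ p
  have hamp : ∀ (i : Fin m) (j : Fin 3), D.amplitude ρ i (p.1 + p.2.2.1 j) v ≤
      D.scaleSq p.1 ^ (-(1 / 2) : ℝ) * ‖y‖ := fun i j =>
    (D.amplitude_le_sobolev hρ0 i _ hy).trans (mul_le_mul_of_nonneg_right
      (Real.rpow_le_rpow_of_nonpos hs (D.scaleSq_le_shift p.1 p.2.2 j) (by norm_num))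
      (norm_nonneg _))
  have hs1 : D.scaleSq p.1 * (D.scaleSq p.1 ^ (-(1 / 2) : ℝ) * D.scaleSq p.1 ^ (-(1 / 2) : ℝ)) = 1 := by
    rw [← Real.rpow_add hs, show (-(1 / 2) + -(1 / 2) : ℝ) = -1 by norm_num, Real.rpow_neg_one,
      mul_inv_cancel₀ hs.ne']
  calc _ ≤ D.cascadeConst ρ * D.decay ρ p * D.scaleSq p.1 *
        ((D.scaleSq p.1 ^ (-(1 / 2) : ℝ) * ‖y‖) * (D.scaleSq p.1 ^ (-(1 / 2) : ℝ) * ‖y‖)) := by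
        gcongr
        · exact D.amplitude_nonneg _ _ _ _
        · exact hamp _ 0
        · exact hamp _ 1
    _ = D.cascadeConst ρ * ‖y‖ ^ 2 * D.decay ρ p * (D.scaleSq p.1 *
        (D.scaleSq p.1 ^ (-(1 / 2) : ℝ) * D.scaleSq p.1 ^ (-(1 / 2) : ℝ))) := by ring
    _ = _ := by rw [hs1, mul_one]

lemma zero_notMem_freqSet (i : Fin m) (n : ℤ) : (0 : Fin 3 → ℤ) ∉ D.freqSet i n := fun h => by
  have := (D.normSqLattice_of_mem_freqSet h).1
  rw [normSqLattice_zero] at this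
  exact absurd this (D.scaleSq_pos n).le.not_gt

/-- `F_ρ` takes values in the fields of zero mean. -/
theorem meanZero_Frho (ρ : ℝ) (v : L2Torus) : MeanZero (D.Frho ρ v) := by
  rw [meanZero_iff]
  refine fourierCoef_zero_besselPow fun j => ?_
  rw [F, cascade]
  by_cases hs : Summable fun p => D.coef (besselPow (-ρ) v) (besselPow (-ρ) v) p • D.outWavelet p
  · have h := (fourierCLM 0 j).hasSum hs.hasSum
    rw [fourierCLM_apply] at h
    refine h.unique ?_
    convert hasSum_zero with p
    rw [fourierCLM_apply, fourierCoef_smul, outWavelet,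
      D.supported_ψNormalized _ _ 0 (D.zero_notMem_freqSet _ _), mul_zero]
  -- A divergent series has the default sum 0, which has zero mean as well; hence the statement
  -- holds on all of L².
  · rw [tsum_eq_zero_of_not_summable hs, fourierCoef_zero_left]

end CascadeData

/-! ### Conservation of the mean -/

/-- A weak solution keeps the zeroth Fourier mode if the nonlinearity has zero mean. -/
theorem IsWeakSolution.meanZero {N : L2Torus → L2Torus} (hN : ∀ v, MeanZero (N v)) {ν T : ℝ}
    {v₀ : L2Torus} {v : ℝ → L2Torus} (h : IsWeakSolution N ν v₀ T v) (h₀ : MeanZero v₀) {t : ℝ}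
    (ht : t ∈ Icc 0 T) : MeanZero (v t) := by
  -- The test field is the mean of v(t) itself, so the pairing with v(t) is the squared modulus of
  -- that mean.
  obtain ⟨φ, hφ⟩ := exists_fourierMul (m := fun k => if k = 0 then 1 else 0)
    (fun k => by simp) (B := 1) (fourierSupported_univ (v t)) fun k _ => by split_ifs <;> simp
  have hφ0 : ∀ k ≠ 0, ∀ j, fourierCoef φ k j = 0 := fun k hk j => by
    rw [hφ k j]; simp [hk]
  have hφS : InSobolev 1 φ := by
    rw [InSobolev, sobolevNormSq, tsum_eq_single 0]
    · exact ENNReal.ofReal_lt_top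
    · intro k hk
      simp [hφ0 k hk]
  have hpair : ∀ w, MeanZero w → (inner ℝ w φ : ℝ) = 0 := fun w hw => by
    refine (hasSum_modePairing w φ).unique ?_
    convert hasSum_zero with k
    refine Finset.sum_eq_zero fun j _ => ?_
    by_cases hk : k = 0
    · rw [hk, (meanZero_iff w).1 hw j, zero_mul, Complex.zero_re]
    · rw [hφ0 k hk, map_zero, mul_zero, Complex.zero_re]
  have hgrad : ∀ w, gradInner w φ = 0 := fun w => by
    rw [gradInner_eq_tsum]
    refine (tsum_congr fun k => ?_).trans tsum_zero
    by_cases hk : k = 0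
    · rw [hk, laplaceSymbol, normSqLattice_zero, mul_zero, zero_mul]
    · simp [modePairing, hφ0 k hk]
  have hw := h.weak φ hφS t ht
  simp only [hgrad, hpair _ h₀, hpair _ (hN _), intervalIntegral.integral_zero, mul_zero, sub_zero,
    add_zero] at hw
  rw [meanZero_iff]
  intro j
  have h0 : modePairing (v t) φ 0 = 0 := by
    rw [← hw]
    refine (hasSum_modePairing (v t) φ).unique ?_ |>.symm
    refine hasSum_single 0 fun k hk => ?_
    simp [modePairing, hφ0 k hk]
  rw [hφ.modePairing_right, if_pos rfl, one_mul, modePairing_self] at h0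
  have := (Finset.sum_eq_zero_iff_of_nonneg fun i _ => by positivity).1 h0 j (Finset.mem_univ j)
  simpa using this

/-! ### Duhamel integrals -/

/-- The Duhamel integral `∫₀ᵗ c(s) e^{μ(t-s)Δ} Ψ ds`. -/
def duhamel (μ : ℝ) (c : ℝ → ℝ) (Ψ : L2Torus) (t : ℝ) : L2Torus :=
  ∫ s in (0 : ℝ)..t, c s • heat (μ * (t - s)) Ψ

lemma continuous_duhamel_integrand (μ : ℝ) {c : ℝ → ℝ} (hc : Continuous c) (Ψ : L2Torus) :
    Continuous fun x : ℝ × ℝ => c x.2 • heat (μ * (x.1 - x.2)) Ψ :=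
  (hc.comp continuous_snd).smul ((continuous_heat Ψ).comp
    (continuous_const.mul (continuous_fst.sub continuous_snd)))

lemma intervalIntegrable_duhamel_integrand (μ : ℝ) {c : ℝ → ℝ} (hc : Continuous c) (Ψ : L2Torus)
    (a b t : ℝ) : IntervalIntegrable (fun s => c s • heat (μ * (t - s)) Ψ) volume a b :=
  ((continuous_duhamel_integrand μ hc Ψ).comp
    (continuous_const.prodMk continuous_id : Continuous fun s : ℝ => (t, s))).intervalIntegrable a b

lemma continuous_duhamel (μ : ℝ) {c : ℝ → ℝ} (hc : Continuous c) (Ψ : L2Torus) :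
    Continuous (duhamel μ c Ψ) :=
  intervalIntegral.continuous_parametric_intervalIntegral_of_continuous
    (f := fun t s => c s • heat (μ * (t - s)) Ψ) (continuous_duhamel_integrand μ hc Ψ) continuous_id

lemma duhamel_sub (μ : ℝ) {c c' : ℝ → ℝ} (hc : Continuous c) (hc' : Continuous c') (Ψ : L2Torus)
    (t : ℝ) : duhamel μ c Ψ t - duhamel μ c' Ψ t = duhamel μ (fun s => c s - c' s) Ψ t := by
  rw [duhamel, duhamel, duhamel, ← intervalIntegral.integral_sub
    (intervalIntegrable_duhamel_integrand μ hc Ψ 0 t t)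
    (intervalIntegrable_duhamel_integrand μ hc' Ψ 0 t t)]
  simp only [sub_smul]

lemma fourierCoef_duhamel {μ : ℝ} {c : ℝ → ℝ} (hc : Continuous c) (Ψ : L2Torus) (t : ℝ)
    (k : Fin 3 → ℤ) (j : Fin 3) : fourierCoef (duhamel μ c Ψ t) k j =
      ((∫ s in (0 : ℝ)..t, c s * heatSymbol (μ * (t - s)) k : ℝ) : ℂ) * fourierCoef Ψ k j := by
  have h := (fourierCLM k j).intervalIntegral_comp_comm
    (intervalIntegrable_duhamel_integrand μ hc Ψ 0 t t)
  rw [fourierCLM_apply] at h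
  rw [duhamel, ← h, ← intervalIntegral.integral_ofReal, ← intervalIntegral.integral_mul_const]
  refine intervalIntegral.integral_congr fun s _ => ?_
  rw [fourierCLM_apply, fourierCoef_smul, heat_spec _ Ψ k j]
  push_cast
  ring

lemma supported_duhamel {μ : ℝ} {c : ℝ → ℝ} (hc : Continuous c) {Ψ : L2Torus}
    {K : Set (Fin 3 → ℤ)} (hΨ : FourierSupported K Ψ) (t : ℝ) :
    FourierSupported K (duhamel μ c Ψ t) := fun k hk j => by
  rw [fourierCoef_duhamel hc, hΨ k hk j, mul_zero]

lemma integral_exp_neg_le {b t : ℝ} (hb : 0 < b) :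
    ∫ s in (0 : ℝ)..t, Real.exp (-(b * (t - s))) ≤ 1 / b := by
  have hd : ∀ s ∈ uIcc 0 t, HasDerivAt (fun s => Real.exp (-(b * (t - s))) / b)
      (Real.exp (-(b * (t - s)))) s := fun s _ => by
    have h1 : HasDerivAt (fun s => -(b * (t - s))) b s := by
      have := ((hasDerivAt_id s).const_sub t).const_mul b |>.fun_neg
      simpa using this
    have h2 := h1.exp.div_const b
    rwa [mul_div_cancel_right₀ _ hb.ne'] at h2
  rw [intervalIntegral.integral_eq_sub_of_hasDerivAt hd
    (Continuous.intervalIntegrable (by fun_prop) _ _)]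
  have : 0 ≤ Real.exp (-(b * (t - 0))) / b := by positivity
  simp only [sub_self, mul_zero, neg_zero, Real.exp_zero]
  linarith

/-- Smoothing by the heat flow: a forcing at frequencies `≥ L^{1/2}` gains the factor `(μL)⁻¹`. -/
lemma norm_duhamel_le {μ L C t : ℝ} (hμ : 1 ≤ μ) (hL : 0 < L) (ht : 0 ≤ t) {c : ℝ → ℝ}
    {Ψ : L2Torus} {K : Set (Fin 3 → ℤ)} (hΨ : FourierSupported K Ψ)
    (hK : ∀ k ∈ K, 2 * L ≤ laplaceSymbol k)
    (hc : ∀ s ∈ Icc 0 t, |c s| * ‖Ψ‖ ≤ C * Real.exp (L * (t - s))) :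
    ‖duhamel μ c Ψ t‖ ≤ C / (μ * L) := by
  have hC : 0 ≤ C := by
    have h0 := hc t ⟨ht, le_rfl⟩
    rw [sub_self, mul_zero, Real.exp_zero, mul_one] at h0
    exact (by positivity : 0 ≤ |c t| * ‖Ψ‖).trans h0
  have hμL : 0 < μ * L := by positivity
  have hb : ∀ s ∈ Ioc 0 t, ‖c s • heat (μ * (t - s)) Ψ‖ ≤
      C * Real.exp (-(μ * L * (t - s))) := fun s hs => by
    have hts : 0 ≤ t - s := by linarith [hs.2]
    have h1 := norm_heat_le_of_supported (mul_nonneg (by linarith) hts : 0 ≤ μ * (t - s)) hΨ hK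
    rw [norm_smul, Real.norm_eq_abs]
    calc |c s| * ‖heat (μ * (t - s)) Ψ‖
        ≤ |c s| * (Real.exp (-(2 * L * (μ * (t - s)))) * ‖Ψ‖) := by gcongr
      _ = (|c s| * ‖Ψ‖) * Real.exp (-(2 * L * (μ * (t - s)))) := by ring
      _ ≤ (C * Real.exp (L * (t - s))) * Real.exp (-(2 * L * (μ * (t - s)))) := by
          exact mul_le_mul_of_nonneg_right (hc s ⟨hs.1.le, hs.2⟩) (Real.exp_pos _).le
      _ = C * Real.exp (L * (t - s) + -(2 * L * (μ * (t - s)))) := by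
          rw [mul_assoc, ← Real.exp_add]
      _ ≤ _ := by
          refine mul_le_mul_of_nonneg_left (Real.exp_le_exp.2 ?_) hC
          -- Since μ ≥ 1, the allowed growth L(t-s) is at most half of the heat exponent 2μL(t-s).
          have : 0 ≤ (μ - 1) * (L * (t - s)) := mul_nonneg (by linarith) (by positivity)
          linarith
  have h2 := intervalIntegral.norm_integral_le_of_norm_le ht (μ := volume) (.of_forall hb)
    (Continuous.intervalIntegrable (by fun_prop) _ _)
  refine h2.trans ?_
  rw [intervalIntegral.integral_const_mul, div_eq_mul_one_div]
  exact mul_le_mul_of_nonneg_left (integral_exp_neg_le hμL) hC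

lemma FourierSupported.inner_eq_zero {v w : L2Torus} {K K' : Set (Fin 3 → ℤ)}
    (hv : FourierSupported K v) (hw : FourierSupported K' w) (h : Disjoint K K') :
    (inner ℝ v w : ℝ) = 0 := by
  refine (hasSum_modePairing v w).unique ?_
  convert hasSum_zero with k
  refine Finset.sum_eq_zero fun j _ => ?_
  by_cases hk : k ∈ K
  · rw [hw k (Set.disjoint_left.1 h hk) j, map_zero, mul_zero, Complex.zero_re]
  · rw [hv k hk j, zero_mul, Complex.zero_re]

/-! ### Time weights and estimates for the Duhamel terms. -/

namespace CascadeData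

variable {m : ℕ} (D : CascadeData m)

/-- The weight `1 / (1 + (1+ε₀)^{2n} t)` describing the decay in time at scale `n`. -/
def timeWeight (n : ℤ) (t : ℝ) : ℝ := (1 + D.scaleSq n * t)⁻¹

lemma timeWeight_pos (n : ℤ) {t : ℝ} (ht : 0 ≤ t) : 0 < D.timeWeight n t :=
  inv_pos.2 (by have := D.scaleSq_pos n; positivity)

lemma timeWeight_le_one (n : ℤ) {t : ℝ} (ht : 0 ≤ t) : D.timeWeight n t ≤ 1 :=
  inv_le_one_of_one_le₀ (by have := mul_nonneg (D.scaleSq_pos n).le ht; linarith)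

lemma timeWeight_shift_le (n : ℤ) (μ : shifts) (i : Fin 3) {t : ℝ} (ht : 0 ≤ t) :
    D.timeWeight (n + μ.1 i) t ≤ D.timeWeight n t := by
  have h := mul_le_mul_of_nonneg_right (D.scaleSq_le_shift n μ i) ht
  have := mul_nonneg (D.scaleSq_pos n).le ht
  exact inv_anti₀ (by linarith) (by linarith)

lemma timeWeight_le_shift (n : ℤ) (μ : shifts) (i : Fin 3) {t : ℝ} (ht : 0 ≤ t) :
    D.timeWeight n t ≤ 4 * D.timeWeight (n + μ.1 i) t := by
  have h := mul_le_mul_of_nonneg_right (D.scaleSq_shift_le n μ i) ht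
  have h1 := mul_nonneg (D.scaleSq_pos n).le ht
  have h2 := mul_nonneg (D.scaleSq_pos (n + μ.1 i)).le ht
  rw [timeWeight, timeWeight, ← div_eq_mul_inv, inv_eq_one_div,
    div_le_div_iff₀ (by linarith) (by linarith)]
  linarith

/-- With L the squared scale, 1 + Lt ≤ (1 + Ls)(1 + L(t-s)) ≤ (1 + Ls) e^{L(t-s)}. Past forcing is
thus compared with the weight at the final time. -/
lemma timeWeight_le_exp (n : ℤ) {s t : ℝ} (hs : 0 ≤ s) (hst : s ≤ t) :
    D.timeWeight n s ≤ D.timeWeight n t * Real.exp (D.scaleSq n * (t - s)) := by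
  have hL := D.scaleSq_pos n
  have h0 : 0 ≤ D.scaleSq n * (t - s) := mul_nonneg hL.le (by linarith)
  have h1 := mul_nonneg hL.le hs
  have h2 := mul_nonneg hL.le (hs.trans hst)
  have h3 := Real.add_one_le_exp (D.scaleSq n * (t - s))
  rw [timeWeight, timeWeight, inv_mul_eq_div, inv_eq_one_div,
    div_le_div_iff₀ (by linarith) (by linarith)]
  nlinarith [mul_nonneg h0 h1]

lemma exp_neg_le_timeWeight (n : ℤ) {t : ℝ} (ht : 0 ≤ t) :
    Real.exp (-(D.scaleSq n * t)) ≤ D.timeWeight n t := by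
  rw [Real.exp_neg, timeWeight]
  have := mul_nonneg (D.scaleSq_pos n).le ht
  exact inv_anti₀ (by linarith) (by linarith [Real.add_one_le_exp (D.scaleSq n * t)])

/-- The summand with index `p` of the Duhamel integral of `F_ρ(v)`. -/
def duhamelTerm (ρ μ : ℝ) (v : ℝ → L2Torus) (p : ℤ × (Fin 3 → Fin m) × shifts) (t : ℝ) : L2Torus :=
  duhamel μ (fun s => D.scalarFactor ρ (v s) (v s) p) (D.outField ρ p) t

lemma continuous_scalarFactor (ρ : ℝ) {v w : ℝ → L2Torus} (hv : Continuous v) (hw : Continuous w)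
    (p : ℤ × (Fin 3 → Fin m) × shifts) : Continuous fun s => D.scalarFactor ρ (v s) (w s) p := by
  unfold scalarFactor
  fun_prop

lemma scaleSq_le_laplaceSymbol_of_mem_outFreq {p : ℤ × (Fin 3 → Fin m) × shifts}
    {k : Fin 3 → ℤ} (hk : k ∈ D.outFreq p) : 2 * D.scaleSq p.1 ≤ laplaceSymbol k :=
  (mul_le_mul_of_nonneg_left (D.scaleSq_le_shift p.1 p.2.2 2) zero_le_two).trans
    (D.scaleSq_le_laplaceSymbol hk)

lemma scalarFactor_mul_norm_le_norm {ρ : ℝ} (hρ : 0 ≤ ρ) (v w : L2Torus)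
    (p : ℤ × (Fin 3 → Fin m) × shifts) :
    |D.scalarFactor ρ v w p| * ‖D.outField ρ p‖ ≤
      D.cascadeConst ρ * D.decay ρ p * D.scaleSq p.1 * (‖v‖ * ‖w‖) := by
  refine (D.scalarFactor_mul_norm_le hρ v w p).trans ?_
  have hA := D.cascadeConst_nonneg ρ
  have hd := D.decay_pos ρ p
  have hs := D.scaleSq_pos p.1
  gcongr
  · exact D.amplitude_nonneg _ _ _ _
  · exact D.amplitude_le_norm hρ _ _ _
  · exact D.amplitude_le_norm hρ _ _ _

/-- The forcing at scale `n` decays like the square of the time weight. -/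
lemma scalarFactor_mul_norm_le_timeWeight {ρ : ℝ} (hρ : 0 ≤ ρ) {v : L2Torus} {M t : ℝ}
    (hM : 0 ≤ M) (ht : 0 ≤ t) (hv : ∀ i n, D.amplitude ρ i n v ≤ M * D.timeWeight n t)
    (p : ℤ × (Fin 3 → Fin m) × shifts) :
    |D.scalarFactor ρ v v p| * ‖D.outField ρ p‖ ≤
      D.cascadeConst ρ * D.decay ρ p * D.scaleSq p.1 * (M ^ 2 * D.timeWeight p.1 t ^ 2) := by
  refine (D.scalarFactor_mul_norm_le hρ v v p).trans ?_
  have hA := D.cascadeConst_nonneg ρ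
  have hd := D.decay_pos ρ p
  have hs := D.scaleSq_pos p.1
  have h : ∀ i j, D.amplitude ρ i (p.1 + p.2.2.1 j) v ≤ M * D.timeWeight p.1 t := fun i j =>
    (hv i _).trans (mul_le_mul_of_nonneg_left (D.timeWeight_shift_le p.1 p.2.2 j ht) hM)
  refine mul_le_mul_of_nonneg_left ?_ (by positivity)
  rw [← mul_pow, sq]
  exact mul_le_mul (h _ 0) (h _ 1) (D.amplitude_nonneg _ _ _ _)
    (mul_nonneg hM (D.timeWeight_pos _ ht).le)

/-- The two derivatives in the forcing are exactly repaid by heat smoothing, leaving 1/μ and the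
summable decay. -/
lemma norm_duhamel_outField_le {ρ μ B t : ℝ} (hμ : 1 ≤ μ) (ht : 0 ≤ t) {c : ℝ → ℝ}
    (p : ℤ × (Fin 3 → Fin m) × shifts)
    (hc : ∀ s ∈ Icc 0 t, |c s| * ‖D.outField ρ p‖ ≤
      D.cascadeConst ρ * D.decay ρ p * D.scaleSq p.1 * B * Real.exp (D.scaleSq p.1 * (t - s))) :
    ‖duhamel μ c (D.outField ρ p) t‖ ≤ D.cascadeConst ρ * B / μ * D.decay ρ p := by
  have hs := D.scaleSq_pos p.1
  refine (norm_duhamel_le hμ hs ht (D.supported_outField ρ p)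
    (fun k hk => D.scaleSq_le_laplaceSymbol_of_mem_outFreq hk) hc).trans (le_of_eq ?_)
  field_simp

lemma norm_duhamelTerm_le {ρ μ B : ℝ} (hρ : 0 ≤ ρ) (hμ : 1 ≤ μ) {v : ℝ → L2Torus}
    (hv : ∀ s, ‖v s‖ ≤ B) (p : ℤ × (Fin 3 → Fin m) × shifts) {t : ℝ} (ht : 0 ≤ t) :
    ‖D.duhamelTerm ρ μ v p t‖ ≤ D.cascadeConst ρ * B ^ 2 / μ * D.decay ρ p := by
  refine D.norm_duhamel_outField_le hμ ht p fun s hs => ?_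
  have hA := D.cascadeConst_nonneg ρ
  have hd := D.decay_pos ρ p
  have hs0 := D.scaleSq_pos p.1
  refine (D.scalarFactor_mul_norm_le_norm hρ _ _ p).trans ?_
  have h1 : 1 ≤ Real.exp (D.scaleSq p.1 * (t - s)) :=
    Real.one_le_exp (mul_nonneg hs0.le (by linarith [hs.2]))
  refine le_trans ?_ (le_mul_of_one_le_right (by positivity) h1)
  rw [sq]
  have hB : 0 ≤ B := (norm_nonneg _).trans (hv s)
  have := hv s
  gcongr

/-- The decay in time of the summands of the Duhamel integral. -/
lemma norm_duhamelTerm_le_timeWeight {ρ μ M : ℝ} (hρ : 0 ≤ ρ) (hμ : 1 ≤ μ) (hM : 0 ≤ M)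
    {v : ℝ → L2Torus}
    (hv : ∀ i n t, 0 ≤ t → D.amplitude ρ i n (v t) ≤ M * D.timeWeight n t)
    (p : ℤ × (Fin 3 → Fin m) × shifts) {t : ℝ} (ht : 0 ≤ t) :
    ‖D.duhamelTerm ρ μ v p t‖ ≤
      D.cascadeConst ρ * (M ^ 2 * D.timeWeight p.1 t) / μ * D.decay ρ p := by
  refine D.norm_duhamel_outField_le hμ ht p fun s hs => ?_
  have hA := D.cascadeConst_nonneg ρ
  have hd := D.decay_pos ρ p
  have hs0 := D.scaleSq_pos p.1
  refine (D.scalarFactor_mul_norm_le_timeWeight hρ hM hs.1 (fun i n => hv i n s hs.1) p).trans ?_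
  -- One of the two weights supplied by the quadratic forcing already suffices to reproduce the
  -- bound.
  have h1 : D.timeWeight p.1 s ^ 2 ≤ D.timeWeight p.1 s :=
    pow_le_of_le_one (D.timeWeight_pos _ hs.1).le (D.timeWeight_le_one _ hs.1) two_ne_zero
  have h2 := h1.trans (D.timeWeight_le_exp p.1 hs.1 hs.2)
  calc _ ≤ D.cascadeConst ρ * D.decay ρ p * D.scaleSq p.1 *
        (M ^ 2 * (D.timeWeight p.1 t * Real.exp (D.scaleSq p.1 * (t - s)))) := by gcongr
    _ = _ := by ring

lemma continuous_duhamelTerm (ρ μ : ℝ) {v : ℝ → L2Torus} (hv : Continuous v)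
    (p : ℤ × (Fin 3 → Fin m) × shifts) : Continuous (D.duhamelTerm ρ μ v p) :=
  continuous_duhamel μ (D.continuous_scalarFactor ρ hv hv p) _

lemma supported_duhamelTerm (ρ μ : ℝ) {v : ℝ → L2Torus} (hv : Continuous v)
    (p : ℤ × (Fin 3 → Fin m) × shifts) (t : ℝ) :
    FourierSupported (D.outFreq p) (D.duhamelTerm ρ μ v p t) :=
  supported_duhamel (D.continuous_scalarFactor ρ hv hv p) (D.supported_outField ρ p) t

lemma norm_duhamelTerm_sub_le {ρ μ M d : ℝ} (hρ : 0 ≤ ρ) (hμ : 1 ≤ μ) {v w : ℝ → L2Torus}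
    (hvc : Continuous v) (hwc : Continuous w) (hv : ∀ s, ‖v s‖ ≤ M) (hw : ∀ s, ‖w s‖ ≤ M)
    (hd : ∀ s, ‖v s - w s‖ ≤ d) (p : ℤ × (Fin 3 → Fin m) × shifts) {t : ℝ} (ht : 0 ≤ t) :
    ‖D.duhamelTerm ρ μ v p t - D.duhamelTerm ρ μ w p t‖ ≤
      D.cascadeConst ρ * (2 * M * d) / μ * D.decay ρ p := by
  rw [duhamelTerm, duhamelTerm, duhamel_sub μ (D.continuous_scalarFactor ρ hvc hvc p)
    (D.continuous_scalarFactor ρ hwc hwc p)]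
  refine D.norm_duhamel_outField_le hμ ht p fun s hs => ?_
  have hA := D.cascadeConst_nonneg ρ
  have hdp := D.decay_pos ρ p
  have hs0 := D.scaleSq_pos p.1
  have hM : 0 ≤ M := (norm_nonneg _).trans (hv s)
  have hd0 : 0 ≤ d := (norm_nonneg _).trans (hd s)
  have h1 : 1 ≤ Real.exp (D.scaleSq p.1 * (t - s)) :=
    Real.one_le_exp (mul_nonneg hs0.le (by linarith [hs.2]))
  refine le_trans ?_ (le_mul_of_one_le_right (by positivity) h1)
  rw [D.scalarFactor_sub]
  have e1 := D.scalarFactor_mul_norm_le_norm hρ (v s - w s) (v s) p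
  have e2 := D.scalarFactor_mul_norm_le_norm hρ (w s) (v s - w s) p
  calc |D.scalarFactor ρ (v s - w s) (v s) p + D.scalarFactor ρ (w s) (v s - w s) p| *
        ‖D.outField ρ p‖
      ≤ (|D.scalarFactor ρ (v s - w s) (v s) p| + |D.scalarFactor ρ (w s) (v s - w s) p|) *
        ‖D.outField ρ p‖ := by gcongr; exact abs_add_le _ _
    _ ≤ D.cascadeConst ρ * D.decay ρ p * D.scaleSq p.1 * (‖v s - w s‖ * ‖v s‖) +
        D.cascadeConst ρ * D.decay ρ p * D.scaleSq p.1 * (‖w s‖ * ‖v s - w s‖) := by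
        rw [add_mul]; exact add_le_add e1 e2
    _ ≤ D.cascadeConst ρ * D.decay ρ p * D.scaleSq p.1 * (d * M) +
        D.cascadeConst ρ * D.decay ρ p * D.scaleSq p.1 * (M * d) := by
        have := hv s; have := hw s; have := hd s
        gcongr
    _ = _ := by ring

/-- The heat flow is moved onto the test wavelet, whose frequencies give exponential decay, which
dominates the algebraic weight. -/
lemma amplitude_heat_le {ρ μ R t : ℝ} (hρ : 0 ≤ ρ) (hμ : 1 ≤ μ) (ht : 0 ≤ t) {v₀ : L2Torus}
    (hv₀ : ‖v₀‖ ≤ R) (i : Fin m) (n : ℤ) :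
    D.amplitude ρ i n (heat (μ * t) v₀) ≤ R * D.timeWeight n t := by
  have hs := D.scaleSq_pos n
  have hμt : 0 ≤ μ * t := by positivity
  have h1 := norm_heat_le_of_supported hμt (D.supported_testWavelet ρ i n)
    fun k hk => D.scaleSq_le_laplaceSymbol hk
  have h2 : Real.exp (-(2 * D.scaleSq n * (μ * t))) ≤ D.timeWeight n t := by
    refine le_trans (Real.exp_le_exp.2 ?_) (D.exp_neg_le_timeWeight n ht)
    have := mul_nonneg (mul_nonneg hs.le ht) (by linarith : 0 ≤ 2 * μ - 1)
    linarith
  rw [amplitude, (heat_spec _ v₀).inner_eq (heat_spec _ _)]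
  have hpos := Real.rpow_nonneg hs.le ρ
  have hneg := Real.rpow_nonneg hs.le (-ρ)
  have hw := (D.timeWeight_pos n ht).le
  have hR : 0 ≤ R := (norm_nonneg _).trans hv₀
  calc D.scaleSq n ^ ρ * |inner ℝ v₀ (heat (μ * t) (D.testWavelet ρ i n))|
      ≤ D.scaleSq n ^ ρ * (R * (D.timeWeight n t * D.scaleSq n ^ (-ρ))) := by
        refine mul_le_mul_of_nonneg_left ((abs_real_inner_le_norm _ _).trans ?_) hpos
        refine mul_le_mul hv₀ (h1.trans ?_) (norm_nonneg _) hR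
        exact mul_le_mul h2 (D.norm_testWavelet_le hρ i n) (norm_nonneg _) hw
    _ = R * D.timeWeight n t * (D.scaleSq n ^ ρ * D.scaleSq n ^ (-ρ)) := by ring
    _ = _ := by rw [D.scaleSq_rpow_mul_neg, mul_one]

lemma inner_duhamelTerm_testWavelet_eq_zero (ρ μ : ℝ) {v : ℝ → L2Torus} (hv : Continuous v)
    {p : ℤ × (Fin 3 → Fin m) × shifts} (t : ℝ) {i : Fin m} {n : ℤ}
    (h : ¬ (p.2.1 2 = i ∧ p.1 + p.2.2.1 2 = n)) :
    (inner ℝ (D.duhamelTerm ρ μ v p t) (D.testWavelet ρ i n) : ℝ) = 0 :=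
  (D.supported_duhamelTerm ρ μ hv p t).inner_eq_zero (D.supported_testWavelet ρ i n)
    (Set.disjoint_left.2 fun _ h1 h2 => h (D.index_eq_of_mem_freqSet h1 h2))

/-- A term is seen only by the wavelet it outputs. That wavelet may sit one scale above the index n
of the term, which costs the factor 4 in comparing weights. -/
lemma amplitude_duhamelTerm_le {ρ μ M : ℝ} (hρ : 0 ≤ ρ) (hμ : 1 ≤ μ) (hM : 0 ≤ M)
    {v : ℝ → L2Torus} (hvc : Continuous v)
    (hv : ∀ i n t, 0 ≤ t → D.amplitude ρ i n (v t) ≤ M * D.timeWeight n t)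
    (p : ℤ × (Fin 3 → Fin m) × shifts) {t : ℝ} (ht : 0 ≤ t) (i : Fin m) (n : ℤ) :
    D.amplitude ρ i n (D.duhamelTerm ρ μ v p t) ≤
      4 * D.cascadeConst ρ * M ^ 2 / μ * D.timeWeight n t * D.decay ρ p := by
  have hA := D.cascadeConst_nonneg ρ
  have hdp := (D.decay_pos ρ p).le
  have hw := (D.timeWeight_pos n ht).le
  by_cases h : p.2.1 2 = i ∧ p.1 + p.2.2.1 2 = n
  · refine (D.amplitude_le_norm hρ _ _ _).trans
      ((D.norm_duhamelTerm_le_timeWeight hρ hμ hM hv p ht).trans ?_)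
    have := D.timeWeight_le_shift p.1 p.2.2 2 ht
    rw [h.2] at this
    calc _ ≤ D.cascadeConst ρ * (M ^ 2 * (4 * D.timeWeight n t)) / μ * D.decay ρ p := by gcongr
      _ = _ := by ring
  · rw [amplitude, D.inner_duhamelTerm_testWavelet_eq_zero ρ μ hvc t h, abs_zero, mul_zero]
    positivity

lemma amplitude_add_tsum_le {ρ : ℝ} {ι : Type*} (i : Fin m) (n : ℤ) (a : L2Torus) {f : ι → L2Torus}
    (hf : Summable f) {b : ι → ℝ} (hb : Summable b) (h : ∀ q, D.amplitude ρ i n (f q) ≤ b q) :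
    D.amplitude ρ i n (a + ∑' q, f q) ≤ D.amplitude ρ i n a + ∑' q, b q := by
  have hpos := Real.rpow_nonneg (D.scaleSq_pos n).le ρ
  have h1 : HasSum (fun q => D.scaleSq n ^ ρ * (inner ℝ (D.testWavelet ρ i n) (f q) : ℝ))
      (D.scaleSq n ^ ρ * inner ℝ (D.testWavelet ρ i n) (∑' q, f q)) :=
    ((innerSL ℝ (D.testWavelet ρ i n)).hasSum hf.hasSum).mul_left _
  have h2 : |D.scaleSq n ^ ρ * inner ℝ (D.testWavelet ρ i n) (∑' q, f q)| ≤ ∑' q, b q := by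
    rw [← h1.tsum_eq, ← Real.norm_eq_abs]
    refine tsum_of_norm_bounded hb.hasSum fun q => ?_
    rw [Real.norm_eq_abs, abs_mul, abs_of_nonneg hpos, real_inner_comm]
    exact h q
  rw [abs_mul, abs_of_nonneg hpos, real_inner_comm] at h2
  rw [amplitude, amplitude, inner_add_left]
  calc _ ≤ D.scaleSq n ^ ρ * (|inner ℝ a (D.testWavelet ρ i n)| +
        |inner ℝ (∑' q, f q) (D.testWavelet ρ i n)|) := by
        gcongr; exact abs_add_le _ _
    _ ≤ _ := by rw [mul_add]; exact add_le_add_right h2 _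

/-! ### The fixed point argument for mild solutions. -/

open BoundedContinuousFunction

lemma summable_duhamelTerm {ρ μ B : ℝ} (hρ : 1 / 4 < ρ) (hμ : 1 ≤ μ) {v : ℝ → L2Torus}
    (hv : ∀ s, ‖v s‖ ≤ B) {t : ℝ} (ht : 0 ≤ t) :
    Summable fun p => D.duhamelTerm ρ μ v p t :=
  Summable.of_norm_bounded ((D.summable_decay hρ).mul_left _)
    fun p => D.norm_duhamelTerm_le (by linarith) hμ hv p ht

/-- The right-hand side of the mild formulation. -/
def mildMap (ρ μ : ℝ) (v₀ : L2Torus) (v : ℝ → L2Torus) (t : ℝ) : L2Torus :=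
  -- For t < 0 both truncations make the value `v₀`, so that the map acts on bounded continuous
  -- functions on the whole line.
  heat (μ * t) v₀ + ∑' p, D.duhamelTerm ρ μ v p (max t 0)

lemma continuous_mildMap {ρ μ B : ℝ} (hρ : 1 / 4 < ρ) (hμ : 1 ≤ μ) (v₀ : L2Torus)
    {v : ℝ → L2Torus} (hvc : Continuous v) (hv : ∀ s, ‖v s‖ ≤ B) :
    Continuous (D.mildMap ρ μ v₀ v) := by
  refine ((continuous_heat v₀).comp (continuous_const.mul continuous_id)).add ?_
  refine continuous_tsum (fun p => (D.continuous_duhamelTerm ρ μ hvc p).comp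
    (continuous_id.max continuous_const)) ((D.summable_decay hρ).mul_left _)
    fun p t => D.norm_duhamelTerm_le (by linarith) hμ hv p (le_max_right t 0)

lemma norm_mildMap_le {ρ μ B R : ℝ} (hρ : 1 / 4 < ρ) (hμ : 1 ≤ μ) {v₀ : L2Torus} (hv₀ : ‖v₀‖ ≤ R)
    {v : ℝ → L2Torus} (hv : ∀ s, ‖v s‖ ≤ B) (t : ℝ) :
    ‖D.mildMap ρ μ v₀ v t‖ ≤ R + D.cascadeConst ρ * B ^ 2 / μ * ∑' p, D.decay ρ p := by
  refine (norm_add_le _ _).trans (add_le_add ((norm_heat_le _ _).trans hv₀) ?_)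
  exact tsum_of_norm_bounded ((D.summable_decay hρ).hasSum.mul_left _)
    fun p => D.norm_duhamelTerm_le (by linarith) hμ hv p (le_max_right t 0)

lemma dist_mildMap_le {ρ μ M d : ℝ} (hρ : 1 / 4 < ρ) (hμ : 1 ≤ μ) (v₀ : L2Torus)
    {v w : ℝ → L2Torus} (hvc : Continuous v) (hwc : Continuous w) (hv : ∀ s, ‖v s‖ ≤ M)
    (hw : ∀ s, ‖w s‖ ≤ M) (hd : ∀ s, ‖v s - w s‖ ≤ d) (t : ℝ) :
    dist (D.mildMap ρ μ v₀ v t) (D.mildMap ρ μ v₀ w t) ≤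
      D.cascadeConst ρ * (2 * M * d) / μ * ∑' p, D.decay ρ p := by
  rw [dist_eq_norm, mildMap, mildMap, add_sub_add_left_eq_sub,
    ← (D.summable_duhamelTerm hρ hμ hv (le_max_right t 0)).tsum_sub
      (D.summable_duhamelTerm hρ hμ hw (le_max_right t 0))]
  exact tsum_of_norm_bounded ((D.summable_decay hρ).hasSum.mul_left _)
    fun p => D.norm_duhamelTerm_sub_le (by linarith) hμ hvc hwc hv hw hd p (le_max_right t 0)

/-- The mild map on bounded continuous functions. -/
def mildMapBCF {ρ μ : ℝ} (hρ : 1 / 4 < ρ) (hμ : 1 ≤ μ) (v₀ : L2Torus) (v : ℝ →ᵇ L2Torus) :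
    ℝ →ᵇ L2Torus :=
  BoundedContinuousFunction.ofNormedAddCommGroup (D.mildMap ρ μ v₀ v)
    (D.continuous_mildMap hρ hμ v₀ v.continuous v.norm_coe_le_norm) _
    (D.norm_mildMap_le hρ hμ le_rfl v.norm_coe_le_norm)

/-- The bounded continuous functions obeying the wavelet decay bounds with constant `M`. -/
def decaySet (ρ M : ℝ) : Set (ℝ →ᵇ L2Torus) :=
  {v | ‖v‖ ≤ M ∧ ∀ i n t, 0 ≤ t → D.amplitude ρ i n (v t) ≤ M * D.timeWeight n t}

lemma isClosed_decaySet (ρ M : ℝ) : IsClosed (D.decaySet ρ M) := by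
  have h : D.decaySet ρ M = {v | ‖v‖ ≤ M} ∩ ⋂ (i) (n) (t : ℝ) (_ : 0 ≤ t),
      {v | D.amplitude ρ i n (v t) ≤ M * D.timeWeight n t} := by
    ext v
    simp [decaySet]
  rw [h]
  refine (isClosed_le continuous_norm continuous_const).inter ?_
  refine isClosed_iInter fun i => isClosed_iInter fun n => isClosed_iInter fun t =>
    isClosed_iInter fun _ => isClosed_le ?_ continuous_const
  unfold amplitude
  have : Continuous fun v : ℝ →ᵇ L2Torus => v t := continuous_eval_const t
  fun_prop

/-- Global mild solutions for large viscosity, with decay of the wavelet amplitudes. -/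
theorem exists_mildSolution {ρ μ R : ℝ} (hρ : 1 / 4 < ρ) (hR : 0 ≤ R) (hμ : 1 ≤ μ)
    (hμR : 4 * D.cascadeConst ρ * (R + 1) ^ 2 * ∑' p, D.decay ρ p ≤ μ) {v₀ : L2Torus}
    (hv₀ : ‖v₀‖ ≤ R) :
    ∃ v : ℝ → L2Torus, Continuous v ∧ (∀ t, ‖v t‖ ≤ R + 1) ∧
      (∀ i n t, 0 ≤ t → D.amplitude ρ i n (v t) ≤ (R + 1) * D.timeWeight n t) ∧
      ∀ t, 0 ≤ t → v t = heat (μ * t) v₀ + ∑' p, D.duhamelTerm ρ μ v p t := by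
  have hρ0 : 0 ≤ ρ := by linarith
  have hA := D.cascadeConst_nonneg ρ
  set Θ := ∑' p, D.decay ρ p with hΘ
  have hΘ0 : 0 ≤ Θ := tsum_nonneg fun p => (D.decay_pos ρ p).le
  have hμ0 : 0 < μ := by linarith
  set f := D.mildMapBCF hρ hμ v₀ with hf
  -- This one inequality serves three times: it bounds the norm by R + 1/4, it is exactly what the
  -- amplitude bound with its factor 4 needs, and it gives the Lipschitz constant 1/2.
  have hsmall : 4 * D.cascadeConst ρ * (R + 1) ^ 2 / μ * Θ ≤ 1 := by
    rw [div_mul_eq_mul_div, div_le_one hμ0]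
    exact hμR
  have hmaps : MapsTo f (D.decaySet ρ (R + 1)) (D.decaySet ρ (R + 1)) := by
    rintro v ⟨hv1, hv2⟩
    have hvn : ∀ s, ‖v s‖ ≤ R + 1 := fun s => (v.norm_coe_le_norm s).trans hv1
    refine ⟨?_, fun i n t ht => ?_⟩
    · refine (BoundedContinuousFunction.norm_le (by linarith)).2 fun t => ?_
      refine (D.norm_mildMap_le hρ hμ hv₀ hvn t).trans (by
        have : 0 ≤ D.cascadeConst ρ * (R + 1) ^ 2 / μ * Θ := by positivity
        have h4 : 4 * D.cascadeConst ρ * (R + 1) ^ 2 / μ * Θ =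
          4 * (D.cascadeConst ρ * (R + 1) ^ 2 / μ * Θ) := by ring
        linarith)
    · change D.amplitude ρ i n (D.mildMap ρ μ v₀ v t) ≤ _
      rw [mildMap, max_eq_left ht]
      refine (D.amplitude_add_tsum_le i n _ (D.summable_duhamelTerm hρ hμ hvn ht)
        ((D.summable_decay hρ).mul_left _) fun p => D.amplitude_duhamelTerm_le hρ0 hμ
          (by linarith) v.continuous hv2 p ht i n).trans ?_
      rw [tsum_mul_left, ← hΘ, add_mul]
      refine add_le_add (D.amplitude_heat_le hρ0 hμ ht hv₀ i n) ?_
      rw [mul_right_comm]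
      exact mul_le_mul_of_nonneg_right hsmall (D.timeWeight_pos n ht).le
  have hlip : ContractingWith (1 / 2) (hmaps.restrict f _ _) := by
    refine ⟨by rw [← NNReal.coe_lt_coe]; norm_num, LipschitzWith.of_dist_le_mul ?_⟩
    rintro ⟨v, hv1, hv2⟩ ⟨w, hw1, hw2⟩
    refine (BoundedContinuousFunction.dist_le (by positivity)).2 fun t => ?_
    refine (D.dist_mildMap_le hρ hμ v₀ v.continuous w.continuous
      (fun s => (v.norm_coe_le_norm s).trans hv1) (fun s => (w.norm_coe_le_norm s).trans hw1)
      (d := dist v w) (fun s => ?_) t).trans ?_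
    · rw [← dist_eq_norm]
      exact BoundedContinuousFunction.dist_coe_le_dist s
    · change _ ≤ _ * dist v w
      rw [← hΘ, show D.cascadeConst ρ * (2 * (R + 1) * dist v w) / μ * Θ =
        (2 * D.cascadeConst ρ * (R + 1) / μ * Θ) * dist v w by ring]
      refine mul_le_mul_of_nonneg_right ?_ dist_nonneg
      have h1 : 2 * D.cascadeConst ρ * (R + 1) / μ * Θ ≤
          2 * D.cascadeConst ρ * (R + 1) ^ 2 / μ * Θ := by
        gcongr
        exact le_self_pow₀ (by linarith) two_ne_zero
      have h4 : 4 * D.cascadeConst ρ * (R + 1) ^ 2 / μ * Θ =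
          2 * (2 * D.cascadeConst ρ * (R + 1) ^ 2 / μ * Θ) := by ring
      push_cast
      linarith
  have h0 : (0 : ℝ →ᵇ L2Torus) ∈ D.decaySet ρ (R + 1) := by
    refine ⟨by rw [norm_zero]; linarith, fun i n t ht => ?_⟩
    rw [amplitude]
    simp only [BoundedContinuousFunction.coe_zero, Pi.zero_apply, inner_zero_left, abs_zero,
      mul_zero]
    exact mul_nonneg (by linarith) (D.timeWeight_pos n ht).le
  obtain ⟨v, hv, hfix, -⟩ := hlip.exists_fixedPoint' (D.isClosed_decaySet ρ (R + 1)).isComplete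
    hmaps h0 (edist_ne_top _ _)
  refine ⟨v, v.continuous, fun t => (v.norm_coe_le_norm t).trans hv.1, hv.2, fun t ht => ?_⟩
  have h1 : f v t = v t := by rw [hfix]
  rw [← h1]
  change D.mildMap ρ μ v₀ v t = _
  rw [mildMap, max_eq_left ht]

end CascadeData

/-! ### Scalar Duhamel identity -/

/-- Factoring out e^{-κt} removes the dependence of the integrand on the upper limit. -/
lemma hasDerivAt_scalar_duhamel (κ : ℝ) {c : ℝ → ℝ} (hc : Continuous c) (t : ℝ) :
    HasDerivAt (fun t => ∫ s in (0 : ℝ)..t, c s * Real.exp (-(κ * (t - s))))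
      (-κ * (∫ s in (0 : ℝ)..t, c s * Real.exp (-(κ * (t - s)))) + c t) t := by
  have heq : ∀ t, ∫ s in (0 : ℝ)..t, c s * Real.exp (-(κ * (t - s))) =
      Real.exp (-(κ * t)) * ∫ s in (0 : ℝ)..t, c s * Real.exp (κ * s) := fun t => by
    rw [← intervalIntegral.integral_const_mul]
    refine intervalIntegral.integral_congr fun s _ => ?_
    rw [mul_left_comm, ← Real.exp_add]
    congr 2
    ring
  have h1 : HasDerivAt (fun t => ∫ s in (0 : ℝ)..t, c s * Real.exp (κ * s))
      (c t * Real.exp (κ * t)) t := by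
    have hcont : Continuous fun s => c s * Real.exp (κ * s) := by fun_prop
    exact intervalIntegral.integral_hasDerivAt_right (hcont.intervalIntegrable _ _)
      hcont.aestronglyMeasurable.stronglyMeasurableAtFilter hcont.continuousAt
  have h2 : HasDerivAt (fun t => Real.exp (-(κ * t))) (Real.exp (-(κ * t)) * -κ) t := by
    have h3 : HasDerivAt (fun t => -(κ * t)) (-κ) t := by
      simpa using ((hasDerivAt_id t).const_mul κ).fun_neg
    exact h3.exp
  simp only [heq]
  refine (h2.fun_mul h1).congr_deriv ?_
  have : Real.exp (-(κ * t)) * Real.exp (κ * t) = 1 := by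
    rw [← Real.exp_add, neg_add_cancel, Real.exp_zero]
  linear_combination (c t) * this

lemma scalar_duhamel_eq (κ : ℝ) {c : ℝ → ℝ} (hc : Continuous c) (t : ℝ) :
    ∫ s in (0 : ℝ)..t, c s * Real.exp (-(κ * (t - s))) =
      -κ * (∫ r in (0 : ℝ)..t, ∫ s in (0 : ℝ)..r, c s * Real.exp (-(κ * (r - s)))) +
        ∫ s in (0 : ℝ)..t, c s := by
  have hcont : Continuous fun t => ∫ s in (0 : ℝ)..t, c s * Real.exp (-(κ * (t - s))) :=
    continuous_iff_continuousAt.2 fun t => (hasDerivAt_scalar_duhamel κ hc t).continuousAt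
  have hcont' : Continuous fun t => -κ * ∫ s in (0 : ℝ)..t, c s * Real.exp (-(κ * (t - s))) :=
    continuous_const.mul hcont
  have h := intervalIntegral.integral_eq_sub_of_hasDerivAt
    (fun s _ => hasDerivAt_scalar_duhamel κ hc s) ((hcont'.add hc).intervalIntegrable 0 t)
  rw [intervalIntegral.integral_add (hcont'.intervalIntegrable _ _)
    (hc.intervalIntegrable _ _), intervalIntegral.integral_const_mul,
    intervalIntegral.integral_same, sub_zero] at h
  exact h.symm

/-! ### The weak formulation for a single Duhamel integral -/

lemma finite_normSqLattice_le (B : ℝ) : {k : Fin 3 → ℤ | normSqLattice k ≤ B}.Finite := by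
  refine (Set.finite_Icc (fun _ => -⌈B⌉ : Fin 3 → ℤ) (fun _ => ⌈B⌉)).subset fun k hk => ?_
  have h : ∀ j, |k j| ≤ ⌈B⌉ := fun j => by
    have h1 : ((k j : ℝ)) ^ 2 ≤ B := (Finset.single_le_sum (f := fun j => (k j : ℝ) ^ 2)
      (fun _ _ => sq_nonneg _) (Finset.mem_univ j)).trans hk
    have h2 : k j ^ 2 ≤ ⌈B⌉ := by
      have := h1.trans (Int.le_ceil B)
      exact_mod_cast this
    have h3 : |k j| ≤ k j ^ 2 := by
      rw [← sq_abs]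
      nlinarith [abs_nonneg (k j), Int.le_self_sq |k j|]
    exact h3.trans h2
  exact ⟨fun j => (abs_le.1 (h j)).1, fun j => (abs_le.1 (h j)).2⟩

lemma FourierSupported.modePairing_eq_zero {v : L2Torus} {K : Set (Fin 3 → ℤ)}
    (hv : FourierSupported K v) (w : L2Torus) {k : Fin 3 → ℤ} (hk : k ∉ K) :
    modePairing v w k = 0 :=
  Finset.sum_eq_zero fun j _ => by rw [hv k hk j, zero_mul, Complex.zero_re]

lemma FourierSupported.inner_eq_sum {v : L2Torus} {K : Set (Fin 3 → ℤ)} (hK : K.Finite)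
    (hv : FourierSupported K v) (w : L2Torus) :
    (inner ℝ v w : ℝ) = ∑ k ∈ hK.toFinset, modePairing v w k :=
  (hasSum_modePairing v w).unique (hasSum_sum_of_ne_finset_zero fun _ hk =>
    hv.modePairing_eq_zero w fun h => hk (hK.mem_toFinset.2 h))

lemma FourierSupported.gradInner_eq_sum {v : L2Torus} {K : Set (Fin 3 → ℤ)} (hK : K.Finite)
    (hv : FourierSupported K v) (w : L2Torus) :
    gradInner v w = ∑ k ∈ hK.toFinset, laplaceSymbol k * modePairing v w k :=
  (gradInner_eq_tsum v w).trans <| tsum_eq_sum fun k hk => by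
    rw [hv.modePairing_eq_zero w fun h => hk (hK.mem_toFinset.2 h), mul_zero]

/-- With finitely many frequencies the Dirichlet form is a finite sum of Fourier coefficients, hence
continuous on L². -/
lemma continuous_gradInner_of_supported {K : Set (Fin 3 → ℤ)} (hK : K.Finite) {z : ℝ → L2Torus}
    (hz : Continuous z) (hzK : ∀ t, FourierSupported K (z t)) (φ : L2Torus) :
    Continuous fun t => gradInner (z t) φ := by
  simp only [fun t => (hzK t).gradInner_eq_sum hK φ, modePairing, ← fourierCLM_apply]
  fun_prop

lemma modePairing_duhamel {μ : ℝ} (hμ : 0 ≤ μ) {c : ℝ → ℝ} (hc : Continuous c) (Ψ φ : L2Torus)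
    {t : ℝ} (ht : 0 ≤ t) (k : Fin 3 → ℤ) : modePairing (duhamel μ c Ψ t) φ k =
      (∫ s in (0 : ℝ)..t, c s * Real.exp (-(μ * laplaceSymbol k * (t - s)))) *
        modePairing Ψ φ k := by
  have h : ∫ s in (0 : ℝ)..t, c s * heatSymbol (μ * (t - s)) k =
      ∫ s in (0 : ℝ)..t, c s * Real.exp (-(μ * laplaceSymbol k * (t - s))) := by
    refine intervalIntegral.integral_congr fun s hs => ?_
    rw [uIcc_of_le ht] at hs
    rw [heatSymbol, max_eq_left (mul_nonneg hμ (by linarith [hs.2]))]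
    congr 3
    ring
  simp only [modePairing, fourierCoef_duhamel hc, mul_assoc, Complex.re_ofReal_mul, Finset.mul_sum,
    h]

/-- The weak formulation of `∂ₜ z = μΔz + c Ψ`, `z(0) = 0`. -/
lemma inner_duhamel_eq {μ : ℝ} (hμ : 0 ≤ μ) {c : ℝ → ℝ} (hc : Continuous c) {Ψ : L2Torus}
    {K : Set (Fin 3 → ℤ)} (hK : K.Finite) (hΨ : FourierSupported K Ψ) (φ : L2Torus) {t : ℝ}
    (ht : 0 ≤ t) : (inner ℝ (duhamel μ c Ψ t) φ : ℝ) =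
      -μ * (∫ s in (0 : ℝ)..t, gradInner (duhamel μ c Ψ s) φ) +
        ∫ s in (0 : ℝ)..t, inner ℝ (c s • Ψ) φ := by
  set H : (Fin 3 → ℤ) → ℝ → ℝ := fun k t =>
    ∫ s in (0 : ℝ)..t, c s * Real.exp (-(μ * laplaceSymbol k * (t - s))) with hH
  have hHc : ∀ k, Continuous (H k) := fun k =>
    continuous_iff_continuousAt.2 fun t => (hasDerivAt_scalar_duhamel _ hc t).continuousAt
  have h1 : ∀ r, 0 ≤ r → ∀ k, modePairing (duhamel μ c Ψ r) φ k = H k r * modePairing Ψ φ k :=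
    fun r hr k => modePairing_duhamel hμ hc Ψ φ hr k
  have h2 : ∫ s in (0 : ℝ)..t, gradInner (duhamel μ c Ψ s) φ =
      ∑ k ∈ hK.toFinset, laplaceSymbol k * modePairing Ψ φ k * ∫ s in (0 : ℝ)..t, H k s := by
    simp only [← intervalIntegral.integral_const_mul]
    have hcont : ∀ k, Continuous fun s => laplaceSymbol k * modePairing Ψ φ k * H k s :=
      fun k => continuous_const.mul (hHc k)
    rw [← intervalIntegral.integral_finsetSum fun k _ => (hcont k).intervalIntegrable _ _]
    refine intervalIntegral.integral_congr fun s hs => ?_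
    rw [uIcc_of_le ht] at hs
    rw [(supported_duhamel hc hΨ s).gradInner_eq_sum hK]
    refine Finset.sum_congr rfl fun k _ => ?_
    rw [h1 s hs.1]
    ring
  have h3 : ∫ s in (0 : ℝ)..t, (inner ℝ (c s • Ψ) φ : ℝ) =
      ∑ k ∈ hK.toFinset, modePairing Ψ φ k * ∫ s in (0 : ℝ)..t, c s := by
    rw [← Finset.sum_mul, ← hΨ.inner_eq_sum hK, ← intervalIntegral.integral_const_mul]
    refine intervalIntegral.integral_congr fun s _ => ?_
    rw [real_inner_smul_left, mul_comm]
  rw [(supported_duhamel hc hΨ t).inner_eq_sum hK, h2, h3, Finset.mul_sum,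
    ← Finset.sum_add_distrib]
  refine Finset.sum_congr rfl fun k _ => ?_
  rw [h1 t ht]
  have h4 : H k t = -(μ * laplaceSymbol k) * (∫ s in (0 : ℝ)..t, H k s) +
      ∫ s in (0 : ℝ)..t, c s := scalar_duhamel_eq _ hc t
  rw [h4]
  ring

/-! ### The weak formulation for the free evolution -/

/-- The contribution of the frequency `k` to `⟨∇ e^{μsΔ} v₀, ∇φ⟩`. -/
def heatGradMode (μ : ℝ) (v₀ φ : L2Torus) (k : Fin 3 → ℤ) (s : ℝ) : ℝ :=
  laplaceSymbol k * Real.exp (-(laplaceSymbol k * (μ * s))) * modePairing v₀ φ k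

lemma continuous_heatGradMode (μ : ℝ) (v₀ φ : L2Torus) (k : Fin 3 → ℤ) :
    Continuous (heatGradMode μ v₀ φ k) := by
  unfold heatGradMode; fun_prop

lemma modePairing_heat {μ s : ℝ} (hμs : 0 ≤ μ * s) (v₀ φ : L2Torus) (k : Fin 3 → ℤ) :
    modePairing (heat (μ * s) v₀) φ k =
      Real.exp (-(laplaceSymbol k * (μ * s))) * modePairing v₀ φ k := by
  rw [(heat_spec _ v₀).modePairing_left, heatSymbol, max_eq_left hμs]

lemma integral_heatGradMode {μ : ℝ} (v₀ φ : L2Torus) (k : Fin 3 → ℤ) (t : ℝ) :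
    μ * ∫ s in (0 : ℝ)..t, heatGradMode μ v₀ φ k s =
      modePairing v₀ φ k - Real.exp (-(laplaceSymbol k * (μ * t))) * modePairing v₀ φ k := by
  have hd : ∀ s ∈ uIcc 0 t, HasDerivAt
      (fun s => -Real.exp (-(laplaceSymbol k * (μ * s))) * modePairing v₀ φ k)
      (μ * heatGradMode μ v₀ φ k s) s := fun s _ => by
    have h1 : HasDerivAt (fun s => -(laplaceSymbol k * (μ * s))) (-(laplaceSymbol k * μ)) s := by
      simpa using (((hasDerivAt_id s).const_mul μ).const_mul (laplaceSymbol k)).fun_neg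
    refine ((h1.exp.fun_neg).mul_const (modePairing v₀ φ k)).congr_deriv ?_
    unfold heatGradMode
    ring
  rw [← intervalIntegral.integral_const_mul, intervalIntegral.integral_eq_sub_of_hasDerivAt hd
    ((continuous_const.mul (continuous_heatGradMode μ v₀ φ k)).intervalIntegrable _ _)]
  simp
  ring

lemma summable_abs_modePairing (v w : L2Torus) : Summable fun k => |modePairing v w k| :=
  (hasSum_modePairing v w).summable.abs

/-- A mode has constant sign in time, so the integral of its modulus is the modulus of its explicit
integral. The bound is summable in k for any L² field `φ`. -/
lemma integral_abs_heatGradMode_le {μ T : ℝ} (hμ : 1 ≤ μ) (hT : 0 ≤ T) (v₀ φ : L2Torus)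
    (k : Fin 3 → ℤ) :
    ∫ s in Ioc 0 T, ‖heatGradMode μ v₀ φ k s‖ ≤ |modePairing v₀ φ k| := by
  have hq := laplaceSymbol_nonneg k
  have h1 : ∀ s, ‖heatGradMode μ v₀ φ k s‖ = SignType.sign (modePairing v₀ φ k) *
      heatGradMode μ v₀ φ k s := fun s => by
    rw [heatGradMode, norm_mul, Real.norm_of_nonneg (by positivity), Real.norm_eq_abs,
      ← sign_mul_self (modePairing v₀ φ k)]
    ring
  simp only [h1]
  rw [← intervalIntegral.integral_of_le hT, intervalIntegral.integral_const_mul]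
  have h2 := integral_heatGradMode (μ := μ) v₀ φ k T
  have h3 : ∫ s in (0 : ℝ)..T, heatGradMode μ v₀ φ k s =
      μ⁻¹ * (1 - Real.exp (-(laplaceSymbol k * (μ * T)))) * modePairing v₀ φ k := by
    rw [mul_assoc, eq_inv_mul_iff_mul_eq₀ (by linarith), h2]
    ring
  have h4 : 0 ≤ 1 - Real.exp (-(laplaceSymbol k * (μ * T))) := by
    rw [sub_nonneg, Real.exp_le_one_iff, neg_nonpos]
    positivity
  have h5 : μ⁻¹ * (1 - Real.exp (-(laplaceSymbol k * (μ * T)))) ≤ 1 := by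
    refine mul_le_one₀ (inv_le_one_of_one_le₀ hμ) h4 ?_
    linarith [Real.exp_pos (-(laplaceSymbol k * (μ * T)))]
  rw [h3]
  calc _ = μ⁻¹ * (1 - Real.exp (-(laplaceSymbol k * (μ * T)))) *
        (SignType.sign (modePairing v₀ φ k) * modePairing v₀ φ k) := by ring
    _ ≤ 1 * |modePairing v₀ φ k| := by
        rw [sign_mul_self]
        exact mul_le_mul_of_nonneg_right h5 (abs_nonneg _)
    _ = _ := one_mul _

lemma summable_integral_heatGradMode {μ T : ℝ} (hμ : 1 ≤ μ) (hT : 0 ≤ T) (v₀ φ : L2Torus) :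
    Summable fun k => ∫ s in Ioc 0 T, ‖heatGradMode μ v₀ φ k s‖ :=
  (summable_abs_modePairing v₀ φ).of_nonneg_of_le
    (fun _ => integral_nonneg fun _ => norm_nonneg _)
    fun k => integral_abs_heatGradMode_le hμ hT v₀ φ k

lemma integrableOn_heatGradMode (μ T : ℝ) (v₀ φ : L2Torus) (k : Fin 3 → ℤ) :
    IntegrableOn (heatGradMode μ v₀ φ k) (Ioc 0 T) :=
  (continuous_heatGradMode μ v₀ φ k).integrableOn_Ioc

/-- The weak formulation of the heat equation. -/
lemma inner_heat_eq {μ t : ℝ} (hμ : 1 ≤ μ) (ht : 0 ≤ t) (v₀ φ : L2Torus) :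
    (inner ℝ (heat (μ * t) v₀) φ : ℝ) = inner ℝ v₀ φ -
      μ * ∫ s in Ioc 0 t, ∑' k, heatGradMode μ v₀ φ k s := by
  have h1 := (hasSum_integral_of_summable_integral_norm
    (fun k => integrableOn_heatGradMode μ t v₀ φ k)
    (summable_integral_heatGradMode hμ ht v₀ φ)).mul_left μ
  have h2 := (hasSum_modePairing v₀ φ).sub h1
  refine (hasSum_modePairing (heat (μ * t) v₀) φ).unique (h2.congr_fun fun k => ?_)
  rw [← intervalIntegral.integral_of_le ht, integral_heatGradMode,
    modePairing_heat (by positivity)]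
  ring

/-! ### Sobolev bounds -/

lemma measurable_sobolevNormSq {w : ℝ → L2Torus} (hw : Continuous w) :
    Measurable fun t => sobolevNormSq 1 (w t) := by
  unfold sobolevNormSq
  refine Measurable.tsum fun k => ?_
  simp only [← fourierCLM_apply]
  refine ENNReal.measurable_ofReal.comp (Continuous.measurable ?_)
  fun_prop

lemma sobolevNormSq_add_le (a b : L2Torus) :
    sobolevNormSq 1 (a + b) ≤ 2 * sobolevNormSq 1 a + 2 * sobolevNormSq 1 b := by
  unfold sobolevNormSq
  rw [← ENNReal.tsum_mul_left, ← ENNReal.tsum_mul_left, ← ENNReal.tsum_add]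
  refine ENNReal.tsum_le_tsum fun k => ?_
  have hb := besselSymbol_pos k
  have h2 : ∀ x : ℝ, 2 * ENNReal.ofReal x = ENNReal.ofReal (2 * x) := fun x => by
    rw [ENNReal.ofReal_mul zero_le_two, ENNReal.ofReal_ofNat]
  rw [h2, h2, ← ENNReal.ofReal_add (by positivity) (by positivity)]
  refine ENNReal.ofReal_le_ofReal ?_
  have h3 : ∑ j, ‖fourierCoef (a + b) k j‖ ^ 2 ≤
      2 * ∑ j, ‖fourierCoef a k j‖ ^ 2 + 2 * ∑ j, ‖fourierCoef b k j‖ ^ 2 := by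
    rw [Finset.mul_sum, Finset.mul_sum, ← Finset.sum_add_distrib]
    refine Finset.sum_le_sum fun j _ => ?_
    rw [fourierCoef_add]
    have := norm_add_le (fourierCoef a k j) (fourierCoef b k j)
    nlinarith [norm_nonneg (fourierCoef a k j + fourierCoef b k j),
      sq_nonneg (‖fourierCoef a k j‖ - ‖fourierCoef b k j‖)]
  calc _ ≤ besselSymbol k ^ (1 : ℝ) *
        (2 * ∑ j, ‖fourierCoef a k j‖ ^ 2 + 2 * ∑ j, ‖fourierCoef b k j‖ ^ 2) := by gcongr
    _ = _ := by ring

lemma integral_laplaceSymbol_exp_le {q μ T : ℝ} (hμ : 1 ≤ μ) :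
    ∫ s in (0 : ℝ)..T, q * Real.exp (-(q * (μ * s))) ≤ 1 := by
  have hμ0 : 0 < μ := by linarith
  have hd : ∀ s ∈ uIcc 0 T, HasDerivAt (fun s => -Real.exp (-(q * (μ * s))) / μ)
      (q * Real.exp (-(q * (μ * s)))) s := fun s _ => by
    have h1 : HasDerivAt (fun s => -(q * (μ * s))) (-(q * μ)) s := by
      simpa using (((hasDerivAt_id s).const_mul μ).const_mul q).fun_neg
    refine ((h1.exp.fun_neg).div_const μ).congr_deriv ?_
    field_simp
  rw [intervalIntegral.integral_eq_sub_of_hasDerivAt hd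
    (Continuous.intervalIntegrable (by fun_prop) _ _)]
  simp only [mul_zero, neg_zero, Real.exp_zero]
  rw [div_sub_div_same, div_le_one hμ0]
  linarith [Real.exp_pos (-(q * (μ * T)))]

/-- The free evolution belongs to `L²(0,T; H¹)`. -/
lemma lintegral_sobolevNormSq_heat_lt_top {μ T : ℝ} (hμ : 1 ≤ μ) (hT : 0 ≤ T) (v₀ : L2Torus) :
    ∫⁻ t in Ioc 0 T, sobolevNormSq 1 (heat (μ * t) v₀) < ∞ := by
  have hterm : ∀ k, ∫⁻ t in Ioc 0 T, ENNReal.ofReal (besselSymbol k ^ (1 : ℝ) *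
      ∑ j, ‖fourierCoef (heat (μ * t) v₀) k j‖ ^ 2) ≤
      ENNReal.ofReal ((T + 1) * ∑ j, ‖fourierCoef v₀ k j‖ ^ 2) := fun k => by
    have hq := laplaceSymbol_nonneg k
    have hS : 0 ≤ ∑ j, ‖fourierCoef v₀ k j‖ ^ 2 := by positivity
    set S := ∑ j, ‖fourierCoef v₀ k j‖ ^ 2 with hSdef
    have hcont : Continuous fun t =>
        (1 + laplaceSymbol k * Real.exp (-(laplaceSymbol k * (μ * t)))) * S := by fun_prop
    calc _ ≤ ∫⁻ t in Ioc 0 T, ENNReal.ofReal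
          ((1 + laplaceSymbol k * Real.exp (-(laplaceSymbol k * (μ * t)))) * S) := by
          refine setLIntegral_mono' measurableSet_Ioc fun t ht => ENNReal.ofReal_le_ofReal ?_
          have hμt : 0 ≤ μ * t := mul_nonneg (by linarith) ht.1.le
          rw [(heat_spec _ v₀).normSq_mode, heatSymbol, max_eq_left hμt, ← hSdef, Real.rpow_one,
            ← mul_assoc, besselSymbol_eq]
          refine mul_le_mul_of_nonneg_right ?_ hS
          have he0 := Real.exp_pos (-(laplaceSymbol k * (μ * t)))
          have he1 : Real.exp (-(laplaceSymbol k * (μ * t))) ≤ 1 := by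
            rw [Real.exp_le_one_iff, neg_nonpos]; positivity
          set e := Real.exp (-(laplaceSymbol k * (μ * t)))
          -- Hence (1 + q)e² ≤ 1 + qe with q = 4π²|k|², and ∫ qe dt ≤ 1 independently of k.
          have he2 : e ^ 2 ≤ e := pow_le_of_le_one he0.le he1 two_ne_zero
          nlinarith
      _ = ENNReal.ofReal (∫ t in Ioc 0 T,
          (1 + laplaceSymbol k * Real.exp (-(laplaceSymbol k * (μ * t)))) * S) := by
          rw [ofReal_integral_eq_lintegral_ofReal hcont.integrableOn_Ioc
            (.of_forall fun t => by positivity)]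
      _ ≤ _ := by
          refine ENNReal.ofReal_le_ofReal ?_
          rw [← intervalIntegral.integral_of_le hT, intervalIntegral.integral_mul_const,
            intervalIntegral.integral_add (by simp)
              (Continuous.intervalIntegrable (by fun_prop) _ _)]
          refine mul_le_mul_of_nonneg_right (add_le_add (by simp) ?_) hS
          exact integral_laplaceSymbol_exp_le hμ
  unfold sobolevNormSq
  rw [lintegral_tsum fun k => ?_]
  · refine (ENNReal.tsum_le_tsum hterm).trans_lt ?_
    exact ((hasSum_normSq_fourierCoef v₀).summable.mul_left (T + 1)).tsum_ofReal_lt_top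
  · have hc : Continuous fun t => heat (μ * t) v₀ :=
      (continuous_heat v₀).comp (continuous_const.mul continuous_id)
    simp only [← fourierCLM_apply]
    refine Measurable.aemeasurable (ENNReal.measurable_ofReal.comp (Continuous.measurable ?_))
    fun_prop

/-- Cauchy–Schwarz for weighted series. -/
lemma sq_tsum_mul_le {ι : Type*} {r x : ι → ℝ} (hr : ∀ i, 0 ≤ r i) (hx : ∀ i, 0 ≤ x i)
    (hrs : Summable r) (hs : Summable fun i => r i * x i ^ 2) :
    (∑' i, r i * x i) ^ 2 ≤ (∑' i, r i) * ∑' i, r i * x i ^ 2 := by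
  have h := Real.inner_le_Lp_mul_Lq_tsum_of_nonneg (p := 2) (q := 2)
    (f := fun i => √(r i)) (g := fun i => √(r i) * x i) Real.HolderConjugate.two_two
    (fun i => Real.sqrt_nonneg _) (fun i => mul_nonneg (Real.sqrt_nonneg _) (hx i))
    (hrs.congr fun i => by rw [Real.rpow_two, Real.sq_sqrt (hr i)])
    (hs.congr fun i => by rw [Real.rpow_two, mul_pow, Real.sq_sqrt (hr i)])
  have e1 : ∀ i, √(r i) * (√(r i) * x i) = r i * x i := fun i => by
    rw [← mul_assoc, Real.mul_self_sqrt (hr i)]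
  simp only [e1, Real.rpow_two, mul_pow, Real.sq_sqrt (hr _), ← Real.sqrt_eq_rpow] at h
  have h0 : 0 ≤ ∑' i, r i * x i := tsum_nonneg fun i => mul_nonneg (hr i) (hx i)
  have h1 : 0 ≤ ∑' i, r i := tsum_nonneg hr
  have h2 : 0 ≤ ∑' i, r i * x i ^ 2 := tsum_nonneg fun i => mul_nonneg (hr i) (sq_nonneg _)
  calc _ ≤ (√(∑' i, r i) * √(∑' i, r i * x i ^ 2)) ^ 2 := pow_le_pow_left₀ h0 h 2
    _ = _ := by rw [mul_pow, Real.sq_sqrt h1, Real.sq_sqrt h2]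

lemma finite_of_besselSymbol_le {K : Set (Fin 3 → ℤ)} {B : ℝ} (h : ∀ k ∈ K, besselSymbol k ≤ B) :
    K.Finite := by
  refine (finite_normSqLattice_le B).subset fun k hk => ?_
  have h1 := h k hk
  have h2 := normSqLattice_nonneg k
  have h3 : 1 ≤ 4 * Real.pi ^ 2 := by nlinarith [Real.pi_gt_three]
  rw [besselSymbol] at h1
  exact (by nlinarith : normSqLattice k ≤ B)

namespace CascadeData

variable {m : ℕ} (D : CascadeData m)

/-! ### Time integrals of the weights -/

lemma continuousOn_timeWeight (n : ℤ) (T : ℝ) : ContinuousOn (D.timeWeight n) (Icc 0 T) := by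
  unfold timeWeight
  refine ContinuousOn.inv₀ (by fun_prop) fun t ht => ?_
  have := mul_nonneg (D.scaleSq_pos n).le ht.1
  linarith

lemma integrableOn_scaleSq_timeWeight_sq (n : ℤ) (T : ℝ) :
    IntegrableOn (fun t => D.scaleSq n * D.timeWeight n t ^ 2) (Ioc 0 T) :=
  ((continuousOn_const.mul ((D.continuousOn_timeWeight n T).pow 2)).integrableOn_compact
    isCompact_Icc).mono_set Ioc_subset_Icc_self

/-- The integrand is the derivative of -w_n. The uniformity in n is the reason for choosing this
weight: it makes two derivatives at scale n integrable in time at no cost. -/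
lemma integral_scaleSq_timeWeight_sq_le (n : ℤ) {T : ℝ} (hT : 0 ≤ T) :
    ∫ t in Ioc 0 T, D.scaleSq n * D.timeWeight n t ^ 2 ≤ 1 := by
  have hd : ∀ t ∈ uIcc 0 T, HasDerivAt (fun t => -D.timeWeight n t)
      (D.scaleSq n * D.timeWeight n t ^ 2) t := fun t ht => by
    rw [uIcc_of_le hT] at ht
    have h0 : 1 + D.scaleSq n * t ≠ 0 := by
      have := mul_nonneg (D.scaleSq_pos n).le ht.1
      linarith
    have h1 : HasDerivAt (fun t => 1 + D.scaleSq n * t) (D.scaleSq n) t := by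
      simpa using ((hasDerivAt_id t).const_mul (D.scaleSq n)).const_add 1
    refine (h1.fun_inv h0).fun_neg.congr_deriv ?_
    rw [timeWeight]
    field_simp
  have hi : IntervalIntegrable (fun t => D.scaleSq n * D.timeWeight n t ^ 2) volume 0 T :=
    (intervalIntegrable_iff_integrableOn_Ioc_of_le hT).2 (D.integrableOn_scaleSq_timeWeight_sq n T)
  rw [← intervalIntegral.integral_of_le hT, intervalIntegral.integral_eq_sub_of_hasDerivAt hd hi]
  have h1 := D.timeWeight_pos n hT
  have h2 := D.timeWeight_le_one n le_rfl
  linarith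

lemma setIntegral_norm_le_of_le {E : Type*} [NormedAddCommGroup E] {f : ℝ → E} {a b T : ℝ} (n : ℤ)
    (hT : 0 ≤ T) (hb : 0 ≤ b) (hf : IntegrableOn f (Ioc 0 T))
    (h : ∀ t ∈ Ioc 0 T, ‖f t‖ ≤ a + b * (D.scaleSq n * D.timeWeight n t ^ 2)) :
    ∫ t in Ioc 0 T, ‖f t‖ ≤ a * T + b := by
  have hi := D.integrableOn_scaleSq_timeWeight_sq n T
  have hc : IntegrableOn (fun _ : ℝ => a) (Ioc 0 T) := integrableOn_const (by simp)
  calc ∫ t in Ioc 0 T, ‖f t‖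
      ≤ ∫ t in Ioc 0 T, (a + b * (D.scaleSq n * D.timeWeight n t ^ 2)) :=
        setIntegral_mono_on hf.norm (hc.add (hi.const_mul b)) measurableSet_Ioc h
    _ = a * T + b * ∫ t in Ioc 0 T, D.scaleSq n * D.timeWeight n t ^ 2 := by
        rw [integral_add hc (hi.const_mul b), integral_const_mul]
        simp [hT, mul_comm]
    _ ≤ a * T + b * 1 := by
        have := D.integral_scaleSq_timeWeight_sq_le n hT
        gcongr
    _ = _ := by ring

/-- The weight `(1+ε₀)ⁿ / (1 + (1+ε₀)^{2n} t)` controlling the gradient at scale `n`. -/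
def gradWeight (n : ℤ) (t : ℝ) : ℝ := √(D.scaleSq n) * D.timeWeight n t

lemma gradWeight_nonneg (n : ℤ) {t : ℝ} (ht : 0 ≤ t) : 0 ≤ D.gradWeight n t :=
  mul_nonneg (Real.sqrt_nonneg _) (D.timeWeight_pos n ht).le

lemma gradWeight_sq (n : ℤ) (t : ℝ) : D.gradWeight n t ^ 2 = D.scaleSq n * D.timeWeight n t ^ 2 := by
  rw [gradWeight, mul_pow, Real.sq_sqrt (D.scaleSq_pos n).le]

lemma gradWeight_le (n : ℤ) (t : ℝ) :
    D.gradWeight n t ≤ 1 + D.scaleSq n * D.timeWeight n t ^ 2 := by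
  rw [← D.gradWeight_sq]
  nlinarith [sq_nonneg (D.gradWeight n t - 1)]

/-- From Lt ≤ (1 + Lt)². The bound is uniform in n and gives convergence in H¹ at each fixed
positive time, though it is not integrable at t = 0. -/
lemma gradWeight_sq_le (n : ℤ) {t : ℝ} (ht : 0 < t) : D.gradWeight n t ^ 2 ≤ 1 / t := by
  have hs := D.scaleSq_pos n
  rw [gradWeight_sq, timeWeight, inv_pow, ← div_eq_mul_inv, div_le_div_iff₀ (by positivity) ht]
  nlinarith [mul_pos hs ht]

/-! ### Gradient bounds for the Duhamel terms -/

lemma finite_outFreq (p : ℤ × (Fin 3 → Fin m) × shifts) : (D.outFreq p).Finite :=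
  finite_of_besselSymbol_le fun _ hk => D.besselSymbol_le hk

/-- `(Id - Δ)^{1/2}` applied to a Duhamel term. -/
def duhamelRoot (ρ μ : ℝ) (v : ℝ → L2Torus) (p : ℤ × (Fin 3 → Fin m) × shifts) (t : ℝ) : L2Torus :=
  besselPow (1 / 2) (D.duhamelTerm ρ μ v p t)

lemma duhamelRoot_spec (ρ μ : ℝ) {v : ℝ → L2Torus} (hv : Continuous v)
    (p : ℤ × (Fin 3 → Fin m) × shifts) (t : ℝ) :
    FourierMul (besselPowSymbol (1 / 2)) (D.duhamelTerm ρ μ v p t) (D.duhamelRoot ρ μ v p t) :=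
  besselPow_spec_of_supported (D.supported_duhamelTerm ρ μ hv p t) fun _ hk => D.besselSymbol_le hk

/-- The constant in the gradient bound for the Duhamel terms. -/
def gradConst (ρ μ M : ℝ) : ℝ := √(4 * symbolConst) * (D.cascadeConst ρ * M ^ 2 / μ)

lemma gradConst_nonneg (ρ M : ℝ) {μ : ℝ} (hμ : 1 ≤ μ) : 0 ≤ D.gradConst ρ μ M := by
  have := D.cascadeConst_nonneg ρ
  unfold gradConst
  positivity

lemma norm_duhamelRoot_le {ρ μ M : ℝ} (hρ : 0 ≤ ρ) (hμ : 1 ≤ μ) (hM : 0 ≤ M)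
    {v : ℝ → L2Torus} (hvc : Continuous v)
    (hv : ∀ i n t, 0 ≤ t → D.amplitude ρ i n (v t) ≤ M * D.timeWeight n t)
    (p : ℤ × (Fin 3 → Fin m) × shifts) {t : ℝ} (ht : 0 ≤ t) :
    ‖D.duhamelRoot ρ μ v p t‖ ≤ D.gradConst ρ μ M * D.decay ρ p * D.gradWeight p.1 t := by
  have hs := D.scaleSq_pos p.1
  have hC := symbolConst_pos
  have h := (D.duhamelRoot_spec ρ μ hvc p t).norm_le (D.supported_duhamelTerm ρ μ hvc p t)
    (B := √(4 * symbolConst) * √(D.scaleSq p.1)) (by positivity) fun k hk => by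
      rw [abs_of_pos (besselPowSymbol_pos _ k), besselPowSymbol, ← Real.sqrt_eq_rpow,
        ← Real.sqrt_mul (by positivity)]
      refine Real.sqrt_le_sqrt ((D.besselSymbol_le hk).trans ?_)
      nlinarith [D.scaleSq_shift_le p.1 p.2.2 2]
  refine (h.trans (mul_le_mul_of_nonneg_left
    (D.norm_duhamelTerm_le_timeWeight hρ hμ hM hv p ht) (by positivity))).trans (le_of_eq ?_)
  rw [gradConst, gradWeight]
  ring

/-! ### Decaying mild solutions: regularity and passage to weak solutions. -/

/-- A global mild solution with decaying wavelet amplitudes. -/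
structure IsDecayingMildSolution (ρ μ M : ℝ) (v₀ : L2Torus) (v : ℝ → L2Torus) : Prop where
  continuous : Continuous v
  norm_le : ∀ t, ‖v t‖ ≤ M
  amplitude_le : ∀ i n t, 0 ≤ t → D.amplitude ρ i n (v t) ≤ M * D.timeWeight n t
  mild : ∀ t, 0 ≤ t → v t = heat (μ * t) v₀ + ∑' p, D.duhamelTerm ρ μ v p t

namespace IsDecayingMildSolution

variable {D} {ρ μ M : ℝ} {v₀ : L2Torus} {v : ℝ → L2Torus}

lemma nonneg (h : D.IsDecayingMildSolution ρ μ M v₀ v) : 0 ≤ M :=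
  (norm_nonneg _).trans (h.norm_le 0)

lemma hasSum_duhamelTerm (h : D.IsDecayingMildSolution ρ μ M v₀ v) (hρ : 1 / 4 < ρ) (hμ : 1 ≤ μ)
    {t : ℝ} (ht : 0 ≤ t) :
    HasSum (fun p => D.duhamelTerm ρ μ v p t) (v t - heat (μ * t) v₀) := by
  rw [h.mild t ht, add_sub_cancel_left]
  exact (D.summable_duhamelTerm hρ hμ h.norm_le ht).hasSum

lemma summable_duhamelRoot (h : D.IsDecayingMildSolution ρ μ M v₀ v) (hρ : 1 / 4 < ρ) (hμ : 1 ≤ μ)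
    {t : ℝ} (ht : 0 < t) : Summable fun p => ‖D.duhamelRoot ρ μ v p t‖ := by
  refine ((D.summable_decay hρ).mul_left (D.gradConst ρ μ M * √(1 / t))).of_nonneg_of_le
    (fun p => norm_nonneg _) fun p => ?_
  refine (D.norm_duhamelRoot_le (by linarith) hμ h.nonneg h.continuous h.amplitude_le p
    ht.le).trans ?_
  have h1 : D.gradWeight p.1 t ≤ √(1 / t) := Real.le_sqrt_of_sq_le (D.gradWeight_sq_le p.1 ht)
  have h2 := D.gradConst_nonneg ρ M hμ
  have h3 := (D.decay_pos ρ p).le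
  calc _ ≤ D.gradConst ρ μ M * D.decay ρ p * √(1 / t) := by gcongr
    _ = _ := by ring

lemma duhamelRoot_tsum_spec (h : D.IsDecayingMildSolution ρ μ M v₀ v) (hρ : 1 / 4 < ρ)
    (hμ : 1 ≤ μ) {t : ℝ} (ht : 0 < t) :
    FourierMul (besselPowSymbol (1 / 2)) (v t - heat (μ * t) v₀)
      (∑' p, D.duhamelRoot ρ μ v p t) := fun k j => by
  have h1 := (fourierCLM k j).hasSum (h.hasSum_duhamelTerm hρ hμ ht.le)
  have h2 := (fourierCLM k j).hasSum (h.summable_duhamelRoot hρ hμ ht).of_norm.hasSum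
  simp only [fourierCLM_apply] at h1 h2
  exact h2.unique ((h1.mul_left _).congr_fun fun p => D.duhamelRoot_spec ρ μ h.continuous p t k j)

/-- The solution belongs to `L²(0,T; H¹)`. -/
theorem lintegral_sobolevNormSq_lt_top (h : D.IsDecayingMildSolution ρ μ M v₀ v) (hρ : 1 / 4 < ρ)
    (hμ : 1 ≤ μ) {T : ℝ} (hT : 0 ≤ T) : ∫⁻ t in Ioc 0 T, sobolevNormSq 1 (v t) < ∞ := by
  have hheat : Continuous fun t => heat (μ * t) v₀ :=
    (continuous_heat v₀).comp (continuous_const.mul continuous_id)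
  have hC := D.gradConst_nonneg ρ M hμ
  set C := D.gradConst ρ μ M
  set Θ := ∑' p, D.decay ρ p with hΘ
  have hΘ0 : 0 ≤ Θ := tsum_nonneg fun p => (D.decay_pos ρ p).le
  have hz : ∫⁻ t in Ioc 0 T, sobolevNormSq 1 (v t - heat (μ * t) v₀) < ∞ := by
    have hpt : ∀ t ∈ Ioc 0 T, sobolevNormSq 1 (v t - heat (μ * t) v₀) ≤
        ∑' p, ENNReal.ofReal (C ^ 2 * Θ * D.decay ρ p *
          (D.scaleSq p.1 * D.timeWeight p.1 t ^ 2)) := fun t ht => by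
      have hg0 : ∀ p : ℤ × (Fin 3 → Fin m) × shifts, 0 ≤ D.gradWeight p.1 t :=
        fun p => D.gradWeight_nonneg _ ht.1.le
      have hd0 : ∀ p, 0 ≤ D.decay ρ p := fun p => (D.decay_pos ρ p).le
      have hs2 : Summable fun p => D.decay ρ p * D.gradWeight p.1 t ^ 2 :=
        ((D.summable_decay hρ).mul_right (1 / t)).of_nonneg_of_le
          (fun p => mul_nonneg (hd0 p) (sq_nonneg _))
          fun p => mul_le_mul_of_nonneg_left (D.gradWeight_sq_le p.1 ht.1) (hd0 p)
      have hs1 : Summable fun p => D.decay ρ p * D.gradWeight p.1 t :=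
        ((D.summable_decay hρ).mul_right (√(1 / t))).of_nonneg_of_le
          (fun p => mul_nonneg (hd0 p) (hg0 p))
          fun p => mul_le_mul_of_nonneg_left
            (Real.le_sqrt_of_sq_le (D.gradWeight_sq_le p.1 ht.1)) (hd0 p)
      have hn : ‖∑' p, D.duhamelRoot ρ μ v p t‖ ≤ C * ∑' p, D.decay ρ p * D.gradWeight p.1 t :=
        tsum_of_norm_bounded (hs1.hasSum.mul_left C) fun p => by
          rw [← mul_assoc]
          exact D.norm_duhamelRoot_le (by linarith) hμ h.nonneg h.continuous h.amplitude_le p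
            ht.1.le
      -- Cauchy–Schwarz with the summable weights `decay` brings the square inside the sum, so that
      -- the time integral can be estimated scale by scale.
      have hcs := sq_tsum_mul_le hd0 hg0 (D.summable_decay hρ) hs2
      rw [(h.duhamelRoot_tsum_spec hρ hμ ht.1).sobolevNormSq_eq,
        ← ENNReal.ofReal_tsum_of_nonneg (fun p => ?_) ?_]
      · refine ENNReal.ofReal_le_ofReal ?_
        calc _ ≤ (C * ∑' p, D.decay ρ p * D.gradWeight p.1 t) ^ 2 :=
              pow_le_pow_left₀ (norm_nonneg _) hn 2
          _ ≤ C ^ 2 * (Θ * ∑' p, D.decay ρ p * D.gradWeight p.1 t ^ 2) := by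
              rw [mul_pow]
              exact mul_le_mul_of_nonneg_left hcs (sq_nonneg _)
          _ = _ := by
              rw [← mul_assoc, ← tsum_mul_left]
              refine tsum_congr fun p => ?_
              rw [gradWeight_sq]
              ring
      · refine (hs2.mul_left (C ^ 2 * Θ)).congr fun p => ?_
        rw [gradWeight_sq]
        ring
      · have := hd0 p
        have := (D.scaleSq_pos p.1).le
        positivity
    refine (setLIntegral_mono' measurableSet_Ioc hpt).trans_lt ?_
    have hint : ∀ p : ℤ × (Fin 3 → Fin m) × shifts, IntegrableOn (fun t => C ^ 2 * Θ * D.decay ρ p *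
        (D.scaleSq p.1 * D.timeWeight p.1 t ^ 2)) (Ioc 0 T) := fun p =>
      (D.integrableOn_scaleSq_timeWeight_sq p.1 T).const_mul _
    rw [lintegral_tsum fun p => (hint p).aestronglyMeasurable.aemeasurable.ennreal_ofReal]
    refine lt_of_le_of_lt (ENNReal.tsum_le_tsum fun p => ?_)
      ((D.summable_decay hρ).mul_left (C ^ 2 * Θ)).tsum_ofReal_lt_top
    have hd0 := (D.decay_pos ρ p).le
    have hs0 := (D.scaleSq_pos p.1).le
    rw [← ofReal_integral_eq_lintegral_ofReal (hint p) (.of_forall fun t => by positivity),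
      integral_const_mul]
    refine ENNReal.ofReal_le_ofReal (mul_le_of_le_one_right (by positivity) ?_)
    exact D.integral_scaleSq_timeWeight_sq_le p.1 hT
  have hle : ∀ t, sobolevNormSq 1 (v t) ≤
      2 * sobolevNormSq 1 (heat (μ * t) v₀) + 2 * sobolevNormSq 1 (v t - heat (μ * t) v₀) :=
    fun t => by
      have := sobolevNormSq_add_le (heat (μ * t) v₀) (v t - heat (μ * t) v₀)
      rwa [add_sub_cancel] at this
  refine (lintegral_mono hle).trans_lt ?_
  have hm := measurable_sobolevNormSq hheat
  have hm' : Measurable fun t => sobolevNormSq 1 (v t - heat (μ * t) v₀) :=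
    measurable_sobolevNormSq (h.continuous.sub hheat)
  rw [lintegral_add_left (hm.const_mul 2), lintegral_const_mul 2 hm, lintegral_const_mul 2 hm']
  exact ENNReal.add_lt_top.2 ⟨ENNReal.mul_lt_top (by simp)
    (lintegral_sobolevNormSq_heat_lt_top hμ hT v₀), ENNReal.mul_lt_top (by simp) hz⟩

/-! ### The weak formulation -/

lemma integrableOn_gradInner_duhamelTerm (h : D.IsDecayingMildSolution ρ μ M v₀ v) (φ : L2Torus)
    (p : ℤ × (Fin 3 → Fin m) × shifts) (T : ℝ) :
    IntegrableOn (fun s => gradInner (D.duhamelTerm ρ μ v p s) φ) (Ioc 0 T) :=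
  (continuous_gradInner_of_supported (D.finite_outFreq p)
    (D.continuous_duhamelTerm ρ μ h.continuous p)
    (D.supported_duhamelTerm ρ μ h.continuous p) φ).integrableOn_Ioc

/-- The gradient weight is at most 1 + λ^{2n}w_n², whose integral over (0,T) is at most T + 1 for
every n. -/
lemma summable_integral_gradInner (h : D.IsDecayingMildSolution ρ μ M v₀ v) (hρ : 1 / 4 < ρ)
    (hμ : 1 ≤ μ) {T : ℝ} (hT : 0 ≤ T) {φ : L2Torus} (hφ : InSobolev 1 φ) :
    Summable fun p => ∫ s in Ioc 0 T, ‖gradInner (D.duhamelTerm ρ μ v p s) φ‖ := by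
  obtain ⟨X, hX⟩ := hφ.exists_dirichlet
  have hC := D.gradConst_nonneg ρ M hμ
  refine ((D.summable_decay hρ).mul_left (D.gradConst ρ μ M * ‖X‖ * (T + 1))).of_nonneg_of_le
    (fun p => integral_nonneg fun _ => norm_nonneg _) fun p => ?_
  have hd0 := (D.decay_pos ρ p).le
  refine (D.setIntegral_norm_le_of_le (a := D.gradConst ρ μ M * D.decay ρ p * ‖X‖)
    (b := D.gradConst ρ μ M * D.decay ρ p * ‖X‖) p.1 hT (by positivity)
    (h.integrableOn_gradInner_duhamelTerm φ p T) fun s hs => ?_).trans (le_of_eq (by ring))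
  rw [gradInner_eq_inner (D.duhamelRoot_spec ρ μ h.continuous p s) hX, Real.norm_eq_abs]
  refine (abs_real_inner_le_norm _ _).trans ?_
  have h1 := D.norm_duhamelRoot_le (by linarith) hμ h.nonneg h.continuous h.amplitude_le p hs.1.le
  have h2 := D.gradWeight_le p.1 s
  calc _ ≤ (D.gradConst ρ μ M * D.decay ρ p *
        (1 + D.scaleSq p.1 * D.timeWeight p.1 s ^ 2)) * ‖X‖ := by
        gcongr
        exact h1.trans (by gcongr)
    _ = _ := by ring

/-- The Dirichlet form of the solution, as a sum over heat modes and Duhamel terms. -/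
lemma gradInner_ae_eq (h : D.IsDecayingMildSolution ρ μ M v₀ v) (hρ : 1 / 4 < ρ)
    (hμ : 1 ≤ μ) {T : ℝ} (hT : 0 ≤ T) {φ : L2Torus} (hφ : InSobolev 1 φ) :
    (fun s => gradInner (v s) φ) =ᵐ[volume.restrict (Ioc 0 T)]
      fun s => (∑' k, heatGradMode μ v₀ φ k s) + ∑' p, gradInner (D.duhamelTerm ρ μ v p s) φ := by
  obtain ⟨X, hX⟩ := hφ.exists_dirichlet
  -- Absolute convergence of the mode series is obtained only for almost every time, which suffices
  -- under the integral.
  filter_upwards [ae_summable_norm_of_summable_integral_norm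
    (fun k => integrableOn_heatGradMode μ T v₀ φ k) (summable_integral_heatGradMode hμ hT v₀ φ),
    ae_restrict_mem measurableSet_Ioc] with s hs1 hs
  have h1 := hs1.of_norm.hasSum
  have h2 := hasSum_gradInner (h.duhamelRoot_tsum_spec hρ hμ hs.1) hX
  have h3 : ∑' p, gradInner (D.duhamelTerm ρ μ v p s) φ =
      inner ℝ (∑' p, D.duhamelRoot ρ μ v p s) X := by
    simp only [fun p => gradInner_eq_inner (D.duhamelRoot_spec ρ μ h.continuous p s) hX]
    have h4 := (innerSL ℝ X).hasSum (h.summable_duhamelRoot hρ hμ hs.1).of_norm.hasSum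
    rw [real_inner_comm, ← innerSL_apply_apply ℝ, ← h4.tsum_eq]
    exact tsum_congr fun p => real_inner_comm _ _
  rw [h3, gradInner_eq_tsum]
  refine ((h1.add h2).congr_fun fun k => ?_).tsum_eq
  have hμs : 0 ≤ μ * s := mul_nonneg (by linarith) hs.1.le
  have h5 : modePairing (v s) φ k = modePairing (heat (μ * s) v₀) φ k +
      modePairing (v s - heat (μ * s) v₀) φ k := by
    simp only [modePairing, fourierCoef_sub, ← Finset.sum_add_distrib, ← Complex.add_re, ← add_mul,
      add_sub_cancel]
  rw [h5, mul_add, modePairing_heat hμs, heatGradMode]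
  ring

lemma continuous_inner_scalarFactor (h : D.IsDecayingMildSolution ρ μ M v₀ v) (φ : L2Torus)
    (p : ℤ × (Fin 3 → Fin m) × shifts) :
    Continuous fun s => (inner ℝ (D.scalarFactor ρ (v s) (v s) p • D.outField ρ p) φ : ℝ) :=
  ((D.continuous_scalarFactor ρ h.continuous h.continuous p).smul continuous_const).inner
    continuous_const

/-- The amplitude bounds give the forcing the factor λ^{2n}w_n², of integral at most 1, times the
geometric decay. -/
lemma summable_integral_nonlin (h : D.IsDecayingMildSolution ρ μ M v₀ v) (hρ : 1 / 4 < ρ)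
    {T : ℝ} (hT : 0 ≤ T) :
    Summable fun p => ∫ s in Ioc 0 T, ‖D.scalarFactor ρ (v s) (v s) p • D.outField ρ p‖ := by
  have hA := D.cascadeConst_nonneg ρ
  refine ((D.summable_decay hρ).mul_left (D.cascadeConst ρ * M ^ 2)).of_nonneg_of_le
    (fun p => integral_nonneg fun _ => norm_nonneg _) fun p => ?_
  have hd0 := (D.decay_pos ρ p).le
  have hc : Continuous fun s => D.scalarFactor ρ (v s) (v s) p • D.outField ρ p :=
    (D.continuous_scalarFactor ρ h.continuous h.continuous p).smul continuous_const
  refine (D.setIntegral_norm_le_of_le (a := 0) (b := D.cascadeConst ρ * D.decay ρ p * M ^ 2) p.1 hT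
    (by positivity) hc.integrableOn_Ioc fun s hs => ?_).trans (le_of_eq (by ring))
  rw [norm_smul, Real.norm_eq_abs]
  refine (D.scalarFactor_mul_norm_le_timeWeight (by linarith) h.nonneg hs.1.le
    (fun i n => h.amplitude_le i n s hs.1.le) p).trans (le_of_eq (by ring))

lemma summable_integral_inner_nonlin (h : D.IsDecayingMildSolution ρ μ M v₀ v) (hρ : 1 / 4 < ρ)
    {T : ℝ} (hT : 0 ≤ T) (φ : L2Torus) :
    Summable fun p => ∫ s in Ioc 0 T,
      ‖(inner ℝ (D.scalarFactor ρ (v s) (v s) p • D.outField ρ p) φ : ℝ)‖ := by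
  refine ((h.summable_integral_nonlin hρ hT).mul_right ‖φ‖).of_nonneg_of_le
    (fun p => integral_nonneg fun _ => norm_nonneg _) fun p => ?_
  have hc : Continuous fun s => D.scalarFactor ρ (v s) (v s) p • D.outField ρ p :=
    (D.continuous_scalarFactor ρ h.continuous h.continuous p).smul continuous_const
  rw [← integral_mul_const]
  refine setIntegral_mono_on (h.continuous_inner_scalarFactor φ p).norm.integrableOn_Ioc
    (hc.norm.mul continuous_const).integrableOn_Ioc measurableSet_Ioc fun s _ => ?_
  exact norm_inner_le_norm _ _

/-- For almost every time the series converges absolutely in L², because the norms are summable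
after integration; at such times it represents F_ρ(v(s)). -/
lemma inner_Frho_ae_eq (h : D.IsDecayingMildSolution ρ μ M v₀ v) (hρ : 1 / 4 < ρ)
    {T : ℝ} (hT : 0 ≤ T) (φ : L2Torus) :
    (fun s => (inner ℝ (D.Frho ρ (v s)) φ : ℝ)) =ᵐ[volume.restrict (Ioc 0 T)]
      fun s => ∑' p, inner ℝ (D.scalarFactor ρ (v s) (v s) p • D.outField ρ p) φ := by
  have hc : ∀ p, Continuous fun s => D.scalarFactor ρ (v s) (v s) p • D.outField ρ p := fun p =>
    (D.continuous_scalarFactor ρ h.continuous h.continuous p).smul continuous_const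
  filter_upwards [ae_summable_norm_of_summable_integral_norm
    (fun p => (hc p).integrableOn_Ioc (a := 0) (b := T)) (h.summable_integral_nonlin hρ hT)]
    with s hs
  have h1 := (innerSL ℝ φ).hasSum (D.hasSum_Frho (by linarith) hs)
  rw [real_inner_comm, ← innerSL_apply_apply ℝ, ← h1.tsum_eq]
  exact tsum_congr fun p => by rw [innerSL_apply_apply, real_inner_comm]

/-- Decaying mild solutions are weak solutions. -/
theorem isWeakSolution {ν : ℝ} (hρ : 1 / 4 < ρ) (hν : 0 ≤ ν)
    (h : D.IsDecayingMildSolution ρ (1 + ν) M v₀ v) {T : ℝ} (hT : 0 < T) :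
    IsWeakSolution (D.Frho ρ) ν v₀ T v := by
  have hμ : 1 ≤ 1 + ν := by linarith
  refine ⟨h.continuous.continuousOn, h.lintegral_sobolevNormSq_lt_top hρ hμ hT.le, ?_,
    fun φ hφ => ?_, fun φ _ => ?_, fun φ hφ t ht => ?_⟩
  · have h0 := h.mild 0 le_rfl
    rw [mul_zero, heat_zero] at h0
    rw [h0]
    have : ∀ p, D.duhamelTerm ρ (1 + ν) v p 0 = 0 := fun p => by
      rw [duhamelTerm, duhamel, intervalIntegral.integral_same]
    simp [this]
  · rw [intervalIntegrable_iff_integrableOn_Ioc_of_le hT.le]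
    refine Integrable.congr ?_ (h.gradInner_ae_eq hρ hμ hT.le hφ).symm
    exact (integrable_tsum_of_summable_integral_norm
      (fun k => integrableOn_heatGradMode _ T v₀ φ k)
      (summable_integral_heatGradMode hμ hT.le v₀ φ)).add
      (integrable_tsum_of_summable_integral_norm
        (fun p => h.integrableOn_gradInner_duhamelTerm φ p T)
        (h.summable_integral_gradInner hρ hμ hT.le hφ))
  · rw [intervalIntegrable_iff_integrableOn_Ioc_of_le hT.le]
    refine Integrable.congr ?_ (h.inner_Frho_ae_eq hρ hT.le φ).symm
    exact integrable_tsum_of_summable_integral_norm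
      (fun p => (h.continuous_inner_scalarFactor φ p).integrableOn_Ioc)
      (h.summable_integral_inner_nonlin hρ hT.le φ)
  · have ht0 := ht.1
    -- The weak identity of each Duhamel term is summed; all three series converge, and the sums of
    -- the two series of integrals are integrals of the sums.
    have hz : (inner ℝ (v t - heat ((1 + ν) * t) v₀) φ : ℝ) =
        -(1 + ν) * (∫ s in Ioc 0 t, ∑' p, gradInner (D.duhamelTerm ρ (1 + ν) v p s) φ) +
        ∫ s in Ioc 0 t, ∑' p, (inner ℝ (D.scalarFactor ρ (v s) (v s) p • D.outField ρ p) φ : ℝ) := by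
      have h1 := (innerSL ℝ φ).hasSum (h.hasSum_duhamelTerm hρ hμ ht0)
      have h2 := hasSum_integral_of_summable_integral_norm
        (fun p => h.integrableOn_gradInner_duhamelTerm φ p t)
        (h.summable_integral_gradInner hρ hμ ht0 hφ)
      have h3 := hasSum_integral_of_summable_integral_norm
        (fun p => (h.continuous_inner_scalarFactor φ p).integrableOn_Ioc (a := 0) (b := t))
        (h.summable_integral_inner_nonlin hρ ht0 φ)
      rw [real_inner_comm]
      refine h1.unique (((h2.mul_left (-(1 + ν))).add h3).congr_fun fun p => ?_)
      rw [← intervalIntegral.integral_of_le ht0, ← intervalIntegral.integral_of_le ht0,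
        innerSL_apply_apply, real_inner_comm]
      exact inner_duhamel_eq (by linarith) (D.continuous_scalarFactor ρ h.continuous h.continuous p)
        (D.finite_outFreq p) (D.supported_outField ρ p) φ ht0
    have hg : ∫ s in (0 : ℝ)..t, gradInner (v s) φ =
        (∫ s in Ioc 0 t, ∑' k, heatGradMode (1 + ν) v₀ φ k s) +
        ∫ s in Ioc 0 t, ∑' p, gradInner (D.duhamelTerm ρ (1 + ν) v p s) φ := by
      rw [intervalIntegral.integral_of_le ht0, integral_congr_ae (h.gradInner_ae_eq hρ hμ ht0 hφ)]
      exact integral_add (integrable_tsum_of_summable_integral_norm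
        (fun k => integrableOn_heatGradMode _ t v₀ φ k)
        (summable_integral_heatGradMode hμ ht0 v₀ φ))
        (integrable_tsum_of_summable_integral_norm
          (fun p => h.integrableOn_gradInner_duhamelTerm φ p t)
          (h.summable_integral_gradInner hρ hμ ht0 hφ))
    have hn : ∫ s in (0 : ℝ)..t, (inner ℝ (D.Frho ρ (v s)) φ : ℝ) =
        ∫ s in Ioc 0 t, ∑' p, (inner ℝ (D.scalarFactor ρ (v s) (v s) p • D.outField ρ p) φ : ℝ) := by
      rw [intervalIntegral.integral_of_le ht0, integral_congr_ae (h.inner_Frho_ae_eq hρ ht0 φ)]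
    have hh := inner_heat_eq hμ ht0 v₀ φ
    rw [inner_sub_left] at hz
    rw [hg, hn]
    linarith

end IsDecayingMildSolution

/-- For every radius there is a viscosity for which all data in the ball of `L²` have global weak
solutions, bounded uniformly in time. -/
theorem exists_globalSolution {ρ R : ℝ} (hρ : 1 / 4 < ρ) (hR : 0 ≤ R) :
    ∃ ν : ℝ, 0 < ν ∧ ∀ v₀ : L2Torus, ‖v₀‖ ≤ R → ∃ v : ℝ → L2Torus,
      (∀ S : ℝ, 0 < S → IsWeakSolution (D.Frho ρ) ν v₀ S v) ∧ ∀ t, ‖v t‖ ≤ R + 1 := by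
  have hA := D.cascadeConst_nonneg ρ
  have hΘ : 0 ≤ ∑' p, D.decay ρ p := tsum_nonneg fun p => (D.decay_pos ρ p).le
  -- The threshold of the fixed point argument, plus 1 to keep ν positive. It depends on R but not
  -- on a time horizon.
  refine ⟨4 * D.cascadeConst ρ * (R + 1) ^ 2 * ∑' p, D.decay ρ p + 1, by positivity,
    fun v₀ hv₀ => ?_⟩
  have h0 : 0 ≤ 4 * D.cascadeConst ρ * (R + 1) ^ 2 * ∑' p, D.decay ρ p := by positivity
  obtain ⟨v, hvc, hvn, hva, hvm⟩ := D.exists_mildSolution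
    (μ := 1 + (4 * D.cascadeConst ρ * (R + 1) ^ 2 * ∑' p, D.decay ρ p + 1)) hρ hR (by linarith)
    (by linarith) hv₀
  exact ⟨v, fun S hS => IsDecayingMildSolution.isWeakSolution hρ (by positivity)
    ⟨hvc, hvn, hva, hvm⟩ hS, hvn⟩

end CascadeData

/-! ### The mean-zero balls -/

lemma meanZeroBall_eq (R : ℝ) : meanZeroBall R =
    {f | ∀ j, fourierCLM 0 j f = 0} ∩ Metric.closedBall 0 R := by
  ext f
  simp [meanZeroBall, meanZero_iff]

lemma convex_meanZeroBall (R : ℝ) : Convex ℝ (meanZeroBall R) := by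
  rw [meanZeroBall_eq]
  refine Convex.inter ?_ (convex_closedBall 0 R)
  intro f hf g hg a b _ _ _ j
  rw [map_add, map_smul, map_smul, hf j, hg j, smul_zero, smul_zero, add_zero]

lemma isClosed_meanZeroBall (R : ℝ) : IsClosed (meanZeroBall R) := by
  rw [meanZeroBall_eq]
  refine IsClosed.inter ?_ Metric.isClosed_closedBall
  have : {f : L2Torus | ∀ j, fourierCLM 0 j f = 0} = ⋂ j, {f | fourierCLM 0 j f = 0} := by
    ext f; simp
  rw [this]
  exact isClosed_iInter fun j => isClosed_eq (fourierCLM 0 j).continuous continuous_const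

lemma isBounded_meanZeroBall (R : ℝ) : Bornology.IsBounded (meanZeroBall R) := by
  rw [meanZeroBall_eq]
  exact Metric.isBounded_closedBall.subset inter_subset_right

/-- Hypothesis (H4) for the mean-zero balls. -/
theorem hypothesisH4_meanZeroBall {m : ℕ} (D : CascadeData m) {ρ : ℝ} (hρ : 1 / 4 < ρ) {R : ℝ}
    (hR : 0 ≤ R) : HypothesisH4 (D.Frho ρ) (meanZeroBall R) := by
  refine ⟨convex_meanZeroBall R, isClosed_meanZeroBall R, isBounded_meanZeroBall R,
    fun T _ => ?_⟩
  obtain ⟨ν, hν, h⟩ := D.exists_globalSolution hρ hR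
  choose! sol h1 h2 using h
  exact ⟨ν, hν, sol, fun v₀ hv₀ => h1 v₀ hv₀.2, R + 1, fun v₀ hv₀ t _ => h2 v₀ hv₀.2 t⟩

end AveragedNSE

end

/-! ### The three assertions combined. -/

theorem mainTheorem7 {m : ℕ} (D : AveragedNSE.CascadeData m) (ρ : ℝ) (hρ : 1 / 4 < ρ) :
    -- on `H¹` the series of `F_ρ(v)` converges absolutely in `L²`, with sum `F_ρ(v)` of zero mean
    (∀ v : AveragedNSE.L2Torus, AveragedNSE.InSobolev 1 v →
      Summable (fun p => ‖D.coef (AveragedNSE.besselPow (-ρ) v) (AveragedNSE.besselPow (-ρ) v) p •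
        AveragedNSE.besselPow ρ (D.outWavelet p)‖) ∧
      HasSum (fun p => D.coef (AveragedNSE.besselPow (-ρ) v) (AveragedNSE.besselPow (-ρ) v) p •
        AveragedNSE.besselPow ρ (D.outWavelet p)) (D.Frho ρ v) ∧
      AveragedNSE.MeanZero (D.Frho ρ v)) ∧
    -- the dynamics preserve the mean-zero vector fields
    (∀ (ν T : ℝ) (v₀ : AveragedNSE.L2Torus) (v : ℝ → AveragedNSE.L2Torus), 0 ≤ ν → 0 < T →
      AveragedNSE.IsWeakSolution (D.Frho ρ) ν v₀ T v → AveragedNSE.MeanZero v₀ →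
      ∀ t ∈ Set.Icc 0 T, AveragedNSE.MeanZero (v t)) ∧
    -- hypothesis (H4) holds with every mean-zero ball
    (∀ R : ℝ, 0 ≤ R →
      AveragedNSE.HypothesisH4 (D.Frho ρ) (AveragedNSE.meanZeroBall R)) := by
  refine ⟨fun v hv => ?_, fun ν T v₀ v _ _ h h₀ t ht => h.meanZero (D.meanZero_Frho ρ) h₀ ht,
    fun R hR => AveragedNSE.hypothesisH4_meanZeroBall D hρ hR⟩
  have hs := D.summable_Frho_of_sobolev hρ hv
  simp only [D.coef_besselPow (by linarith : 0 ≤ ρ)]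
  exact ⟨hs, D.hasSum_Frho (by linarith) hs, D.meanZero_Frho ρ v⟩
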